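/- Let $M$ be a closed (compact, boundaryless, Hausdorff) connected orientable $C^\infty$ manifold of dimension $n\ge 2$ with a $C^\infty$ volume form $\omega$ (by which $M$ is oriented), and fix a finite regular smooth atlas $(V_i,\phi_i)_{i\le m}$ of $M$: for some $\lambda>0$, each $\phi_i(V_i)$ is the open ball $B=\lambda\mathbb B^n$, and $\phi_i$ is the restriction to $V_i$ of a smooth chart whose domain $W_i$ contains $\overline{V_i}$. Let $\mathrm{div}$ be the divergence with respect to $\omega$. For a function or vector field $X$ on $M$, let $X_i$ be its expression in the chart $\phi_i$, a map on $B$. For an integer $r\ge1$ and $0\le\alpha\le1$, $X$ is of class $C^{r,\alpha}$ if it is $C^r$ and, in case $\alpha>0$, the derivatives of order $r$ of all $X_i$ are $\alpha$-Hölder continuous on $B$ (so $C^{r,0}=C^r$), and $$\|X\|_{C^{r,\alpha}}=\max_i\max\Big(\max_{0\le k\le r}\sup_{B}\|D^kX_i\|,\ [D^rX_i]_{\alpha;B}\Big),$$ where the $\alpha$-Hölder seminorm $[\cdot]_{\alpha;B}$ is omitted if $\alpha=0$. Let $\Omega_1,\Omega\subset M$ be connected open sets with $\overline{\Omega_1}\subset\Omega$,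 and put $$\mathcal A=\Big\{h\in C^1(M):\int_\Omega h\,\omega=0,\ \operatorname{supp}h\subset\Omega_1\Big\},\qquad \mathcal B=\{v\ \text{a } C^1 \text{ vector field on } M:\ \operatorname{supp}v\subset\Omega\}.$$ Then there is a linear operator $\Phi:\mathcal A\to\mathcal B$ with $\mathrm{div}\,\Phi(h)=h$ for all $h\in\mathcal A$ and such that, for every integer $r\ge1$, there is a constant $C\ge1$ depending only on $r,\Omega_1,\Omega$ (for the fixed $M$, $\omega$ and atlas), and in particular not on $\alpha$, for which the following holds: for all $0\le\alpha\le1$ and all $h\in\mathcal A$ of class $C^{r,\alpha}$, the field $v=\Phi(h)$ is of class $C^{r,\alpha}$ and $$\|v\|_{C^{r,\alpha}}\le C\,\|h\|_{C^{r,\alpha}}.$$ -/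

import Mathlib

open scoped Manifold ContDiff NNReal ENNReal Topology

noncomputable section

namespace DivEq

/-- Euclidean space `ℝⁿ`, with the Euclidean norm. -/
abbrev Eucl (n : ℕ) : Type := EuclideanSpace ℝ (Fin n)

/-! ### Volume forms, divergence -/

section Forms

variable {n : ℕ} {M : Type*} [TopologicalSpace M] [ChartedSpace (Eucl n) M]

/-- The coefficient `ρ` of an `n`-form `vol` in the chart `e`, i.e. `(e⁻¹)^* vol = ρ dy₁ ∧ ⋯ ∧ dyₙ`
on `e.target`. -/
def density (vol : ∀ x : M, (TangentSpace (𝓡 n) x) [⋀^Fin n]→ₗ[ℝ] ℝ)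
    (e : OpenPartialHomeomorph M (Eucl n)) (y : Eucl n) : ℝ :=
  vol (e.symm y) (fun i : Fin n =>
    mfderiv (𝓡 n) (𝓡 n) e.symm y (EuclideanSpace.single i (1 : ℝ) : Eucl n))

/-- The expression in the chart `e` of a vector field `v` (the push-forward `e_* v`),
a map `ℝⁿ → ℝⁿ` that is meaningful on `e.target`. -/
def fieldInChart (v : ∀ x : M, TangentSpace (𝓡 n) x)
    (e : OpenPartialHomeomorph M (Eucl n)) (y : Eucl n) : Eucl n :=
  mfderiv (𝓡 n) (𝓡 n) e (e.symm y) (v (e.symm y))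

variable (n M) in
/-- A smooth volume form on a manifold of dimension `n`: a nowhere vanishing `n`-form with smooth
coefficient in every chart. Its existence makes the manifold orientable, and the manifold is
oriented by it. -/
structure VolumeForm where
  toFun : ∀ x : M, (TangentSpace (𝓡 n) x) [⋀^Fin n]→ₗ[ℝ] ℝ
  ne_zero : ∀ x, toFun x ≠ 0
  smooth : ∀ e ∈ IsManifold.maximalAtlas (𝓡 n) ∞ M, ContDiffOn ℝ ∞ (density toFun e) e.target

/-- The divergence of a vector field with respect to a volume form. In a chart in which the form is
`ρ dy₁ ∧ ⋯ ∧ dyₙ` and the field is `X`, it is `ρ⁻¹ ∑ᵢ ∂ᵢ (ρ Xᵢ)`; the chart at `x` is used to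
compute it at `x`. -/
def divergence (vol : VolumeForm n M) (v : ∀ x : M, TangentSpace (𝓡 n) x) (x : M) : ℝ :=
  (density vol.toFun (chartAt (Eucl n) x) (chartAt (Eucl n) x x))⁻¹ *
    LinearMap.trace ℝ (Eucl n)
      (fderiv ℝ (fun y => density vol.toFun (chartAt (Eucl n) x) y •
        fieldInChart v (chartAt (Eucl n) x) y) (chartAt (Eucl n) x x) : Eucl n →ₗ[ℝ] Eucl n)

end Forms

/-! ### Finite regular atlases, integration -/

/-- A finite regular smooth atlas `(V i, φ i)`: every `φ i` is the restriction to `V i` of a chart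
`chart i` with a larger domain `W i`, `φ i (V i)` is the open ball `B` of radius `radius` about `0`,
the closed ball is contained in the image of `W i` (so that `closure (V i) ⊆ W i`), and the `V i`
cover the manifold. -/
structure RegularAtlas (n : ℕ) (M : Type*) [TopologicalSpace M] [ChartedSpace (Eucl n) M] where
  m : ℕ
  chart : Fin m → OpenPartialHomeomorph M (Eucl n)
  radius : ℝ
  radius_pos : 0 < radius
  mem_maximalAtlas : ∀ i, chart i ∈ IsManifold.maximalAtlas (𝓡 n) ∞ M
  closedBall_subset : ∀ i, Metric.closedBall 0 radius ⊆ (chart i).target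
  cover : ∀ x : M, ∃ i, x ∈ (chart i).source ∧ chart i x ∈ Metric.ball 0 radius

section Atlas

variable {n : ℕ} {M : Type*} [TopologicalSpace M] [ChartedSpace (Eucl n) M]

/-- The common image `B` in `ℝⁿ` of the chart domains `V i`. -/
def RegularAtlas.ball (A : RegularAtlas n M) : Set (Eucl n) := Metric.ball 0 A.radius

/-- The chart domain `V i`. -/
def RegularAtlas.dom (A : RegularAtlas n M) (i : Fin A.m) : Set M :=
  (A.chart i).source ∩ A.chart i ⁻¹' A.ball

/-- The part of `φ i (V i)` that represents the points of `S` outside all `V j`, `j < i`. These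
pieces, over all `i`, represent every point of `S` exactly once. -/
def RegularAtlas.piece (A : RegularAtlas n M) (S : Set M) (i : Fin A.m) : Set (Eucl n) :=
  A.ball ∩ (A.chart i).symm ⁻¹' (S \ ⋃ j < i, A.dom j)

/-- The integral `∫_S h vol`, for the orientation given by `vol`, computed by cutting `S` into pieces
that lie in one chart each. -/
def integral (A : RegularAtlas n M) (vol : VolumeForm n M) (S : Set M) (h : M → ℝ) : ℝ :=
  ∑ i, ∫ y in A.piece S i, h ((A.chart i).symm y) * |density vol.toFun (A.chart i) y|

theorem integrableOn_piece (A : RegularAtlas n M) (vol : VolumeForm n M) (S : Set M) {h : M → ℝ}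
    (hh : Continuous h) (i : Fin A.m) :
    MeasureTheory.IntegrableOn
      (fun y => h ((A.chart i).symm y) * |density vol.toFun (A.chart i) y|) (A.piece S i) := by
  have hc : ContinuousOn (fun y => h ((A.chart i).symm y) * |density vol.toFun (A.chart i) y|)
      (Metric.closedBall 0 A.radius) := by
    refine ContinuousOn.mul ?_ ?_
    · exact hh.comp_continuousOn ((A.chart i).continuousOn_symm.mono (A.closedBall_subset i))
    · exact (((vol.smooth _ (A.mem_maximalAtlas i)).continuousOn).mono (A.closedBall_subset i)).abs
  exact (hc.integrableOn_compact (isCompact_closedBall _ _)).mono_set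
    (Set.inter_subset_left.trans Metric.ball_subset_closedBall)

/-! ### The function spaces -/

/-- The space of the `C¹` functions `h` with `∫_Ω h vol = 0` and `supp h ⊆ Ω₁`. -/
def sourceSpace (A : RegularAtlas n M) (vol : VolumeForm n M) (Ω₁ Ω : Set M) :
    Submodule ℝ (M → ℝ) where
  carrier := {h | ContMDiff (𝓡 n) 𝓘(ℝ, ℝ) 1 h ∧ integral A vol Ω h = 0 ∧ tsupport h ⊆ Ω₁}
  zero_mem' := by
    refine ⟨contMDiff_const, ?_, ?_⟩
    · simp [integral]
    · simp [tsupport]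
  add_mem' := by
    rintro f g ⟨hf, hf0, hfs⟩ ⟨hg, hg0, hgs⟩
    refine ⟨hf.add hg, ?_, (tsupport_add f g).trans (Set.union_subset hfs hgs)⟩
    have : integral A vol Ω (f + g) = integral A vol Ω f + integral A vol Ω g := by
      simp only [integral, ← Finset.sum_add_distrib, Pi.add_apply, add_mul]
      exact Finset.sum_congr rfl fun i _ => MeasureTheory.integral_add
        (integrableOn_piece A vol Ω hf.continuous i) (integrableOn_piece A vol Ω hg.continuous i)
    rw [this, hf0, hg0, add_zero]
  smul_mem' := by
    rintro c f ⟨hf, hf0, hfs⟩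
    refine ⟨(contMDiff_const (c := c)).mul hf, ?_, (closure_mono ?_).trans hfs⟩
    · have : integral A vol Ω (c • f) = c * integral A vol Ω f := by
        simp only [integral, Finset.mul_sum, Pi.smul_apply, smul_eq_mul, mul_assoc,
          MeasureTheory.integral_const_mul]
      rw [this, hf0, mul_zero]
    · exact Function.support_const_smul_subset c f

/-- The space of the `C¹` vector fields `v` with `supp v ⊆ Ω`. -/
def targetSpace [IsManifold (𝓡 n) ∞ M] (Ω : Set M) :
    Submodule ℝ (∀ x : M, TangentSpace (𝓡 n) x) where
  carrier := {v | ContMDiff (𝓡 n) (𝓡 n).tangent 1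
      (fun x => (⟨x, v x⟩ : TangentBundle (𝓡 n) M)) ∧ closure {x | v x ≠ 0} ⊆ Ω}
  zero_mem' := by
    have : IsManifold (𝓡 n) 1 M := IsManifold.of_le (n := ∞) (by exact_mod_cast le_top)
    exact ⟨Bundle.contMDiff_zeroSection ℝ (TangentSpace (𝓡 n) : M → Type _), by simp⟩
  add_mem' := by
    rintro v w ⟨hv, hvs⟩ ⟨hw, hws⟩
    refine ⟨hv.add_section hw, ?_⟩
    refine (closure_mono (t := {x | v x ≠ 0} ∪ {x | w x ≠ 0}) ?_).trans ?_
    · intro x hx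
      by_contra hcon
      simp only [Set.mem_union, Set.mem_ofPred_eq, not_or, not_not] at hcon
      exact hx (by simp [hcon.1, hcon.2])
    · rw [closure_union]
      exact Set.union_subset hvs hws
  smul_mem' := by
    rintro c v ⟨hv, hvs⟩
    refine ⟨hv.const_smul_section, (closure_mono ?_).trans hvs⟩
    intro x hx hx0
    exact hx (by simp [hx0])

/-! ### Hölder classes and norms -/

section Holder

variable {F : Type*} [NormedAddCommGroup F] [NormedSpace ℝ F]

/-- For `0 < α`, the derivative of order `r` of `f` is `α`-Hölder continuous on `D`; no condition
for `α = 0`. -/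
def HolderDeriv (D : Set (Eucl n)) (r : ℕ) (α : ℝ≥0) (f : Eucl n → F) : Prop :=
  α ≠ 0 → MemHolder α (D.domRestrict (iteratedFDeriv ℝ r f))

/-- The `C^{r,α}` norm of `f` on the open set `D`: the largest among the suprema on `D` of the
operator norms of the derivatives of order at most `r` and, if `0 < α`, the `α`-Hölder seminorm on
`D` of the derivative of order `r`. -/
def holderNormOn (D : Set (Eucl n)) (r : ℕ) (α : ℝ≥0) (f : Eucl n → F) : ℝ≥0∞ :=
  max (⨆ k ≤ r, ⨆ y ∈ D, ‖iteratedFDeriv ℝ k f y‖ₑ)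
    (if α = 0 then 0 else eHolderNorm α (D.domRestrict (iteratedFDeriv ℝ r f)))

end Holder

/-- The function `h` on the manifold is of class `C^{r,α}` (with `C^{r,0} = C^r`). -/
def FunIsHolder (A : RegularAtlas n M) (r : ℕ) (α : ℝ≥0) (h : M → ℝ) : Prop :=
  ContMDiff (𝓡 n) 𝓘(ℝ, ℝ) r h ∧
    ∀ i, HolderDeriv A.ball r α (fun y => h ((A.chart i).symm y))

/-- The `C^{r,α}` norm of a function, the maximum over the charts of the atlas. -/
def funNorm (A : RegularAtlas n M) (r : ℕ) (α : ℝ≥0) (h : M → ℝ) : ℝ≥0∞ :=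
  ⨆ i, holderNormOn A.ball r α (fun y => h ((A.chart i).symm y))

/-- The vector field `v` is of class `C^{r,α}` (with `C^{r,0} = C^r`). -/
def FieldIsHolder [IsManifold (𝓡 n) ∞ M] (A : RegularAtlas n M) (r : ℕ) (α : ℝ≥0)
    (v : ∀ x : M, TangentSpace (𝓡 n) x) : Prop :=
  ContMDiff (𝓡 n) (𝓡 n).tangent r (fun x => (⟨x, v x⟩ : TangentBundle (𝓡 n) M)) ∧
    ∀ i, HolderDeriv A.ball r α (fieldInChart v (A.chart i))

/-- The `C^{r,α}` norm of a vector field, the maximum over the charts of the atlas. -/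
def fieldNorm (A : RegularAtlas n M) (r : ℕ) (α : ℝ≥0)
    (v : ∀ x : M, TangentSpace (𝓡 n) x) : ℝ≥0∞ :=
  ⨆ i, holderNormOn A.ball r α (fieldInChart v (A.chart i))

end Atlas

end DivEq

end

noncomputable section

namespace DivEq

/-! ### Calculus of derivative and Hölder bounds, uniform in the exponent -/

section HolderBound

set_option maxSynthPendingDepth 3

variable {E F G H : Type} [NormedAddCommGroup E] [NormedSpace ℝ E]
  [NormedAddCommGroup F] [NormedSpace ℝ F] [NormedAddCommGroup G] [NormedSpace ℝ G]
  [NormedAddCommGroup H] [NormedSpace ℝ H]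

/-! The right inverse of the divergence is built without singular integrals, which is why it loses
nothing at `α = 0` or `α = 1` and its constants do not depend on `α`.

In Euclidean space, let `θ` be a bump function of mass one about `0`. Moving mass along straight
segments gives two fields. The field `∫∫ θ(y) f(x - s y) y ds dy`, with `s` in `[0,1]`, has
divergence `f - θ ∗ f`. The field `∫∫ f(y) θ(x - c - s (y - c)) (y - c) ds dy` has divergence `(∫ f)
θ(· - c) - θ ∗ f`. Their difference (`localOperator`) is linear in `f` and has divergence `f - (∫ f)
θ(· - c)` (`trace_fderiv_localOperator`). Both fields are superpositions of translates, of `f` with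
a fixed integrable weight and of the smooth `θ` with weight controlled by `sup |f|`. Translates
satisfy the same bounds, so the `C^{r,α}` bounds of `f` pass to the difference
(`exists_holderBound_localOperator`).

On the manifold, `closure Ω₁` is covered by finitely many coordinate balls whose doubles lie in `Ω`,
with a subordinate partition of unity `χ j`. In each ball, `χ j * h` is multiplied by the density,
solved by the local operator, divided by the density and pushed forward. The Piola identity
(`trace_fderiv_piola`) makes the divergence independent of the chart. What remains is `∫ χ j h`
times a bump function of mass one in the `j`-th ball (`LocalBall.divergence_solve`).

Connectedness of `Ω` removes these remainders. The difference of the bump functions of any two balls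
is the divergence of a smooth field supported in `Ω` (`linked_of_isPreconnected`), so all remainders
move to a single ball by fixed fields with scalar coefficients. There they add up to `∫_Ω h = 0`
(`divergence_sum_localSolution`). -/

theorem le_max_mul_rpow {α t R : ℝ} (hα0 : 0 ≤ α) (hα : α ≤ 1) (ht : 0 ≤ t) (htR : t ≤ R) :
    t ≤ max 1 R * t ^ α := by
  rcases ht.eq_or_lt with rfl | ht'
  · exact mul_nonneg (le_max_of_le_left zero_le_one) (Real.rpow_nonneg le_rfl _)
  · calc t = t ^ (1 - α) * t ^ α := by rw [← Real.rpow_add ht']; simp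
      _ ≤ max 1 R * t ^ α := by
        gcongr
        calc t ^ (1 - α) ≤ (max 1 R) ^ (1 - α) :=
              Real.rpow_le_rpow ht (htR.trans (le_max_right _ _)) (by linarith)
          _ ≤ (max 1 R) ^ (1 : ℝ) :=
              Real.rpow_le_rpow_of_exponent_le (le_max_left _ _) (by linarith)
          _ = _ := Real.rpow_one _

/-- All derivatives of `f` of order at most `r` are bounded by `K` on `D`, and so are their
`α`-Hölder quotients. -/
def HolderBound (r : ℕ) (α : ℝ) (D : Set E) (K : ℝ) (f : E → F) : Prop :=
  ∀ k ≤ r, (∀ x ∈ D, ‖iteratedFDeriv ℝ k f x‖ ≤ K) ∧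
    ∀ x ∈ D, ∀ y ∈ D, ‖iteratedFDeriv ℝ k f x - iteratedFDeriv ℝ k f y‖ ≤ K * ‖x - y‖ ^ α

theorem norm_iteratedFDeriv_zero_sub (f : E → F) (x y : E) :
    ‖iteratedFDeriv ℝ 0 f x - iteratedFDeriv ℝ 0 f y‖ = ‖f x - f y‖ := by
  simp only [iteratedFDeriv_zero_eq_comp, Function.comp, ← map_sub, LinearIsometryEquiv.norm_map]

theorem norm_iteratedFDeriv_succ_sub (k : ℕ) (f : E → F) (x y : E) :
    ‖iteratedFDeriv ℝ (k + 1) f x - iteratedFDeriv ℝ (k + 1) f y‖ =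
      ‖iteratedFDeriv ℝ k (fderiv ℝ f) x - iteratedFDeriv ℝ k (fderiv ℝ f) y‖ := by
  rw [iteratedFDeriv_succ_eq_comp_right, iteratedFDeriv_succ_eq_comp_right,
    Function.comp_apply, Function.comp_apply, ← LinearIsometryEquiv.map_sub, LinearIsometryEquiv.norm_map]

theorem holderBound_zero {α : ℝ} {D : Set E} {K : ℝ} {f : E → F} :
    HolderBound 0 α D K f ↔ (∀ x ∈ D, ‖f x‖ ≤ K) ∧
      ∀ x ∈ D, ∀ y ∈ D, ‖f x - f y‖ ≤ K * ‖x - y‖ ^ α := by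
  simp [HolderBound, norm_iteratedFDeriv_zero_sub]

/-- Since the bounds are imposed at every order and not only at the top one, a derivative can be
peeled off. The inductions for products, compositions and superpositions all reduce in this way to
order zero, with values in spaces of operators. -/
theorem holderBound_succ {r : ℕ} {α : ℝ} {D : Set E} {K : ℝ} {f : E → F} :
    HolderBound (r + 1) α D K f ↔ HolderBound 0 α D K f ∧ HolderBound r α D K (fderiv ℝ f) := by
  constructor
  · intro h
    refine ⟨fun k hk => h k (by omega), fun k hk => ?_⟩
    have := h (k + 1) (by omega)
    simpa only [norm_iteratedFDeriv_succ_sub, norm_iteratedFDeriv_fderiv] using this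
  · rintro ⟨h0, h⟩ k hk
    rcases k with _ | k
    · exact h0 0 le_rfl
    · have := h k (by omega)
      simpa only [norm_iteratedFDeriv_succ_sub, norm_iteratedFDeriv_fderiv] using this

namespace HolderBound

variable {r : ℕ} {α : ℝ} {D : Set E} {K L : ℝ} {f : E → F}

theorem of_le (h : HolderBound r α D K f) {s : ℕ} (hs : s ≤ r) : HolderBound s α D K f :=
  fun k hk => h k (hk.trans hs)

theorem mono (h : HolderBound r α D K f) (hKL : K ≤ L) : HolderBound r α D L f := fun k hk =>
  ⟨fun x hx => ((h k hk).1 x hx).trans hKL, fun x hx y hy => ((h k hk).2 x hx y hy).trans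
    (mul_le_mul_of_nonneg_right hKL (Real.rpow_nonneg (norm_nonneg _) _))⟩

theorem mono_set (h : HolderBound r α D K f) {D' : Set E} (hD : D' ⊆ D) :
    HolderBound r α D' K f := fun k hk =>
  ⟨fun x hx => (h k hk).1 x (hD hx), fun x hx y hy => (h k hk).2 x (hD hx) y (hD hy)⟩

theorem norm_le (h : HolderBound r α D K f) {x : E} (hx : x ∈ D) : ‖f x‖ ≤ K := by
  simpa using (h 0 (Nat.zero_le _)).1 x hx

theorem congr (hD : IsOpen D) (h : HolderBound r α D K f) {g : E → F} (hfg : Set.EqOn g f D) :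
    HolderBound r α D K g := by
  have key : ∀ k, ∀ x ∈ D, iteratedFDeriv ℝ k g x = iteratedFDeriv ℝ k f x := fun k x hx =>
    ((hfg.eventuallyEq_of_mem (hD.mem_nhds hx)).iteratedFDeriv ℝ k).self_of_nhds
  intro k hk
  refine ⟨fun x hx => ?_, fun x hx y hy => ?_⟩
  · rw [key k x hx]; exact (h k hk).1 x hx
  · rw [key k x hx, key k y hy]; exact (h k hk).2 x hx y hy

theorem add (hD : IsOpen D) (h : HolderBound r α D K f) {g : E → F} (hg : HolderBound r α D L g)
    (hfc : ContDiffOn ℝ r f D) (hgc : ContDiffOn ℝ r g D) :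
    HolderBound r α D (K + L) (fun x => f x + g x) := by
  have key : ∀ k ≤ r, ∀ x ∈ D, iteratedFDeriv ℝ k (fun x => f x + g x) x =
      iteratedFDeriv ℝ k f x + iteratedFDeriv ℝ k g x := fun k hk x hx =>
    fun_iteratedFDeriv_add_apply (((hfc.contDiffAt (hD.mem_nhds hx))).of_le (by exact_mod_cast hk))
      (((hgc.contDiffAt (hD.mem_nhds hx))).of_le (by exact_mod_cast hk))
  intro k hk
  refine ⟨fun x hx => ?_, fun x hx y hy => ?_⟩
  · rw [key k hk x hx]
    exact (norm_add_le _ _).trans (add_le_add ((h k hk).1 x hx) ((hg k hk).1 x hx))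
  · rw [key k hk x hx, key k hk y hy, add_sub_add_comm, add_mul]
    exact (norm_add_le _ _).trans (add_le_add ((h k hk).2 x hx y hy) ((hg k hk).2 x hx y hy))

theorem zero (hK : 0 ≤ K) : HolderBound r α D K (fun _ => 0 : E → F) := by
  intro k hk
  have : iteratedFDeriv ℝ k (fun _ => 0 : E → F) = 0 := iteratedFDeriv_fun_zero
  simp only [this, Pi.zero_apply, norm_zero, sub_self]
  exact ⟨fun _ _ => hK, fun x _ y _ => mul_nonneg hK (Real.rpow_nonneg (norm_nonneg _) _)⟩

theorem const_smul (hD : IsOpen D) (c : ℝ) (h : HolderBound r α D K f) (hfc : ContDiffOn ℝ r f D) :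
    HolderBound r α D (|c| * K) (fun x => c • f x) := by
  have key : ∀ k ≤ r, ∀ x ∈ D, iteratedFDeriv ℝ k (fun x => c • f x) x =
      c • iteratedFDeriv ℝ k f x := fun k hk x hx =>
    iteratedFDeriv_const_smul_apply'
      (((hfc.contDiffAt (hD.mem_nhds hx))).of_le (by exact_mod_cast hk))
  intro k hk
  refine ⟨fun x hx => ?_, fun x hx y hy => ?_⟩
  · rw [key k hk x hx, norm_smul, Real.norm_eq_abs]
    exact mul_le_mul_of_nonneg_left ((h k hk).1 x hx) (abs_nonneg _)
  · rw [key k hk x hx, key k hk y hy, ← smul_sub, norm_smul, Real.norm_eq_abs, mul_assoc]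
    exact mul_le_mul_of_nonneg_left ((h k hk).2 x hx y hy) (abs_nonneg _)

theorem sum (hD : IsOpen D) {ι : Type*} (s : Finset ι) {K : ι → ℝ} {f : ι → E → F}
    (hf : ∀ i ∈ s, HolderBound r α D (K i) (f i)) (hfc : ∀ i ∈ s, ContDiffOn ℝ r (f i) D) :
    HolderBound r α D (∑ i ∈ s, K i) (fun x => ∑ i ∈ s, f i x) := by
  classical
  induction s using Finset.induction_on with
  | empty => simpa using zero le_rfl
  | insert a s ha ih =>
    simp only [Finset.sum_insert ha]
    exact add hD (hf a (Finset.mem_insert_self _ _))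
      (ih (fun i hi => hf i (Finset.mem_insert_of_mem hi))
        fun i hi => hfc i (Finset.mem_insert_of_mem hi)) (hfc a (Finset.mem_insert_self _ _))
      (ContDiffOn.sum fun i hi => hfc i (Finset.mem_insert_of_mem hi))

/-- The Leibniz rule writes the derivative as two bilinear expressions, in `(f, Dg)` and `(Df, g)`,
whose bilinear maps have norm at most `‖B‖`. Each order therefore doubles the constant. -/
theorem bilin (hD : IsOpen D) (B : F →L[ℝ] G →L[ℝ] H) {g : E → G} (hK : 0 ≤ K) (hL : 0 ≤ L)
    (hf : HolderBound r α D K f) (hg : HolderBound r α D L g)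
    (hfc : ContDiffOn ℝ r f D) (hgc : ContDiffOn ℝ r g D) :
    HolderBound r α D (2 ^ (r + 1) * ‖B‖ * K * L) (fun x => B (f x) (g x)) := by
  have base : ∀ {F G H : Type} [NormedAddCommGroup F] [NormedSpace ℝ F] [NormedAddCommGroup G]
      [NormedSpace ℝ G] [NormedAddCommGroup H] [NormedSpace ℝ H] (B : F →L[ℝ] G →L[ℝ] H)
      {f : E → F} {g : E → G}, HolderBound 0 α D K f → HolderBound 0 α D L g →
      HolderBound 0 α D (2 * ‖B‖ * K * L) (fun x => B (f x) (g x)) := by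
    intro F G H _ _ _ _ _ _ B f g hf hg
    rw [holderBound_zero] at *
    have h1 : ∀ (a : F) (b : G) (s t : ℝ), ‖a‖ ≤ s → ‖b‖ ≤ t → 0 ≤ s →
        ‖B a b‖ ≤ ‖B‖ * s * t := fun a b s t ha hb hs => (B.le_opNorm₂ a b).trans (by gcongr)
    refine ⟨fun x hx => (h1 _ _ _ _ (hf.1 x hx) (hg.1 x hx) hK).trans ?_, fun x hx y hy => ?_⟩
    · have : 0 ≤ ‖B‖ * K * L := by positivity
      linarith
    · have e : B (f x) (g x) - B (f y) (g y) = B (f x) (g x - g y) + B (f x - f y) (g y) := by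
        simp
      rw [e]
      have a1 := h1 _ _ _ _ (hf.1 x hx) (hg.2 x hx y hy) hK
      have a2 := h1 _ _ _ _ (hf.2 x hx y hy) (hg.1 y hy) (by positivity)
      refine (norm_add_le _ _).trans ((add_le_add a1 a2).trans (le_of_eq ?_))
      ring
  induction r generalizing F G H with
  | zero => simpa using base B hf hg
  | succ r ih =>
    have hpos : 0 ≤ ‖B‖ * K * L := by positivity
    refine holderBound_succ.2 ⟨(base B (hf.of_le (Nat.zero_le _))
      (hg.of_le (Nat.zero_le _))).mono ?_, ?_⟩
    · have : (1 : ℝ) ≤ 2 ^ (r + 1) := one_le_pow₀ (by norm_num)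
      rw [pow_succ]; nlinarith
    · rw [holderBound_succ] at hf hg
      have hfd : ContDiffOn ℝ r (fderiv ℝ f) D := hfc.fderiv_of_isOpen hD (by simp)
      have hgd : ContDiffOn ℝ r (fderiv ℝ g) D := hgc.fderiv_of_isOpen hD (by simp)
      have hf0 : ContDiffOn ℝ r f D := hfc.of_le (by simp)
      have hg0 : ContDiffOn ℝ r g D := hgc.of_le (by simp)
      have hf' : HolderBound r α D K f := by
        rcases r with _ | r
        · exact hf.1
        · exact holderBound_succ.2 ⟨hf.1, hf.2.of_le (by omega)⟩
      have hg' : HolderBound r α D L g := by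
        rcases r with _ | r
        · exact hg.1
        · exact holderBound_succ.2 ⟨hg.1, hg.2.of_le (by omega)⟩
      have e1 := ih (B.precompR E) hf' hg.2 hf0 hgd
      have e2 := ih (B.precompL E) hf.2 hg' hfd hg0
      have hR := B.norm_precompR_le E
      have hLe := B.norm_precompL_le E
      refine ((add hD e1 e2 ?_ ?_).mono ?_).congr hD ?_
      · exact (B.precompR E).isBoundedBilinearMap.contDiff.comp₂_contDiffOn hf0 hgd
      · exact (B.precompL E).isBoundedBilinearMap.contDiff.comp₂_contDiffOn hfd hg0
      · have : 2 ^ (r + 1) * ‖B.precompR E‖ * K * L ≤ 2 ^ (r + 1) * ‖B‖ * K * L := by gcongr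
        have : 2 ^ (r + 1) * ‖B.precompL E‖ * K * L ≤ 2 ^ (r + 1) * ‖B‖ * K * L := by gcongr
        rw [pow_succ (2 : ℝ) (r + 1)]; linarith
      · intro x hx
        have hfx : DifferentiableAt ℝ f x :=
          (hfc.differentiableOn (by simp)).differentiableAt (hD.mem_nhds hx)
        have hgx : DifferentiableAt ℝ g x :=
          (hgc.differentiableOn (by simp)).differentiableAt (hD.mem_nhds hx)
        exact B.fderiv_of_bilinear hfx hgx

/-- Induction by the chain rule, with `bilin` applied to `Df ∘ ψ` and `Dψ`. At order zero the Hölder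
quotient acquires the factor `L ^ α ≤ L`, which is where `1 ≤ L` keeps the constant independent of
`α`. The map `ψ` itself need not be bounded. -/
theorem comp {ψ : E → G} {f : G → F} (hα0 : 0 ≤ α) (hα : α ≤ 1) (hK : 0 ≤ K) (hL : 1 ≤ L)
    (hf : HolderBound r α Set.univ K f) (hfc : ContDiff ℝ r f)
    (hψ : ∀ x y, ‖ψ x - ψ y‖ ≤ L * ‖x - y‖) (hψ' : HolderBound r α Set.univ L (fderiv ℝ ψ))
    (hψc : ContDiff ℝ ∞ ψ) :
    HolderBound r α Set.univ ((2 ^ (r + 1)) ^ r * K * L ^ (r + 1)) (fun x => f (ψ x)) := by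
  have base : ∀ {F : Type} [NormedAddCommGroup F] [NormedSpace ℝ F] {f : G → F},
      HolderBound 0 α Set.univ K f → HolderBound 0 α Set.univ (K * L) (fun x => f (ψ x)) := by
    intro F _ _ f hf
    rw [holderBound_zero] at *
    refine ⟨fun x _ => (hf.1 (ψ x) trivial).trans (le_mul_of_one_le_right hK hL),
      fun x _ y _ => (hf.2 (ψ x) trivial (ψ y) trivial).trans ?_⟩
    rw [mul_assoc]
    refine mul_le_mul_of_nonneg_left ?_ hK
    calc ‖ψ x - ψ y‖ ^ α ≤ (L * ‖x - y‖) ^ α := Real.rpow_le_rpow (norm_nonneg _) (hψ x y) hα0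
      _ = L ^ α * ‖x - y‖ ^ α := Real.mul_rpow (by linarith) (norm_nonneg _)
      _ ≤ L * ‖x - y‖ ^ α := by
        gcongr
        calc L ^ α ≤ L ^ (1 : ℝ) := Real.rpow_le_rpow_of_exponent_le hL hα
          _ = L := Real.rpow_one L
  have mono_const : ∀ {s : ℕ}, (1 : ℝ) ≤ (2 ^ (s + 1)) ^ s := fun {s} =>
    one_le_pow₀ (one_le_pow₀ (by norm_num))
  induction r generalizing F with
  | zero => simpa using base hf
  | succ r ih =>
    have hKL : 0 ≤ K * L := by positivity
    refine holderBound_succ.2 ⟨(base (hf.of_le (Nat.zero_le _))).mono ?_, ?_⟩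
    · have h1 : (1 : ℝ) ≤ (2 ^ (r + 1 + 1)) ^ (r + 1) := mono_const
      have h2 : (1 : ℝ) ≤ L ^ (r + 1) := one_le_pow₀ hL
      rw [pow_succ L (r + 1)]
      calc K * L ≤ ((2 ^ (r + 1 + 1)) ^ (r + 1) * L ^ (r + 1)) * (K * L) :=
            le_mul_of_one_le_left hKL (one_le_mul_of_one_le_of_one_le h1 h2)
        _ = _ := by ring
    · have hfd : ContDiff ℝ r (fderiv ℝ f) := hfc.fderiv_right (by simp)
      have hψd : ContDiff ℝ r (fderiv ℝ ψ) := hψc.fderiv_right (by exact_mod_cast le_top)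
      have e1 := ih (holderBound_succ.1 hf).2 hfd (hψ'.of_le (Nat.le_succ r))
      have hb := bilin isOpen_univ (ContinuousLinearMap.compL ℝ E G F) (r := r) (by positivity)
        (by positivity) e1 (hψ'.of_le (Nat.le_succ r))
        ((hfd.comp (hψc.of_le (by exact_mod_cast le_top))).contDiffOn) hψd.contDiffOn
      refine (hb.mono ?_).congr isOpen_univ ?_
      · have hc : ‖ContinuousLinearMap.compL ℝ E G F‖ ≤ 1 :=
          ContinuousLinearMap.norm_compL_le ℝ E G F
        have h3 : ((2 : ℝ) ^ (r + 1)) ^ r ≤ (2 ^ (r + 1 + 1)) ^ r := by gcongr <;> norm_num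
        have h4 : ((2 : ℝ) ^ (r + 1)) ≤ (2 ^ (r + 1 + 1)) := by gcongr <;> norm_num
        calc 2 ^ (r + 1) * ‖ContinuousLinearMap.compL ℝ E G F‖ *
              ((2 ^ (r + 1)) ^ r * K * L ^ (r + 1)) * L
            ≤ 2 ^ (r + 1 + 1) * 1 * ((2 ^ (r + 1 + 1)) ^ r * K * L ^ (r + 1)) * L := by gcongr
          _ = _ := by ring
      · intro x _
        exact fderiv_comp (g := f) (f := ψ) x ((hfc.differentiable (by simp)) _)
          ((hψc.differentiable (by simp)) _)

/-- Below the top order the Hölder quotients come for free: the mean value inequality on the convex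
set gives a Lipschitz bound, and `t ≤ max 1 R * t ^ α` for `t ≤ R` turns it into a Hölder bound. -/
theorem of_norm_le {N R : ℝ} (hD : IsOpen D) (hDc : Convex ℝ D)
    (hR : ∀ x ∈ D, ∀ y ∈ D, ‖x - y‖ ≤ R) (hα0 : 0 ≤ α) (hα : α ≤ 1) (hN : 0 ≤ N)
    (hf : ContDiffOn ℝ r f D) (hb : ∀ k ≤ r, ∀ x ∈ D, ‖iteratedFDeriv ℝ k f x‖ ≤ N)
    (htop : ∀ x ∈ D, ∀ y ∈ D,
      ‖iteratedFDeriv ℝ r f x - iteratedFDeriv ℝ r f y‖ ≤ N * ‖x - y‖ ^ α) :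
    HolderBound r α D (N * max 1 R) f := by
  have h1 : 1 ≤ max 1 R := le_max_left _ _
  intro k hk
  refine ⟨fun x hx => (hb k hk x hx).trans (le_mul_of_one_le_right hN h1),
    fun x hx y hy => ?_⟩
  rcases hk.eq_or_lt with rfl | hlt
  · refine (htop x hx y hy).trans ?_
    gcongr
    exact le_mul_of_one_le_right hN h1
  · have := hDc.norm_image_sub_le_of_norm_fderiv_le (𝕜 := ℝ) (f := iteratedFDeriv ℝ k f) (C := N)
      (fun z hz => (hf.contDiffAt (hD.mem_nhds hz)).differentiableAt_iteratedFDeriv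
        (by exact_mod_cast hlt))
      (fun z hz => by rw [norm_fderiv_iteratedFDeriv]; exact hb _ hlt z hz) hy hx
    refine this.trans ?_
    rw [mul_assoc]
    gcongr
    exact le_max_mul_rpow hα0 hα (norm_nonneg _) (hR x hx y hy)

/-- Smooth functions on a neighbourhood of a compact set satisfy bounds, on bounded convex
subsets, that are uniform in the Hölder exponent. -/
theorem exists_of_contDiffOn {U C : Set E} (hU : IsOpen U) (hC : IsCompact C) (hD : IsOpen D)
    (hDc : Convex ℝ D) (hDC : D ⊆ C) (hCU : C ⊆ U) (hf : ContDiffOn ℝ ∞ f U) (r : ℕ) :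
    ∃ K, 0 ≤ K ∧ ∀ α : ℝ, 0 ≤ α → α ≤ 1 → HolderBound r α D K f := by
  have hk : ∀ k : ℕ, ∃ M, ∀ x ∈ C, ‖iteratedFDeriv ℝ k f x‖ ≤ M := fun k => by
    refine hC.exists_bound_of_continuousOn fun x hx => ?_
    exact ((hf.contDiffAt (hU.mem_nhds (hCU hx))).continuousAt_iteratedFDeriv
      (by exact_mod_cast le_top)).continuousWithinAt
  choose M hM using hk
  obtain ⟨R, hR⟩ : ∃ R, ∀ x ∈ D, ∀ y ∈ D, ‖x - y‖ ≤ R := by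
    obtain ⟨R, hR⟩ := Metric.isBounded_iff.1 hC.isBounded
    exact ⟨R, fun x hx y hy => by simpa [dist_eq_norm] using hR (hDC hx) (hDC hy)⟩
  -- The range reaches order `r + 1`, one more than the conclusion asks for: that derivative makes
  -- the one of order `r` Lipschitz.
  set N := ∑ k ∈ Finset.range (r + 2), |M k| with hN
  have hMN : ∀ k ≤ r + 1, ∀ x ∈ C, ‖iteratedFDeriv ℝ k f x‖ ≤ N := fun k hk x hx =>
    (hM k x hx).trans ((le_abs_self _).trans (Finset.single_le_sum (f := fun k => |M k|)
      (fun _ _ => abs_nonneg _) (Finset.mem_range.2 (by omega))))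
  have hN0 : 0 ≤ N := Finset.sum_nonneg fun _ _ => abs_nonneg _
  have h1 : 1 ≤ max 1 R := le_max_left _ _
  -- One factor `max 1 R` comes from converting Lipschitz to Hölder at order `r`, the other from
  -- `of_norm_le`.
  refine ⟨N * max 1 R * max 1 R, by positivity, fun α hα0 hα => ?_⟩
  refine of_norm_le hD hDc hR hα0 hα (by positivity)
    ((hf.mono (hDC.trans hCU)).of_le (by exact_mod_cast le_top))
    (fun k hk x hx => (hMN k (by omega) x (hDC hx)).trans (le_mul_of_one_le_right hN0 h1))
    fun x hx y hy => ?_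
  have := hDc.norm_image_sub_le_of_norm_fderiv_le (𝕜 := ℝ) (f := iteratedFDeriv ℝ r f) (C := N)
      (fun z hz => (hf.contDiffAt (hU.mem_nhds (hCU (hDC hz)))).differentiableAt_iteratedFDeriv
        (by exact_mod_cast WithTop.coe_lt_top _))
      (fun z hz => by rw [norm_fderiv_iteratedFDeriv]; exact hMN _ le_rfl z (hDC hz)) hy hx
  refine this.trans ?_
  rw [mul_assoc]
  gcongr
  exact le_max_mul_rpow hα0 hα (norm_nonneg _) (hR x hx y hy)

/-- The whole space has no finite diameter, so points at distance at most `1` are compared by the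
Lipschitz bound and points farther apart by twice the supremum. Both comparisons hold for all `α` in
`[0,1]` at once. -/
theorem exists_of_hasCompactSupport (hf : ContDiff ℝ ∞ f) (hc : HasCompactSupport f) (r : ℕ) :
    ∃ K, 0 ≤ K ∧ ∀ α : ℝ, 0 ≤ α → α ≤ 1 → HolderBound r α Set.univ K f := by
  have hk : ∀ k : ℕ, ∃ M, ∀ x, ‖iteratedFDeriv ℝ k f x‖ ≤ M := fun k =>
    (hc.iteratedFDeriv k).exists_bound_of_continuous
      (hf.continuous_iteratedFDeriv (by exact_mod_cast le_top))
  choose M hM using hk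
  set N := ∑ k ∈ Finset.range (r + 2), |M k| with hN
  have hMN : ∀ k ≤ r + 1, ∀ x, ‖iteratedFDeriv ℝ k f x‖ ≤ N := fun k hk x =>
    (hM k x).trans ((le_abs_self _).trans (Finset.single_le_sum (f := fun k => |M k|)
      (fun _ _ => abs_nonneg _) (Finset.mem_range.2 (by omega))))
  have hN0 : 0 ≤ N := Finset.sum_nonneg fun _ _ => abs_nonneg _
  refine ⟨2 * N, by positivity, fun α hα0 hα k hk => ⟨fun x _ => ?_, fun x _ y _ => ?_⟩⟩
  · linarith [hMN k (by omega) x]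
  · rcases le_total ‖x - y‖ 1 with h | h
    · have := convex_univ.norm_image_sub_le_of_norm_fderiv_le (𝕜 := ℝ)
        (f := iteratedFDeriv ℝ k f) (C := N)
        (fun z _ => hf.differentiable_iteratedFDeriv (by exact_mod_cast WithTop.coe_lt_top _) z)
        (fun z _ => by rw [norm_fderiv_iteratedFDeriv]; exact hMN _ (by omega) z)
        (Set.mem_univ y) (Set.mem_univ x)
      have h2 := le_max_mul_rpow hα0 hα (norm_nonneg _) h
      rw [max_self, one_mul] at h2
      have : N * ‖x - y‖ ≤ N * ‖x - y‖ ^ α := by gcongr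
      have : 0 ≤ N * ‖x - y‖ ^ α := by positivity
      linarith
    · have h2 : 1 ≤ ‖x - y‖ ^ α := Real.one_le_rpow h hα0
      have h3 := norm_sub_le (iteratedFDeriv ℝ k f x) (iteratedFDeriv ℝ k f y)
      have := hMN k (by omega) x
      have := hMN k (by omega) y
      have : 2 * N ≤ 2 * N * ‖x - y‖ ^ α := le_mul_of_one_le_right (by positivity) h2
      linarith

/-- A function supported in a compact subset of an open set inherits the bounds globally. -/
theorem exists_extend {S : Set E} (hD : IsOpen D) (hS : IsCompact S) (hSD : S ⊆ D) :
    ∃ c, 1 ≤ c ∧ ∀ (r : ℕ) (α K : ℝ) (f : E → F), 0 ≤ α → α ≤ 1 → 0 ≤ K → tsupport f ⊆ S →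
      HolderBound r α D K f → HolderBound r α Set.univ (c * K) f := by
  -- Only pairs with one point in `S` and the other outside `D` are not covered by the hypothesis or
  -- trivial. They are at distance `t ≥ δ`, so `max 1 δ⁻¹ * t ^ α ≥ 1` for every `α` in `[0,1]`.
  obtain ⟨δ, hδ, hδS⟩ := hS.exists_cthickening_subset_open hD hSD
  refine ⟨max 1 δ⁻¹, le_max_left _ _, fun r α K f hα0 hα hK hf h k hk => ?_⟩
  have h1 : 1 ≤ max 1 δ⁻¹ := le_max_left _ _
  have hz : ∀ x, x ∉ S → iteratedFDeriv ℝ k f x = 0 := fun x hx => by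
    by_contra hne
    exact hx (hf (support_iteratedFDeriv_subset k hne))
  have hle : ∀ x, ‖iteratedFDeriv ℝ k f x‖ ≤ K := fun x => by
    by_cases hx : x ∈ S
    · exact (h k hk).1 x (hSD hx)
    · rw [hz x hx, norm_zero]; exact hK
  have hcK : K ≤ max 1 δ⁻¹ * K := le_mul_of_one_le_left hK h1
  have key : ∀ x ∈ S, ∀ y, y ∉ D → ‖iteratedFDeriv ℝ k f x - iteratedFDeriv ℝ k f y‖ ≤
      max 1 δ⁻¹ * K * ‖x - y‖ ^ α := by
    intro x hx y hy
    rw [hz y fun hyS => hy (hSD hyS), sub_zero]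
    have hd : δ ≤ ‖x - y‖ := by
      by_contra! hlt
      exact hy (hδS (Metric.mem_cthickening_of_dist_le y x δ S hx
        (by rw [dist_comm, dist_eq_norm]; exact hlt.le)))
    have h2 : 1 ≤ max 1 δ⁻¹ * ‖x - y‖ ^ α := by
      rcases le_total 1 ‖x - y‖ with h3 | h3
      · exact one_le_mul_of_one_le_of_one_le h1 (Real.one_le_rpow h3 hα0)
      · calc (1 : ℝ) = δ⁻¹ * δ := (inv_mul_cancel₀ hδ.ne').symm
          _ ≤ max 1 δ⁻¹ * ‖x - y‖ ^ α := by
            gcongr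
            · exact le_max_right _ _
            · calc δ ≤ ‖x - y‖ ^ (1 : ℝ) := by rwa [Real.rpow_one]
                _ ≤ _ := Real.rpow_le_rpow_of_exponent_ge (hδ.trans_le hd) h3 hα
    calc _ ≤ K := hle x
      _ ≤ K * (max 1 δ⁻¹ * ‖x - y‖ ^ α) := le_mul_of_one_le_right hK h2
      _ = _ := by ring
  refine ⟨fun x _ => (hle x).trans hcK, fun x _ y _ => ?_⟩
  by_cases hx : x ∈ D
  · by_cases hy : y ∈ D
    · refine ((h k hk).2 x hx y hy).trans ?_
      gcongr
    · by_cases hxS : x ∈ S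
      · exact key x hxS y hy
      · rw [hz x hxS, hz y fun hyS => hy (hSD hyS), sub_zero, norm_zero]; positivity
  · by_cases hyS : y ∈ S
    · rw [norm_sub_rev, norm_sub_rev x y]
      exact key y hyS x hx
    · rw [hz y hyS, hz x fun hxS => hx (hSD hxS), sub_zero, norm_zero]; positivity

end HolderBound

end HolderBound

/-! ### Weighted superpositions of translates -/

section Superposition

set_option maxSynthPendingDepth 3
set_option linter.unusedSectionVars false

open MeasureTheory

variable {P : Type} [MeasurableSpace P] {μ : Measure P}
  {E F G : Type} [NormedAddCommGroup E] [NormedSpace ℝ E]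
  [NormedAddCommGroup F] [NormedSpace ℝ F] [NormedAddCommGroup G] [NormedSpace ℝ G]

/-- A superposition of translates of `g`, with operator-valued weight `T`. -/
def superposition (μ : Measure P) (q : P → E) (T : P → F →L[ℝ] G) (g : E → F) (x : E) : G :=
  ∫ p, T p (g (x - q p)) ∂μ

variable {q : P → E} {T : P → F →L[ℝ] G} {g : E → F}

theorem aestronglyMeasurable_superposition (hq : AEStronglyMeasurable q μ)
    (hT : AEStronglyMeasurable T μ) (hg : Continuous g) (x : E) :
    AEStronglyMeasurable (fun p => T p (g (x - q p))) μ :=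
  (ContinuousLinearMap.apply ℝ G (E := F)).flip.aestronglyMeasurable_comp₂ hT
    (hg.comp_aestronglyMeasurable (aestronglyMeasurable_const.sub hq))

theorem integrable_superposition (hq : AEStronglyMeasurable q μ) (hT : Integrable T μ)
    (hg : Continuous g) {K : ℝ} (hK : ∀ x, ‖g x‖ ≤ K) (x : E) :
    Integrable (fun p => T p (g (x - q p))) μ := by
  refine (hT.norm.mul_const K).mono' (aestronglyMeasurable_superposition hq hT.1 hg x)
    (Filter.Eventually.of_forall fun p => ?_)
  exact ((T p).le_opNorm _).trans (mul_le_mul_of_nonneg_left (hK _) (norm_nonneg _))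

/-- The derivative is again a superposition, of translates of `Dg`, with each weight replaced by
composition with it. Operator-valued weights are allowed precisely so that this closes up under
induction. -/
theorem hasFDerivAt_superposition (hq : AEStronglyMeasurable q μ) (hT : Integrable T μ)
    (hg : ContDiff ℝ 1 g) {K : ℝ} (hK : ∀ x, ‖g x‖ ≤ K) (hK' : ∀ x, ‖fderiv ℝ g x‖ ≤ K) (x : E) :
    HasFDerivAt (superposition μ q T g)
      (superposition μ q (fun p => ContinuousLinearMap.compL ℝ E F G (T p)) (fderiv ℝ g) x) x := by
  have hT' : Integrable (fun p => ContinuousLinearMap.compL ℝ E F G (T p)) μ :=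
    (ContinuousLinearMap.compL ℝ E F G).integrable_comp hT
  have hg' : Continuous (fderiv ℝ g) := hg.continuous_fderiv one_ne_zero
  refine hasFDerivAt_integral_of_dominated_of_fderiv_le (𝕜 := ℝ)
    (F' := fun x p => ContinuousLinearMap.compL ℝ E F G (T p) (fderiv ℝ g (x - q p)))
    (bound := fun p => ‖T p‖ * K) Filter.univ_mem
    (Filter.Eventually.of_forall fun y => aestronglyMeasurable_superposition hq hT.1 hg.continuous y)
    (integrable_superposition hq hT hg.continuous hK x)
    (aestronglyMeasurable_superposition hq hT'.1 hg' x)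
    (Filter.Eventually.of_forall fun p y _ => ?_) (hT.norm.mul_const K)
    (Filter.Eventually.of_forall fun p y _ => ?_)
  · exact (ContinuousLinearMap.opNorm_comp_le _ _).trans
      (mul_le_mul_of_nonneg_left (hK' _) (norm_nonneg _))
  · have h1 : HasFDerivAt g (fderiv ℝ g (y - q p)) (y - q p) :=
      ((hg.differentiable one_ne_zero) _).hasFDerivAt
    exact (T p).hasFDerivAt.comp y (by simpa [Function.comp_def] using h1.comp y ((hasFDerivAt_id y).sub_const (q p)))

theorem norm_superposition_le (hT : Integrable T μ) {K : ℝ} {x : E}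
    (hK : ∀ x, ‖g x‖ ≤ K) : ‖superposition μ q T g x‖ ≤ (∫ p, ‖T p‖ ∂μ) * K := by
  rw [← integral_mul_const]
  exact norm_integral_le_of_norm_le (hT.norm.mul_const K) (Filter.Eventually.of_forall fun p =>
    ((T p).le_opNorm _).trans (mul_le_mul_of_nonneg_left (hK _) (norm_nonneg _)))

/-- The exponent `0` in `hK` only encodes boundedness of the derivatives, which is what dominated
convergence needs. -/
theorem contDiff_superposition (hq : AEStronglyMeasurable q μ) {r : ℕ} (hT : Integrable T μ)
    (hg : ContDiff ℝ r g) {K : ℝ} (hK : HolderBound r 0 Set.univ K g) :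
    ContDiff ℝ r (superposition μ q T g) := by
  induction r generalizing F G with
  | zero =>
    refine contDiff_zero.2 (continuous_of_dominated (bound := fun p => ‖T p‖ * K)
      (fun x => aestronglyMeasurable_superposition hq hT.1 hg.continuous x)
      (fun x => Filter.Eventually.of_forall fun p => ((T p).le_opNorm _).trans
        (mul_le_mul_of_nonneg_left (hK.norm_le trivial) (norm_nonneg _)))
      (hT.norm.mul_const K) (Filter.Eventually.of_forall fun p => ?_))
    exact (T p).continuous.comp (hg.continuous.comp (continuous_sub_right _))
  | succ r ih =>
    have hd := hasFDerivAt_superposition hq hT (hg.of_le (by exact_mod_cast Nat.le_add_left 1 r))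
      (fun x => hK.norm_le (Set.mem_univ x))
      (fun x => (holderBound_succ.1 hK).2.norm_le (Set.mem_univ x))
    rw [Nat.cast_succ, contDiff_succ_iff_fderiv]
    refine ⟨fun x => (hd x).differentiableAt, fun h => by simp at h, ?_⟩
    rw [funext fun x => (hd x).fderiv]
    exact ih ((ContinuousLinearMap.compL ℝ E F G).integrable_comp hT) (hg.fderiv_right (by simp))
      (holderBound_succ.1 hK).2

/-- Translations preserve all the bounds of `g`, and no derivative falls on the weight. The constant
is therefore the `L¹` norm of the weight, which does not grow on passing to composition operators.
-/
theorem HolderBound.superposition (hq : AEStronglyMeasurable q μ) {r : ℕ} (hT : Integrable T μ)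
    (hg : ContDiff ℝ r g) {α K : ℝ} (hK0 : 0 ≤ K) (hK : HolderBound r α Set.univ K g) :
    HolderBound r α Set.univ ((∫ p, ‖T p‖ ∂μ) * K) (superposition μ q T g) := by
  have base : ∀ {F G : Type} [NormedAddCommGroup F] [NormedSpace ℝ F] [NormedAddCommGroup G]
      [NormedSpace ℝ G] {T : P → F →L[ℝ] G} {g : E → F}, Integrable T μ → Continuous g →
      HolderBound 0 α Set.univ K g →
      HolderBound 0 α Set.univ ((∫ p, ‖T p‖ ∂μ) * K) (DivEq.superposition μ q T g) := by
    intro F G _ _ _ _ T g hT hg hK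
    have hb : ∀ x, ‖g x‖ ≤ K := fun x => hK.norm_le (Set.mem_univ x)
    rw [holderBound_zero] at *
    refine ⟨fun x _ => norm_superposition_le hT hb, fun x _ y _ => ?_⟩
    have e : DivEq.superposition μ q T g x - DivEq.superposition μ q T g y =
        ∫ p, T p (g (x - q p) - g (y - q p)) ∂μ := by
      simp only [map_sub]
      exact (integral_sub (integrable_superposition hq hT hg hb x)
        (integrable_superposition hq hT hg hb y)).symm
    rw [e, mul_assoc, ← integral_mul_const]
    refine norm_integral_le_of_norm_le (hT.norm.mul_const _) (Filter.Eventually.of_forall fun p => ?_)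
    have := hK.2 (x - q p) trivial (y - q p) trivial
    rw [sub_sub_sub_cancel_right] at this
    exact ((T p).le_opNorm _).trans (mul_le_mul_of_nonneg_left this (norm_nonneg _))
  induction r generalizing F G with
  | zero => exact base hT hg.continuous hK
  | succ r ih =>
    have hd := hasFDerivAt_superposition hq hT (hg.of_le (by exact_mod_cast Nat.le_add_left 1 r))
      (fun x => hK.norm_le (Set.mem_univ x))
      (fun x => (holderBound_succ.1 hK).2.norm_le (Set.mem_univ x))
    refine holderBound_succ.2 ⟨base hT hg.continuous (hK.of_le (Nat.zero_le _)), ?_⟩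
    rw [funext fun x => (hd x).fderiv]
    have hT' := (ContinuousLinearMap.compL ℝ E F G).integrable_comp hT
    refine (ih hT' (hg.fderiv_right (by simp)) (holderBound_succ.1 hK).2).mono ?_
    refine mul_le_mul_of_nonneg_right (integral_mono hT'.norm hT.norm fun p => ?_) hK0
    exact ((ContinuousLinearMap.compL ℝ E F G).le_opNorm _).trans
      (mul_le_of_le_one_left (norm_nonneg _) (ContinuousLinearMap.norm_compL_le ℝ E F G))

end Superposition

/-! ### Transport of mass along segments and its divergence -/

section Transport

set_option maxSynthPendingDepth 3
set_option linter.unusedSectionVars false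

open MeasureTheory

variable {E : Type} [NormedAddCommGroup E] [NormedSpace ℝ E]
  [FiniteDimensional ℝ E] [MeasureSpace E] [BorelSpace E]
  [(volume : Measure E).IsAddHaarMeasure]

/-- The weight of the field that moves the mass distribution `a` along straight lines to `c`. -/
def transportWeight (c : E) (a : E → ℝ) (p : E × ℝ) : ℝ →L[ℝ] E :=
  ContinuousLinearMap.toSpanSingleton ℝ (a p.1 • (p.1 - c))

/-- A field with divergence `(∫ a) g - ∫ a(y) g(· - (y - c)) dy`. -/
def transport (c : E) (a : E → ℝ) (g : E → ℝ) : E → E :=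
  superposition (volume.prod (volume.restrict (Set.Icc (0 : ℝ) 1)))
    (fun p : E × ℝ => p.2 • (p.1 - c)) (transportWeight c a) g

variable {c : E} {a g : E → ℝ}

theorem integrable_weight_base (c : E) (ha : Continuous a) (hac : HasCompactSupport a) :
    Integrable (fun y => ContinuousLinearMap.toSpanSingleton ℝ (a y • (y - c))) volume := by
  have hcont : Continuous fun y => a y • (y - c) := ha.smul (continuous_id.sub continuous_const)
  have : Integrable (fun y => a y • (y - c)) volume :=
    hcont.integrable_of_hasCompactSupport hac.smul_right
  exact (ContinuousLinearMap.toSpanSingletonLE ℝ ℝ E).toContinuousLinearMap.integrable_comp this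

theorem integrable_transportWeight (c : E) (ha : Continuous a) (hac : HasCompactSupport a) :
    Integrable (transportWeight c a) (volume.prod (volume.restrict (Set.Icc (0 : ℝ) 1))) :=
  (integrable_weight_base c ha hac).comp_fst _

theorem aestronglyMeasurable_shift (c : E) :
    AEStronglyMeasurable (fun p : E × ℝ => p.2 • (p.1 - c))
      (volume.prod (volume.restrict (Set.Icc (0 : ℝ) 1))) :=
  (by fun_prop : Continuous fun p : E × ℝ => p.2 • (p.1 - c)).aestronglyMeasurable

theorem transport_contDiff {r : ℕ} (ha : Continuous a) (hac : HasCompactSupport a)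
    (hg : ContDiff ℝ r g) {K : ℝ} (hK : HolderBound r 0 Set.univ K g) :
    ContDiff ℝ r (transport c a g) :=
  contDiff_superposition (aestronglyMeasurable_shift c) (integrable_transportWeight c ha hac) hg hK

/-- Support control: the field at `x` sees `g` only at the points `x - s (y - c)` with `y` in the
support of `a`. -/
theorem transport_eq_zero {x : E}
    (h : ∀ y, a y ≠ 0 → ∀ s ∈ Set.Icc (0 : ℝ) 1, g (x - s • (y - c)) = 0) :
    transport c a g x = 0 := by
  refine integral_eq_zero_of_ae ?_
  have : ∀ᵐ p : E × ℝ ∂(volume.prod (volume.restrict (Set.Icc (0 : ℝ) 1))),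
      p.2 ∈ Set.Icc (0 : ℝ) 1 :=
    Measure.quasiMeasurePreserving_snd.ae (ae_restrict_mem measurableSet_Icc)
  filter_upwards [this] with p hp
  by_cases hz : a p.1 = 0
  · simp [transportWeight, hz]
  · simp [h p.1 hz p.2 hp]

/-- The derivative under the integral has rank one, with trace `a y * Dg(x - s (y - c)) (y - c)`.
This is `-a y` times the `s`-derivative of `g (x - s (y - c))`, so the integral over `s` telescopes
to the values at `s = 0` and `s = 1`. -/
theorem trace_fderiv_transport (ha : Continuous a) (hac : HasCompactSupport a)
    (hg : ContDiff ℝ 1 g) (hgc : HasCompactSupport g) (x : E) :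
    LinearMap.trace ℝ E (fderiv ℝ (transport c a g) x : E →ₗ[ℝ] E) =
      (∫ y, a y) * g x - ∫ y, a y * g (x - (y - c)) := by
  obtain ⟨K₁, hK₁⟩ := hgc.exists_bound_of_continuous hg.continuous
  obtain ⟨K₂, hK₂⟩ := (hgc.fderiv ℝ).exists_bound_of_continuous (hg.continuous_fderiv one_ne_zero)
  have hd := hasFDerivAt_superposition (aestronglyMeasurable_shift c)
    (integrable_transportWeight c ha hac) hg (fun x => (hK₁ x).trans (le_max_left K₁ K₂))
    (fun x => (hK₂ x).trans (le_max_right K₁ K₂)) x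
  have hint := integrable_superposition (aestronglyMeasurable_shift c)
    ((ContinuousLinearMap.compL ℝ E ℝ E).integrable_comp (integrable_transportWeight c ha hac))
    (hg.continuous_fderiv one_ne_zero) hK₂ x
  -- The trace is made a continuous linear map so that it commutes with the Bochner integral.
  let tr : (E →L[ℝ] E) →L[ℝ] ℝ := LinearMap.toContinuousLinearMap
    ((LinearMap.trace ℝ E) ∘ₗ (ContinuousLinearMap.coeLM ℝ))
  have htr : ∀ A : E →L[ℝ] E, tr A = LinearMap.trace ℝ E (A : E →ₗ[ℝ] E) := fun A => rfl
  have hval : ∀ p : E × ℝ, tr (ContinuousLinearMap.compL ℝ E ℝ E (transportWeight c a p)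
      (fderiv ℝ g (x - p.2 • (p.1 - c)))) =
      a p.1 * fderiv ℝ g (x - p.2 • (p.1 - c)) (p.1 - c) := by
    intro p
    rw [htr]
    have : ((ContinuousLinearMap.compL ℝ E ℝ E (transportWeight c a p)
      (fderiv ℝ g (x - p.2 • (p.1 - c))) : E →L[ℝ] E) : E →ₗ[ℝ] E) =
      LinearMap.smulRight (fderiv ℝ g (x - p.2 • (p.1 - c)) : E →ₗ[ℝ] ℝ) (a p.1 • (p.1 - c)) := by
      ext v; simp [transportWeight]
    rw [this, LinearMap.trace_smulRight]
    simp
  have hint2 : Integrable (fun p : E × ℝ => a p.1 * fderiv ℝ g (x - p.2 • (p.1 - c)) (p.1 - c))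
      (volume.prod (volume.restrict (Set.Icc (0 : ℝ) 1))) := by
    have := tr.integrable_comp hint
    simpa only [hval] using this
  have hline : ∀ y, ∫ s in Set.Icc (0 : ℝ) 1, a y * fderiv ℝ g (x - s • (y - c)) (y - c) =
      a y * (g x - g (x - (y - c))) := by
    intro y
    rw [integral_const_mul, integral_Icc_eq_integral_Ioc, ← intervalIntegral.integral_of_le zero_le_one]
    congr 1
    have hder : ∀ s ∈ Set.uIcc (0 : ℝ) 1, HasDerivAt (fun s : ℝ => -g (x - s • (y - c)))
        (fderiv ℝ g (x - s • (y - c)) (y - c)) s := by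
      intro s _
      have h1 : HasDerivAt (fun s : ℝ => x - s • (y - c)) (-(y - c)) s := by
        simpa using ((hasDerivAt_id s).smul_const (y - c)).const_sub x
      have h2 := (((hg.differentiable one_ne_zero) (x - s • (y - c))).hasFDerivAt.comp_hasDerivAt
        s h1).neg
      simpa [Function.comp_def, Pi.neg_def] using h2
    rw [intervalIntegral.integral_eq_sub_of_hasDerivAt hder]
    · simp; ring
    · refine Continuous.intervalIntegrable ?_ _ _
      have := hg.continuous_fderiv one_ne_zero
      fun_prop
  have : fderiv ℝ (transport c a g) x = _ := hd.fderiv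
  rw [this, ← htr, superposition, ← tr.integral_comp_comm hint]
  simp only [hval]
  rw [integral_prod _ hint2]
  simp only [hline, mul_sub]
  rw [integral_sub, integral_mul_const]
  · exact (ha.integrable_of_hasCompactSupport hac).mul_const _
  · exact ((ha.mul (hg.continuous.comp (by fun_prop)))).integrable_of_hasCompactSupport
      hac.mul_right

theorem transport_add_right {g' : E → ℝ} (ha : Continuous a) (hac : HasCompactSupport a)
    (hg : Continuous g) (hgc : HasCompactSupport g) (hg' : Continuous g')
    (hgc' : HasCompactSupport g') :
    transport c a (g + g') = transport c a g + transport c a g' := by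
  obtain ⟨K₁, hK₁⟩ := hgc.exists_bound_of_continuous hg
  obtain ⟨K₂, hK₂⟩ := hgc'.exists_bound_of_continuous hg'
  ext1 x
  simp only [transport, superposition, Pi.add_apply, map_add]
  exact integral_add (integrable_superposition (aestronglyMeasurable_shift c)
    (integrable_transportWeight c ha hac) hg hK₁ x)
    (integrable_superposition (aestronglyMeasurable_shift c)
    (integrable_transportWeight c ha hac) hg' hK₂ x)

theorem transport_smul_right (t : ℝ) : transport c a (t • g) = t • transport c a g := by
  ext1 x
  simp only [transport, superposition, Pi.smul_apply, map_smul]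
  exact integral_smul t _

theorem transport_add_left {a' : E → ℝ} (ha : Continuous a) (hac : HasCompactSupport a)
    (ha' : Continuous a') (hac' : HasCompactSupport a')
    (hg : Continuous g) (hgc : HasCompactSupport g) :
    transport c (a + a') g = transport c a g + transport c a' g := by
  obtain ⟨K, hK⟩ := hgc.exists_bound_of_continuous hg
  ext1 x
  have e : ∀ p, transportWeight c (a + a') p (g (x - p.2 • (p.1 - c))) =
      transportWeight c a p (g (x - p.2 • (p.1 - c))) +
        transportWeight c a' p (g (x - p.2 • (p.1 - c))) := fun p => by
    simp [transportWeight, add_smul]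
  simp only [transport, superposition, Pi.add_apply, e]
  exact integral_add (integrable_superposition (aestronglyMeasurable_shift c)
    (integrable_transportWeight c ha hac) hg hK x)
    (integrable_superposition (aestronglyMeasurable_shift c)
    (integrable_transportWeight c ha' hac') hg hK x)

theorem transport_smul_left (t : ℝ) : transport c (t • a) g = t • transport c a g := by
  ext1 x
  have e : ∀ p, transportWeight c (t • a) p (g (x - p.2 • (p.1 - c))) =
      t • transportWeight c a p (g (x - p.2 • (p.1 - c))) := fun p => by
    simp [transportWeight, smul_smul, mul_left_comm]
  simp only [transport, superposition, Pi.smul_apply, e]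
  exact integral_smul t _

end Transport

/-! ### The Euclidean solution operator -/

section LocalOperator

set_option maxSynthPendingDepth 3
set_option linter.unusedSectionVars false

open MeasureTheory

variable {E : Type} [NormedAddCommGroup E] [NormedSpace ℝ E]
  [FiniteDimensional ℝ E] [MeasureSpace E] [BorelSpace E]
  [(volume : Measure E).IsAddHaarMeasure]

/-- A right inverse of the divergence up to a multiple of the bump function `θ (· - c)`. -/
def localOperator (c : E) (θ f : E → ℝ) : E → E :=
  transport 0 θ f - transport c f (fun x => θ (x - c))

variable {c : E} {θ f g : E → ℝ}

/-- The function `f` is the transported function in one term and the weight in the other, so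
additivity of `transport` in both arguments is used. -/
theorem localOperator_add (hθ : Continuous θ) (hθc : HasCompactSupport θ)
    (hf : Continuous f) (hfc : HasCompactSupport f) (hg : Continuous g)
    (hgc : HasCompactSupport g) :
    localOperator c θ (f + g) = localOperator c θ f + localOperator c θ g := by
  rw [localOperator, transport_add_right hθ hθc hf hfc hg hgc,
    transport_add_left (g := fun x => θ (x - c)) hf hfc hg hgc (hθ.comp (continuous_sub_right c))
      (hθc.comp_homeomorph (Homeomorph.subRight c))]
  simp only [localOperator]
  abel

theorem localOperator_smul (t : ℝ) :
    localOperator c θ (t • f) = t • localOperator c θ f := by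
  rw [localOperator, transport_smul_right, transport_smul_left, localOperator, smul_sub]

/-- In both terms a function supported within `ρ` of `c` is translated by vectors of length at most
`ρ`, hence the doubled radius. -/
theorem localOperator_eq_zero {ρ : ℝ} (hθ : ∀ x, x ∉ Metric.closedBall 0 ρ → θ x = 0)
    (hf : ∀ x, x ∉ Metric.closedBall c ρ → f x = 0) {x : E}
    (hx : x ∉ Metric.closedBall c (2 * ρ)) : localOperator c θ f x = 0 := by
  simp only [Metric.mem_closedBall, dist_eq_norm, not_le, sub_zero] at *
  have h1 : ∀ y : E, θ y ≠ 0 → ‖y‖ ≤ ρ := fun y hy => by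
    by_contra! h; exact hy (hθ y h)
  have h2 : ∀ y : E, f y ≠ 0 → ‖y - c‖ ≤ ρ := fun y hy => by
    by_contra! h; exact hy (hf y h)
  have h3 : ∀ (y : E) (s : ℝ), s ∈ Set.Icc (0 : ℝ) 1 → ‖y‖ ≤ ρ → ‖s • y‖ ≤ ρ := by
    intro y s hs hy
    rw [norm_smul, Real.norm_of_nonneg hs.1]
    exact (mul_le_of_le_one_left (norm_nonneg _) hs.2).trans hy
  rw [localOperator, Pi.sub_apply, transport_eq_zero, transport_eq_zero, sub_zero]
  · intro y hy s hs
    apply hθ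
    have := h3 _ s hs (h2 y hy)
    have h4 := norm_sub_norm_le (x - c) (s • (y - c))
    have : x - s • (y - c) - c = x - c - s • (y - c) := by abel
    rw [this]; linarith
  · intro y hy s hs
    apply hf
    have := h3 _ s hs (h1 y hy)
    have h4 := norm_sub_norm_le (x - c) (s • y)
    have : x - s • (y - 0) - c = x - c - s • y := by rw [sub_zero]; abel
    rw [this]; linarith

/-- A purely qualitative bound that justifies differentiation under the integral; its constant never
enters the estimates. -/
theorem exists_holderBound_zero {r : ℕ} (hf : ContDiff ℝ r f) (hfc : HasCompactSupport f) :
    ∃ K, HolderBound r 0 Set.univ K f := by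
  have hM : ∀ k : ℕ, ∃ M, k ≤ r → ∀ x, ‖iteratedFDeriv ℝ k f x‖ ≤ M := fun k => by
    by_cases hk : k ≤ r
    · obtain ⟨M, hM⟩ := (hfc.iteratedFDeriv k).exists_bound_of_continuous
        (hf.continuous_iteratedFDeriv (by exact_mod_cast hk))
      exact ⟨M, fun _ => hM⟩
    · exact ⟨0, fun h => absurd h hk⟩
  choose M hM using hM
  have hle : ∀ k ≤ r, ∀ x, ‖iteratedFDeriv ℝ k f x‖ ≤ ∑ k ∈ Finset.range (r + 1), |M k| :=
    fun k hk x => (hM k hk x).trans ((le_abs_self _).trans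
      (Finset.single_le_sum (f := fun k => |M k|)
      (fun _ _ => abs_nonneg _) (Finset.mem_range.2 (by omega))))
  refine ⟨2 * ∑ k ∈ Finset.range (r + 1), |M k|, fun k hk => ?_⟩
  refine ⟨fun x _ => ?_, fun x _ y _ => ?_⟩
  · linarith [hle k hk x, norm_nonneg (iteratedFDeriv ℝ k f x)]
  · rw [Real.rpow_zero, mul_one]
    linarith [norm_sub_le (iteratedFDeriv ℝ k f x) (iteratedFDeriv ℝ k f y), hle k hk x,
        hle k hk y]

theorem localOperator_contDiff (hθ : ContDiff ℝ ∞ θ) (hθc : HasCompactSupport θ) {r : ℕ}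
    (hf : ContDiff ℝ r f) (hfc : HasCompactSupport f) : ContDiff ℝ r (localOperator c θ f) := by
  obtain ⟨K, -, hK⟩ := HolderBound.exists_of_hasCompactSupport
    (hθ.comp (contDiff_id.sub contDiff_const) : ContDiff ℝ ∞ fun x => θ (x - c))
    (hθc.comp_homeomorph (Homeomorph.subRight c)) r
  obtain ⟨K', hf0⟩ := exists_holderBound_zero hf hfc
  exact (transport_contDiff hθ.continuous hθc hf hf0).sub
    (transport_contDiff hf.continuous hfc
      ((hθ.comp (contDiff_id.sub contDiff_const)).of_le (by exact_mod_cast le_top))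
      (hK 0 le_rfl zero_le_one))

/-- Both transports produce the convolution of `f` and `θ`, which cancels in the difference. -/
theorem trace_fderiv_localOperator (hθ : ContDiff ℝ ∞ θ) (hθc : HasCompactSupport θ)
    (hθi : ∫ x, θ x = 1) (hf : ContDiff ℝ 1 f) (hfc : HasCompactSupport f) (x : E) :
    LinearMap.trace ℝ E (fderiv ℝ (localOperator c θ f) x : E →ₗ[ℝ] E) =
      f x - (∫ y, f y) * θ (x - c) := by
  have hθ' : ContDiff ℝ ∞ fun x => θ (x - c) := hθ.comp (contDiff_id.sub contDiff_const)
  have hθc' : HasCompactSupport fun x => θ (x - c) :=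
    hθc.comp_homeomorph (Homeomorph.subRight c)
  obtain ⟨K, hK⟩ := exists_holderBound_zero (r := 1) (by exact_mod_cast hf) hfc
  obtain ⟨L, -, hL⟩ := HolderBound.exists_of_hasCompactSupport hθ' hθc' 1
  have d1 : DifferentiableAt ℝ (transport 0 θ f) x :=
    ((transport_contDiff (r := 1) hθ.continuous hθc (by exact_mod_cast hf) hK).differentiable
      (by simp)) x
  have d2 : DifferentiableAt ℝ (transport c f fun x => θ (x - c)) x :=
    ((transport_contDiff (r := 1) hf.continuous hfc (hθ'.of_le (by exact_mod_cast le_top))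
      (hL 0 le_rfl zero_le_one)).differentiable (by simp)) x
  rw [localOperator, fderiv_sub d1 d2, ContinuousLinearMap.toLinearMap_sub, map_sub,
    trace_fderiv_transport hθ.continuous hθc hf hfc,
    trace_fderiv_transport hf.continuous hfc (hθ'.of_le (by exact_mod_cast le_top)) hθc', hθi]
  -- The two convolutions agree by the substitution `y ↦ x - y`.
  have : ∫ y, f y * θ (x - (y - c) - c) = ∫ y, θ y * f (x - (y - 0)) := by
    rw [← integral_sub_left_eq_self (fun y => θ y * f (x - (y - 0))) volume x]
    refine integral_congr_ae (Filter.Eventually.of_forall fun y => ?_)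
    have e : x - (y - c) - c = x - y := by abel
    simp [mul_comm, e]
  rw [this]; ring

/-- In the first term the regularity is that of `f` and the weight is fixed. In the second the
regularity is that of `θ`, and only the `L¹` norm of the weight involves `f`, through its supremum
and the measure of the ball. -/
theorem exists_holderBound_localOperator (hθ : ContDiff ℝ ∞ θ) (hθc : HasCompactSupport θ)
    (c : E) (ρ : ℝ) (r : ℕ) :
    ∃ C, 0 ≤ C ∧ ∀ (α K : ℝ) (f : E → ℝ), 0 ≤ α → α ≤ 1 → 0 ≤ K → ContDiff ℝ r f →
      (∀ x, x ∉ Metric.closedBall c ρ → f x = 0) → HolderBound r α Set.univ K f →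
      HolderBound r α Set.univ (C * K) (localOperator c θ f) := by
  have hθ' : ContDiff ℝ ∞ fun x => θ (x - c) := hθ.comp (contDiff_id.sub contDiff_const)
  have hθc' : HasCompactSupport fun x => θ (x - c) :=
    hθc.comp_homeomorph (Homeomorph.subRight c)
  obtain ⟨L, hL0, hL⟩ := HolderBound.exists_of_hasCompactSupport hθ' hθc' r
  set μ : Measure (E × ℝ) := volume.prod (volume.restrict (Set.Icc (0 : ℝ) 1)) with hμ
  set I := ∫ p, ‖transportWeight 0 θ p‖ ∂μ with hI
  set B : Set (E × ℝ) := Metric.closedBall c ρ ×ˢ Set.univ with hB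
  have hI0 : 0 ≤ I := integral_nonneg fun _ => norm_nonneg _
  have hJ0 : 0 ≤ |ρ| * μ.real B := by positivity
  refine ⟨I + |ρ| * μ.real B * L, by positivity, fun α K f hα0 hα hK hf hf0 hfb => ?_⟩
  have hfc : HasCompactSupport f := HasCompactSupport.intro (isCompact_closedBall c ρ)
    fun x hx => hf0 x hx
  -- The weight has norm `|f y| * ‖y - c‖`, at most `K * |ρ|` on the ball and zero off it. The
  -- absolute value appears because `ρ` is an arbitrary real number here.
  have hw : ∫ p, ‖transportWeight c f p‖ ∂μ ≤ |ρ| * μ.real B * K := by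
    have hBm : MeasurableSet B := Metric.isClosed_closedBall.measurableSet.prod MeasurableSet.univ
    have hBfin : μ B ≠ ⊤ := by
      rw [hμ, hB, Measure.prod_prod]
      exact ENNReal.mul_ne_top (isCompact_closedBall c ρ).measure_lt_top.ne (by simp)
    have hint : Integrable (B.indicator fun _ => |ρ| * K) μ :=
      (integrable_indicator_iff hBm).2 (integrableOn_const hBfin)
    calc ∫ p, ‖transportWeight c f p‖ ∂μ ≤ ∫ p, B.indicator (fun _ => |ρ| * K) p ∂μ := by
          refine integral_mono (integrable_transportWeight c hf.continuous hfc).norm hint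
            fun p => ?_
          by_cases hp : p.1 ∈ Metric.closedBall c ρ
          · have : p ∈ B := ⟨hp, trivial⟩
            rw [Set.indicator_of_mem this, transportWeight,
              ContinuousLinearMap.norm_toSpanSingleton, norm_smul, mul_comm]
            have h1 : ‖p.1 - c‖ ≤ |ρ| := (mem_closedBall_iff_norm.1 hp).trans (le_abs_self _)
            exact mul_le_mul h1 (hfb.norm_le trivial) (norm_nonneg _) (abs_nonneg _)
          · have : p ∉ B := fun h => hp h.1
            simp [Set.indicator_of_notMem this, transportWeight, hf0 _ hp]
      _ = |ρ| * μ.real B * K := by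
          rw [integral_indicator hBm, setIntegral_const, smul_eq_mul]; ring
  have b1 := HolderBound.superposition (aestronglyMeasurable_shift (0 : E))
    (integrable_transportWeight 0 hθ.continuous hθc) hf hK hfb
  have b2 := HolderBound.superposition (aestronglyMeasurable_shift c)
    (integrable_transportWeight c hf.continuous hfc)
    (hθ'.of_le (by exact_mod_cast le_top) : ContDiff ℝ r _) hL0 (hL α hα0 hα)
  obtain ⟨K', hK'⟩ := exists_holderBound_zero hf hfc
  have c1 := transport_contDiff (c := (0 : E)) hθ.continuous hθc hf hK'
  have c2 : ContDiff ℝ r (transport c f fun x => θ (x - c)) := transport_contDiff hf.continuous hfc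
    (hθ'.of_le (by exact_mod_cast le_top)) (hL 0 le_rfl zero_le_one)
  have b3 := HolderBound.const_smul isOpen_univ (-1) b2 c2.contDiffOn
  refine ((HolderBound.add isOpen_univ b1 b3 c1.contDiffOn
    (c2.const_smul (-1 : ℝ)).contDiffOn).mono ?_).congr isOpen_univ fun x _ => ?_
  · rw [abs_neg, abs_one, one_mul]
    have := mul_le_mul_of_nonneg_right hw hL0
    nlinarith
  · simp only [neg_smul, one_smul, ← sub_eq_add_neg]
    rfl

end LocalOperator

/-! ### Jacobi's formula and the Piola identity -/

section Piola

set_option maxSynthPendingDepth 3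

variable {n : ℕ}

/-- Cramer's rule for the identity matrix. It produces the diagonal entries that make up the trace
in Jacobi's formula. -/
theorem basis_det_update {ι V : Type*} [Fintype ι] [DecidableEq ι] [AddCommGroup V] [Module ℝ V]
    (b : Module.Basis ι ℝ V) (i : ι) (w : V) : b.det (Function.update b i w) = b.repr w i := by
  rw [Module.Basis.det_apply, b.toMatrix_update, b.toMatrix_self, ← Matrix.cramer_apply,
    Matrix.cramer_one]
  rfl

/-- Jacobi's formula for the derivative of the determinant at an invertible map `A`, in the
direction `A ∘ G`. -/
theorem hasFDerivAt_det (A : Eucl n →L[ℝ] Eucl n) :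
    ∃ D : (Eucl n →L[ℝ] Eucl n) →L[ℝ] ℝ,
      HasFDerivAt (fun B : Eucl n →L[ℝ] Eucl n => LinearMap.det (B : Eucl n →ₗ[ℝ] Eucl n)) D A ∧
      ∀ G : Eucl n →L[ℝ] Eucl n, D (A.comp G) =
        LinearMap.det (A : Eucl n →ₗ[ℝ] Eucl n) * LinearMap.trace ℝ _ (G : Eucl n →ₗ[ℝ] Eucl n) := by
  set b := (EuclideanSpace.basisFun (Fin n) ℝ).toBasis with hb
  let df : ContinuousMultilinearMap ℝ (fun _ : Fin n => Eucl n) ℝ :=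
    { toMultilinearMap := b.det.toMultilinearMap
      cont := by
        change Continuous fun v : Fin n → Eucl n => b.det v
        simp only [Module.Basis.det_apply]
        refine Continuous.matrix_det (continuous_pi fun i => continuous_pi fun j => ?_)
        simp only [Module.Basis.toMatrix_apply, hb, OrthonormalBasis.coe_toBasis_repr_apply,
          EuclideanSpace.basisFun_repr]
        fun_prop }
  have hdf : ∀ v, df v = b.det v := fun _ => rfl
  let ev : (Eucl n →L[ℝ] Eucl n) →L[ℝ] (Fin n → Eucl n) :=
    ContinuousLinearMap.pi fun i => ContinuousLinearMap.apply ℝ (Eucl n) (b i)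
  have hev : ∀ B i, ev B i = B (b i) := fun _ _ => rfl
  have hdet : ∀ B : Eucl n →L[ℝ] Eucl n, df (ev B) = LinearMap.det (B : Eucl n →ₗ[ℝ] Eucl n) := by
    intro B
    have := b.det_comp (B : Eucl n →ₗ[ℝ] Eucl n) b
    rw [b.det_self, mul_one] at this
    exact this
  refine ⟨(df.linearDeriv (ev A)).comp ev, ?_, fun G => ?_⟩
  · have := (df.hasFDerivAt (ev A)).comp A ev.hasFDerivAt
    exact this.congr_of_eventuallyEq (Filter.Eventually.of_forall fun B => (hdet B).symm)
  · rw [ContinuousLinearMap.comp_apply, ContinuousMultilinearMap.linearDeriv_apply,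
      LinearMap.trace_eq_matrix_trace ℝ b, Matrix.trace, Finset.mul_sum]
    refine Finset.sum_congr rfl fun i _ => ?_
    -- In the `i`-th term of the derivative, `A` factors out of all columns. This leaves `det A`
    -- times the `i`-th diagonal entry of `G`.
    have : Function.update (ev A) i (ev (A.comp G) i) =
        (A : Eucl n →ₗ[ℝ] Eucl n) ∘ Function.update b i (G (b i)) := by
      ext1 j
      rcases eq_or_ne j i with rfl | hj
      · simp [hev]
      · simp [hev, hj]
    rw [this, hdf, b.det_comp, basis_det_update, Matrix.diag_apply, LinearMap.toMatrix_apply]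
    rfl

/-- The Piola identity: the transformation rule of the divergence under the change of variables
`ψ`. -/
theorem trace_fderiv_piola {ψ Y Z : Eucl n → Eucl n} {y : Eucl n} (hψ : ContDiffAt ℝ 2 ψ y)
    (hdet : LinearMap.det (fderiv ℝ ψ y : Eucl n →ₗ[ℝ] Eucl n) ≠ 0)
    (hY : DifferentiableAt ℝ Y (ψ y)) (hZ : DifferentiableAt ℝ Z y)
    (h : ∀ᶠ z in 𝓝 y, fderiv ℝ ψ z (Z z) =
      LinearMap.det (fderiv ℝ ψ z : Eucl n →ₗ[ℝ] Eucl n) • Y (ψ z)) :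
    LinearMap.trace ℝ _ (fderiv ℝ Z y : Eucl n →ₗ[ℝ] Eucl n) =
      LinearMap.det (fderiv ℝ ψ y : Eucl n →ₗ[ℝ] Eucl n) *
        LinearMap.trace ℝ _ (fderiv ℝ Y (ψ y) : Eucl n →ₗ[ℝ] Eucl n) := by
  set A := fderiv ℝ ψ y with hA
  set J := LinearMap.det (A : Eucl n →ₗ[ℝ] Eucl n) with hJ
  obtain ⟨D, hD, hDG⟩ := hasFDerivAt_det A
  have hψ' : DifferentiableAt ℝ (fderiv ℝ ψ) y :=
    (hψ.fderiv_right (m := 1) (by norm_num)).differentiableAt one_ne_zero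
  have hψd : HasFDerivAt ψ A y := (hψ.differentiableAt (by norm_num)).hasFDerivAt
  set S := fderiv ℝ (fderiv ℝ ψ) y with hS
  have hsymm : IsSymmSndFDerivAt ℝ ψ y := hψ.isSymmSndFDerivAt (by simp)
  obtain ⟨e, he⟩ : ∃ e : Eucl n ≃L[ℝ] Eucl n, (e : Eucl n →L[ℝ] Eucl n) = A := by
    refine ⟨(LinearMap.equivOfDetNeZero (A : Eucl n →ₗ[ℝ] Eucl n) hdet).toContinuousLinearEquiv, ?_⟩
    ext x : 1
    rfl
  set Ai : Eucl n →L[ℝ] Eucl n := (e.symm : Eucl n →L[ℝ] Eucl n) with hAi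
  have hAAi : ∀ v, A (Ai v) = v := fun v => by rw [← he]; exact e.apply_symm_apply v
  have hAiA : ∀ v, Ai (A v) = v := fun v => by rw [← he]; exact e.symm_apply_apply v
  have hL : HasFDerivAt (fun z => fderiv ℝ ψ z (Z z)) _ y := hψ'.hasFDerivAt.clm_apply hZ.hasFDerivAt
  have hdetd : HasFDerivAt (fun z => LinearMap.det (fderiv ℝ ψ z : Eucl n →ₗ[ℝ] Eucl n)) _ y :=
    HasFDerivAt.comp (g := fun B : Eucl n →L[ℝ] Eucl n => LinearMap.det (B : Eucl n →ₗ[ℝ] Eucl n))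
      y hD hψ'.hasFDerivAt
  have hYd : HasFDerivAt (fun z => Y (ψ z)) _ y := hY.hasFDerivAt.comp y hψd
  have hR := hdetd.fun_smul hYd
  -- The two sides of `h` are differentiated separately at `y`; uniqueness of the derivative equates
  -- the results.
  have heq := (hL.congr_of_eventuallyEq (h.mono fun _ hz => hz.symm)).unique hR
  have hy := h.self_of_nhds
  have hYZ : Y (ψ y) = J⁻¹ • A (Z y) := by
    rw [hy, smul_smul, inv_mul_cancel₀ hdet, one_smul]
  -- The differentiated identity multiplied by `A⁻¹`, with Jacobi's formula for the derivative of
  -- the determinant and `Y (ψ y)` eliminated through `hYZ`.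
  have hpt : ∀ u, Ai (S u (Z y)) + fderiv ℝ Z y u =
      LinearMap.trace ℝ _ (Ai.comp (S u) : Eucl n →ₗ[ℝ] Eucl n) • Z y +
        J • Ai (fderiv ℝ Y (ψ y) (A u)) := by
    intro u
    have h1 := DFunLike.congr_fun heq u
    have h2 : D (S u) = J * LinearMap.trace ℝ _ (Ai.comp (S u) : Eucl n →ₗ[ℝ] Eucl n) := by
      rw [← hDG]
      congr 1
      ext1 v
      exact (hAAi _).symm
    have h3 := congrArg Ai h1
    simp only [add_apply, ContinuousLinearMap.comp_apply,
      ContinuousLinearMap.flip_apply, smul_apply,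
      ContinuousLinearMap.smulRight_apply, map_add, map_smul, ← hA, ← hJ, ← hS] at h3
    rw [hAiA, h2, hYZ, map_smul, hAiA, smul_smul, mul_right_comm, mul_inv_cancel₀ hdet, one_mul] at h3
    rw [add_comm] at h3
    rw [h3, add_comm]
  let φ : Eucl n →ₗ[ℝ] ℝ := LinearMap.trace ℝ (Eucl n) ∘ₗ ContinuousLinearMap.coeLM ℝ ∘ₗ
    (ContinuousLinearMap.compL ℝ (Eucl n) (Eucl n) (Eucl n) Ai :
      (Eucl n →L[ℝ] Eucl n) →ₗ[ℝ] Eucl n →L[ℝ] Eucl n) ∘ₗ (S : Eucl n →ₗ[ℝ] Eucl n →L[ℝ] Eucl n)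
  have hφ : ∀ u, φ u = LinearMap.trace ℝ _ (Ai.comp (S u) : Eucl n →ₗ[ℝ] Eucl n) := fun u => rfl
  have hop : (Ai.comp (S (Z y)) : Eucl n →ₗ[ℝ] Eucl n) + (fderiv ℝ Z y : Eucl n →ₗ[ℝ] Eucl n) =
      φ.smulRight (Z y) + J • ((Ai : Eucl n →ₗ[ℝ] Eucl n) ∘ₗ
        ((fderiv ℝ Y (ψ y) : Eucl n →ₗ[ℝ] Eucl n) ∘ₗ (A : Eucl n →ₗ[ℝ] Eucl n))) := by
    refine LinearMap.ext fun u => ?_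
    have := hpt u
    -- Symmetry of the second derivative is the heart of the identity. After it, the second-order
    -- terms on the two sides both have trace `tr (A⁻¹ S(Z y))` and cancel.
    rw [hsymm u (Z y)] at this
    exact this
  have htr := congrArg (LinearMap.trace ℝ (Eucl n)) hop
  rw [map_add, map_add, LinearMap.trace_smulRight, hφ, map_smul, LinearMap.trace_comp_comm',
    LinearMap.comp_assoc] at htr
  have hid : (A : Eucl n →ₗ[ℝ] Eucl n) ∘ₗ (Ai : Eucl n →ₗ[ℝ] Eucl n) = LinearMap.id :=
    LinearMap.ext hAAi
  rw [hid, LinearMap.comp_id, smul_eq_mul] at htr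
  linarith

end Piola

/-! ### Densities, fields and the divergence under changes of charts -/

section Charts

set_option maxSynthPendingDepth 3
set_option linter.unusedSectionVars false

variable {n : ℕ} {M : Type*} [TopologicalSpace M] [ChartedSpace (Eucl n) M]

/-- The domain, in the chart `e`, of the transition map to the chart `e'`. -/
def overlap (e e' : OpenPartialHomeomorph M (Eucl n)) : Set (Eucl n) :=
  e.target ∩ e.symm ⁻¹' e'.source

/-- The transition map from the chart `e` to the chart `e'`. -/
def transition (e e' : OpenPartialHomeomorph M (Eucl n)) (y : Eucl n) : Eucl n := e' (e.symm y)

variable {e e' : OpenPartialHomeomorph M (Eucl n)}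

theorem isOpen_overlap : IsOpen (overlap e e') :=
  e.isOpen_inter_preimage_symm e'.open_source

theorem transition_mem_overlap {y : Eucl n} (hy : y ∈ overlap e e') :
    transition e e' y ∈ overlap e' e := by
  refine ⟨e'.map_source hy.2, ?_⟩
  change e'.symm (e' (e.symm y)) ∈ e.source
  rw [e'.left_inv hy.2]
  exact e.map_target hy.1

theorem symm_transition {y : Eucl n} (hy : y ∈ overlap e e') :
    e'.symm (transition e e' y) = e.symm y := e'.left_inv hy.2

theorem transition_transition {y : Eucl n} (hy : y ∈ overlap e e') :
    transition e' e (transition e e' y) = y := by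
  rw [transition, symm_transition hy, e.right_inv hy.1]

/-- The differential of the chart `e`, as an endomorphism of the model space. -/
def dchart (e : OpenPartialHomeomorph M (Eucl n)) (x : M) : Eucl n →L[ℝ] Eucl n :=
  mfderiv (𝓡 n) (𝓡 n) e x

/-- The differential of the inverse of the chart `e`, as an endomorphism of the model space. -/
def dsymm (e : OpenPartialHomeomorph M (Eucl n)) (y : Eucl n) : Eucl n →L[ℝ] Eucl n :=
  mfderiv (𝓡 n) (𝓡 n) e.symm y

/-- A vector at a point of the manifold, read in the preferred chart at that point. -/
def toModel {x : M} (v : TangentSpace (𝓡 n) x) : Eucl n := v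

theorem fieldInChart_eq (v : ∀ x : M, TangentSpace (𝓡 n) x) (y : Eucl n) :
    fieldInChart v e y = dchart e (e.symm y) (toModel (v (e.symm y))) := rfl

variable [IsManifold (𝓡 n) ∞ M]

theorem mdifferentiable_of_mem_maximalAtlas (he : e ∈ IsManifold.maximalAtlas (𝓡 n) ∞ M) :
    e.MDifferentiable (𝓡 n) (𝓡 n) :=
  ⟨(contMDiffOn_of_mem_maximalAtlas he).mdifferentiableOn (by simp),
    (contMDiffOn_symm_of_mem_maximalAtlas he).mdifferentiableOn (by simp)⟩

theorem contDiffOn_transition (he : e ∈ IsManifold.maximalAtlas (𝓡 n) ∞ M)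
    (he' : e' ∈ IsManifold.maximalAtlas (𝓡 n) ∞ M) :
    ContDiffOn ℝ ∞ (transition e e') (overlap e e') :=
  contMDiffOn_iff_contDiffOn.1 ((contMDiffOn_of_mem_maximalAtlas he').comp
    ((contMDiffOn_symm_of_mem_maximalAtlas he).mono Set.inter_subset_left) fun _ hy => hy.2)

theorem dsymm_eq (he : e ∈ IsManifold.maximalAtlas (𝓡 n) ∞ M)
    (he' : e' ∈ IsManifold.maximalAtlas (𝓡 n) ∞ M) {y : Eucl n} (hy : y ∈ overlap e e')
    (w : Eucl n) :
    dsymm e y w = dsymm e' (transition e e' y) (fderiv ℝ (transition e e') y w) := by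
  have h1 : e.symm =ᶠ[𝓝 y] e'.symm ∘ transition e e' := by
    filter_upwards [isOpen_overlap.mem_nhds hy] with z hz using (symm_transition hz).symm
  have h2 : MDifferentiableAt (𝓡 n) (𝓡 n) (transition e e') y :=
    (((contDiffOn_transition he he').contDiffAt (isOpen_overlap.mem_nhds hy)).differentiableAt
      (by simp)).mdifferentiableAt
  have h3 : MDifferentiableAt (𝓡 n) (𝓡 n) e'.symm (transition e e' y) :=
    (mdifferentiable_of_mem_maximalAtlas he').mdifferentiableAt_symm (transition_mem_overlap hy).1
  have h4 : mfderiv (𝓡 n) (𝓡 n) e.symm y = mfderiv (𝓡 n) (𝓡 n) (e'.symm ∘ transition e e') y :=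
    h1.mfderiv_eq
  have h5 := mfderiv_comp y h3 h2
  rw [mfderiv_eq_fderiv] at h5
  exact (DFunLike.congr_fun h4 w).trans (DFunLike.congr_fun h5 w)

theorem dchart_dsymm (he : e ∈ IsManifold.maximalAtlas (𝓡 n) ∞ M) {y : Eucl n}
    (hy : y ∈ e.target) (w : Eucl n) :
    dchart e (e.symm y) (dsymm e y w) = w :=
  DFunLike.congr_fun ((mdifferentiable_of_mem_maximalAtlas he).comp_symm_deriv hy) w

theorem dsymm_dchart (he : e ∈ IsManifold.maximalAtlas (𝓡 n) ∞ M) {x : M}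
    (hx : x ∈ e.source) (w : Eucl n) :
    dsymm e (e x) (dchart e x w) = w :=
  DFunLike.congr_fun ((mdifferentiable_of_mem_maximalAtlas he).symm_comp_deriv hx) w

theorem fderiv_transition_comp (he : e ∈ IsManifold.maximalAtlas (𝓡 n) ∞ M)
    (he' : e' ∈ IsManifold.maximalAtlas (𝓡 n) ∞ M) {y : Eucl n} (hy : y ∈ overlap e e')
    (w : Eucl n) :
    fderiv ℝ (transition e' e) (transition e e' y) (fderiv ℝ (transition e e') y w) = w := by
  have h2 := ((contDiffOn_transition he he').contDiffAt (isOpen_overlap.mem_nhds hy)).differentiableAt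
      (by simp)
  have h3 := ((contDiffOn_transition he' he).contDiffAt
    (isOpen_overlap.mem_nhds (transition_mem_overlap hy))).differentiableAt (by simp)
  have h4 := (h3.hasFDerivAt.comp y h2.hasFDerivAt).congr_of_eventuallyEq
    (f₁ := id) (by filter_upwards [isOpen_overlap.mem_nhds hy] with z hz using
      (transition_transition hz).symm)
  exact DFunLike.congr_fun (h4.unique (hasFDerivAt_id y)) w

theorem det_fderiv_transition_ne_zero (he : e ∈ IsManifold.maximalAtlas (𝓡 n) ∞ M)
    (he' : e' ∈ IsManifold.maximalAtlas (𝓡 n) ∞ M) {y : Eucl n} (hy : y ∈ overlap e e') :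
    LinearMap.det (fderiv ℝ (transition e e') y : Eucl n →ₗ[ℝ] Eucl n) ≠ 0 := by
  have h : (fderiv ℝ (transition e' e) (transition e e' y) : Eucl n →ₗ[ℝ] Eucl n) ∘ₗ
      (fderiv ℝ (transition e e') y : Eucl n →ₗ[ℝ] Eucl n) = LinearMap.id :=
    LinearMap.ext (fderiv_transition_comp he he' hy)
  have := congrArg LinearMap.det h
  rw [LinearMap.det_comp, LinearMap.det_id] at this
  exact right_ne_zero_of_mul_eq_one this

theorem density_eq (vol : VolumeForm n M) (he : e ∈ IsManifold.maximalAtlas (𝓡 n) ∞ M)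
    (he' : e' ∈ IsManifold.maximalAtlas (𝓡 n) ∞ M) {y : Eucl n} (hy : y ∈ overlap e e') :
    density vol.toFun e y =
      LinearMap.det (fderiv ℝ (transition e e') y : Eucl n →ₗ[ℝ] Eucl n) *
        density vol.toFun e' (transition e e' y) := by
  set b := (EuclideanSpace.basisFun (Fin n) ℝ).toBasis with hb
  have hbi : ∀ i, b i = EuclideanSpace.single i (1 : ℝ) := fun i => by simp [hb]
  let T : Eucl n →ₗ[ℝ] Eucl n :=
    (show Eucl n →L[ℝ] Eucl n from mfderiv (𝓡 n) (𝓡 n) e'.symm (transition e e' y))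
  let f : Eucl n [⋀^Fin n]→ₗ[ℝ] ℝ :=
    AlternatingMap.compLinearMap (show Eucl n [⋀^Fin n]→ₗ[ℝ] ℝ from vol.toFun (e.symm y)) T
  have h1 : density vol.toFun e y = f ((fderiv ℝ (transition e e') y : Eucl n →ₗ[ℝ] Eucl n) ∘ b) := by
    refine congrArg (vol.toFun (e.symm y)) (funext fun i => ?_)
    rw [Function.comp_apply, hbi]
    exact dsymm_eq he he' hy _
  have h2 : density vol.toFun e' (transition e e' y) = f b := by
    have : f b = vol.toFun (e.symm y) fun i : Fin n => (mfderiv (𝓡 n) (𝓡 n) e'.symm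
        (transition e e' y) (EuclideanSpace.single i (1 : ℝ) : Eucl n) : Eucl n) := by
      refine congrArg (vol.toFun (e.symm y)) (funext fun i => ?_)
      rw [hbi]
      rfl
    rw [this, density]
    rw [symm_transition hy]
  rw [h1, h2, f.eq_smul_basis_det b]
  simp only [AlternatingMap.smul_apply, b.det_comp, b.det_self, smul_eq_mul]
  ring

/-- The differential of the inverse chart is surjective, so a form that vanishes on the image of a
basis would vanish identically. -/
theorem density_ne_zero (vol : VolumeForm n M) (he : e ∈ IsManifold.maximalAtlas (𝓡 n) ∞ M)
    {y : Eucl n} (hy : y ∈ e.target) : density vol.toFun e y ≠ 0 := by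
  set b := (EuclideanSpace.basisFun (Fin n) ℝ).toBasis with hb
  have hbi : ∀ i, b i = EuclideanSpace.single i (1 : ℝ) := fun i => by simp [hb]
  let T : Eucl n →ₗ[ℝ] Eucl n := (show Eucl n →L[ℝ] Eucl n from mfderiv (𝓡 n) (𝓡 n) e.symm y)
  let g : Eucl n [⋀^Fin n]→ₗ[ℝ] ℝ := vol.toFun (e.symm y)
  have h1 : density vol.toFun e y = g.compLinearMap T b := by
    refine congrArg (vol.toFun (e.symm y)) (funext fun i => ?_)
    rw [hbi]
    rfl
  have hsurj : Function.Surjective T := by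
    intro w
    have := dsymm_dchart he (e.map_target hy) w
    rw [e.right_inv hy] at this
    exact ⟨_, this⟩
  intro h0
  rw [h1, AlternatingMap.map_basis_eq_zero_iff] at h0
  apply vol.ne_zero (e.symm y)
  refine AlternatingMap.ext fun v => ?_
  choose w hw using fun i => hsurj (v i)
  have := DFunLike.congr_fun h0 w
  rw [AlternatingMap.compLinearMap_apply] at this
  simp only [hw] at this
  exact this

theorem fieldInChart_transition (v : ∀ x : M, TangentSpace (𝓡 n) x)
    (he : e ∈ IsManifold.maximalAtlas (𝓡 n) ∞ M) (he' : e' ∈ IsManifold.maximalAtlas (𝓡 n) ∞ M)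
    {y : Eucl n} (hy : y ∈ overlap e e') :
    fderiv ℝ (transition e e') y (fieldInChart v e y) =
      fieldInChart v e' (transition e e' y) := by
  have h2 := dsymm_dchart he (e.map_target hy.1) (toModel (v (e.symm y)))
  rw [e.right_inv hy.1] at h2
  rw [← dchart_dsymm he' (transition_mem_overlap hy).1
    (fderiv ℝ (transition e e') y (fieldInChart v e y)), ← dsymm_eq he he' hy, fieldInChart_eq,
    h2, fieldInChart_eq, symm_transition hy]

/-- The expression in the chart is the pullback of `v` along `e.symm`, because the differential of
`e` inverts that of `e.symm`. Regularity of pullbacks then applies. -/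
theorem contDiffOn_fieldInChart {v : ∀ x : M, TangentSpace (𝓡 n) x}
    (he : e ∈ IsManifold.maximalAtlas (𝓡 n) ∞ M) {k : ℕ∞}
    {s : Set M} (hs : IsOpen s)
    (hv : ContMDiffOn (𝓡 n) (𝓡 n).tangent k (fun x => (⟨x, v x⟩ : TangentBundle (𝓡 n) M)) s) :
    ContDiffOn ℝ k (fieldInChart v e) (e.target ∩ e.symm ⁻¹' s) := by
  have : IsManifold (𝓡 n) 1 M := IsManifold.of_le (n := ∞) (by exact_mod_cast le_top)
  have hmd := mdifferentiable_of_mem_maximalAtlas he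
  intro y hy
  have hsm : ContMDiffAt (𝓡 n) (𝓡 n) ∞ e.symm y :=
    (contMDiffOn_symm_of_mem_maximalAtlas he).contMDiffAt (e.open_target.mem_nhds hy.1)
  have h1 := ContMDiffAt.mpullback_vectorField_preimage (hv.contMDiffAt (hs.mem_nhds hy.2)) hsm
    ⟨hmd.symm.mfderiv hy.1, rfl⟩ (by exact_mod_cast le_top)
  have h2 := contMDiffAt_vectorSpace_iff_contDiffAt.1 h1
  refine (h2.congr_of_eventuallyEq ?_).contDiffWithinAt
  filter_upwards [e.open_target.mem_nhds hy.1] with z hz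
  exact (DFunLike.congr_fun (ContinuousLinearMap.inverse_equiv (hmd.symm.mfderiv hz))
    (v (e.symm z))).symm

/-- The push-forward to the manifold of the field `u` on the target of the chart `e`. -/
def pushField (e : OpenPartialHomeomorph M (Eucl n)) (u : Eucl n → Eucl n) (x : M) :
    TangentSpace (𝓡 n) x :=
  open scoped Classical in
  if x ∈ e.source then dsymm e (e x) (u (e x)) else (0 : Eucl n)

theorem toModel_pushField {u : Eucl n → Eucl n} {x : M} (hx : x ∈ e.source) :
    toModel (pushField e u x) = dsymm e (e x) (u (e x)) := if_pos hx

theorem fieldInChart_pushField (he : e ∈ IsManifold.maximalAtlas (𝓡 n) ∞ M)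
    (u : Eucl n → Eucl n) {y : Eucl n} (hy : y ∈ e.target) :
    fieldInChart (pushField e u) e y = u y := by
  rw [fieldInChart_eq, toModel_pushField (e.map_target hy), e.right_inv hy, dchart_dsymm he hy]

theorem pushField_ne_zero {u : Eucl n → Eucl n} {x : M} (h : pushField e u x ≠ 0) :
    x ∈ e.source ∧ u (e x) ≠ 0 := by
  by_cases hx : x ∈ e.source
  · refine ⟨hx, fun h0 => h ?_⟩
    have := toModel_pushField (u := u) hx
    rw [h0, map_zero] at this
    exact this
  · exact absurd (if_neg hx) h

/-- Extension by zero is harmless: the image of the compact set `S` is closed in the Hausdorff space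
`M`, so the field vanishes near every point outside the chart domain. -/
theorem contMDiff_pushField [T2Space M] (he : e ∈ IsManifold.maximalAtlas (𝓡 n) ∞ M) {k : ℕ∞}
    {u : Eucl n → Eucl n} (hu : ContDiff ℝ k u) {S : Set (Eucl n)} (hS : IsCompact S)
    (hSe : S ⊆ e.target) (huS : ∀ y, y ∉ S → u y = 0) :
    ContMDiff (𝓡 n) (𝓡 n).tangent k
      (fun x => (⟨x, pushField e u x⟩ : TangentBundle (𝓡 n) M)) := by
  have : IsManifold (𝓡 n) 1 M := IsManifold.of_le (n := ∞) (by exact_mod_cast le_top)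
  have hmd := mdifferentiable_of_mem_maximalAtlas he
  have hC : IsClosed (e.symm '' S) := (hS.image_of_continuousOn (e.continuousOn_symm.mono hSe)).isClosed
  intro x
  by_cases hx : x ∈ e.source
  · have hsm : ContMDiffAt (𝓡 n) (𝓡 n) ∞ e x :=
      (contMDiffOn_of_mem_maximalAtlas he).contMDiffAt (e.open_source.mem_nhds hx)
    have hu' : ContMDiffAt (𝓡 n) (𝓡 n).tangent k
        (fun y => (⟨y, u y⟩ : TangentBundle (𝓡 n) (Eucl n))) (e x) :=
      contMDiffAt_vectorSpace_iff_contDiffAt.2 hu.contDiffAt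
    have h1 := ContMDiffAt.mpullback_vectorField_preimage hu' hsm
      ⟨hmd.mfderiv hx, rfl⟩ (by exact_mod_cast le_top)
    refine h1.congr_of_eventuallyEq ?_
    filter_upwards [e.open_source.mem_nhds hx] with z hz
    refine congrArg (Bundle.TotalSpace.mk z) ((toModel_pushField hz).trans ?_)
    exact (DFunLike.congr_fun (ContinuousLinearMap.inverse_equiv (hmd.mfderiv hz)) (u (e z))).symm
  · have hxC : x ∉ e.symm '' S := by
      rintro ⟨y, hy, rfl⟩
      exact hx (e.map_target (hSe hy))
    refine (Bundle.contMDiff_zeroSection ℝ (TangentSpace (𝓡 n) : M → Type _)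
      x).congr_of_eventuallyEq ?_
    filter_upwards [hC.isOpen_compl.mem_nhds hxC] with z hz
    have : pushField e u z = 0 := by
      by_contra hne
      obtain ⟨h1, h2⟩ := pushField_ne_zero hne
      refine hz ⟨e z, ?_, e.left_inv h1⟩
      by_contra hzS
      exact h2 (huS _ hzS)
    rw [this]
    rfl

theorem closure_pushField_subset [T2Space M] {u : Eucl n → Eucl n} {S : Set (Eucl n)}
    (hS : IsCompact S) (hSe : S ⊆ e.target) (huS : ∀ y, y ∉ S → u y = 0) :
    closure {x | pushField e u x ≠ 0} ⊆ e.symm '' S := by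
  refine closure_minimal (fun x hx => ?_)
    (hS.image_of_continuousOn (e.continuousOn_symm.mono hSe)).isClosed
  obtain ⟨h1, h2⟩ := pushField_ne_zero hx
  refine ⟨e x, ?_, e.left_inv h1⟩
  by_contra hzS
  exact h2 (huS _ hzS)

/-- The divergence can be computed in any chart. -/
theorem divergence_eq (vol : VolumeForm n M) {v : ∀ x : M, TangentSpace (𝓡 n) x}
    (hv : ContMDiff (𝓡 n) (𝓡 n).tangent 1 (fun x => (⟨x, v x⟩ : TangentBundle (𝓡 n) M)))
    (he : e ∈ IsManifold.maximalAtlas (𝓡 n) ∞ M) {x : M} (hx : x ∈ e.source) :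
    divergence vol v x = (density vol.toFun e (e x))⁻¹ * LinearMap.trace ℝ (Eucl n)
      (fderiv ℝ (fun y => density vol.toFun e y • fieldInChart v e y) (e x) :
        Eucl n →ₗ[ℝ] Eucl n) := by
  set e' := chartAt (Eucl n) x with he'd
  have he' : e' ∈ IsManifold.maximalAtlas (𝓡 n) ∞ M := IsManifold.chart_mem_maximalAtlas x
  have hx' : x ∈ e'.source := mem_chart_source _ x
  have hdiff : ∀ {e : OpenPartialHomeomorph M (Eucl n)}, e ∈ IsManifold.maximalAtlas (𝓡 n) ∞ M →
      x ∈ e.source →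
      DifferentiableAt ℝ (fun y => density vol.toFun e y • fieldInChart v e y) (e x) := by
    intro e he hx
    have h1 := ((vol.smooth e he).contDiffAt (e.open_target.mem_nhds (e.map_source hx)))
    have h2 : ContDiffOn ℝ (1 : ℕ∞) (fieldInChart v e) _ :=
      contDiffOn_fieldInChart he isOpen_univ (by exact_mod_cast hv.contMDiffOn)
    rw [Set.preimage_univ, Set.inter_univ] at h2
    exact (h1.differentiableAt (by simp)).smul
      ((h2.contDiffAt (e.open_target.mem_nhds (e.map_source hx))).differentiableAt (by simp))
  have hy : e x ∈ overlap e e' := ⟨e.map_source hx, by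
    rw [Set.mem_preimage, e.left_inv hx]; exact hx'⟩
  have hty : transition e e' (e x) = e' x := by rw [transition, e.left_inv hx]
  -- The fields compared are density times field in the two charts. They satisfy the Piola relation
  -- because the densities differ by exactly the Jacobian determinant, sign included.
  have hP := trace_fderiv_piola (ψ := transition e e') (y := e x)
    (Y := fun y => density vol.toFun e' y • fieldInChart v e' y)
    (Z := fun y => density vol.toFun e y • fieldInChart v e y)
    (((contDiffOn_transition he he').contDiffAt (isOpen_overlap.mem_nhds hy)).of_le
      (WithTop.coe_le_coe.2 le_top))
    (det_fderiv_transition_ne_zero he he' hy) (by rw [hty]; exact hdiff he' hx') (hdiff he hx)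
    (by
      filter_upwards [isOpen_overlap.mem_nhds hy] with z hz
      rw [map_smul, fieldInChart_transition v he he' hz, density_eq vol he he' hz, smul_smul])
  rw [hP, density_eq vol he he' hy, hty, divergence, ← he'd, mul_inv, mul_mul_mul_comm,
    inv_mul_cancel₀ (det_fderiv_transition_ne_zero he he' hy), one_mul]

end Charts

/-! ### The integral of a function supported in one chart -/

section Integral

set_option maxSynthPendingDepth 3
set_option linter.unusedSectionVars false

open MeasureTheory

variable {n : ℕ} {M : Type*} [TopologicalSpace M] [ChartedSpace (Eucl n) M]
  {A : RegularAtlas n M} {vol : VolumeForm n M}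

theorem RegularAtlas.ball_subset (A : RegularAtlas n M) (i : Fin A.m) :
    A.ball ⊆ (A.chart i).target :=
  Metric.ball_subset_closedBall.trans (A.closedBall_subset i)

theorem RegularAtlas.isOpen_ball (A : RegularAtlas n M) : IsOpen A.ball := Metric.isOpen_ball

theorem RegularAtlas.isOpen_dom (A : RegularAtlas n M) (i : Fin A.m) : IsOpen (A.dom i) :=
  (A.chart i).isOpen_inter_preimage A.isOpen_ball

theorem RegularAtlas.isOpen_ball_inter (A : RegularAtlas n M) (i : Fin A.m) {U : Set M}
    (hU : IsOpen U) : IsOpen (A.ball ∩ (A.chart i).symm ⁻¹' U) :=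
  ((A.chart i).continuousOn_symm.mono (A.ball_subset i)).isOpen_inter_preimage A.isOpen_ball hU

theorem RegularAtlas.measurableSet_ball_inter (A : RegularAtlas n M) (i : Fin A.m) {U V : Set M}
    (hU : IsOpen U) (hV : IsOpen V) :
    MeasurableSet (A.ball ∩ (A.chart i).symm ⁻¹' (U \ V)) := by
  have : A.ball ∩ (A.chart i).symm ⁻¹' (U \ V) =
      (A.ball ∩ (A.chart i).symm ⁻¹' U) \ (A.ball ∩ (A.chart i).symm ⁻¹' V) := by
    ext y; simp only [Set.mem_inter_iff, Set.mem_preimage, Set.mem_sdiff]; tauto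
  rw [this]
  exact (A.isOpen_ball_inter i hU).measurableSet.diff (A.isOpen_ball_inter i hV).measurableSet

theorem RegularAtlas.symm_mem_dom (A : RegularAtlas n M) (i : Fin A.m) {y : Eucl n}
    (hy : y ∈ A.ball) : (A.chart i).symm y ∈ A.dom i :=
  ⟨(A.chart i).map_target (A.ball_subset i hy), by
    rw [Set.mem_preimage, (A.chart i).right_inv (A.ball_subset i hy)]; exact hy⟩

/-- The integrand, in the chart `i`, of the integral of `f` with respect to the volume form. -/
def chartIntegrand (A : RegularAtlas n M) (vol : VolumeForm n M) (i : Fin A.m) (f : M → ℝ)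
    (y : Eucl n) : ℝ := f ((A.chart i).symm y) * |density vol.toFun (A.chart i) y|

theorem integrableOn_chartIntegrand {f : M → ℝ} (hf : Continuous f) (i : Fin A.m) :
    IntegrableOn (chartIntegrand A vol i f) A.ball := by
  have hc : ContinuousOn (chartIntegrand A vol i f) (Metric.closedBall 0 A.radius) :=
    ContinuousOn.mul
      (hf.comp_continuousOn ((A.chart i).continuousOn_symm.mono (A.closedBall_subset i)))
      (((vol.smooth _ (A.mem_maximalAtlas i)).continuousOn).mono (A.closedBall_subset i)).abs
  exact (hc.integrableOn_compact (isCompact_closedBall _ _)).mono_set Metric.ball_subset_closedBall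

theorem integral_sum (Ω : Set M) {ι : Type*} (s : Finset ι) {f : ι → M → ℝ}
    (hf : ∀ j ∈ s, Continuous (f j)) :
    integral A vol Ω (fun x => ∑ j ∈ s, f j x) = ∑ j ∈ s, integral A vol Ω (f j) := by
  simp only [integral, Finset.sum_mul]
  rw [Finset.sum_comm]
  exact Finset.sum_congr rfl fun i _ => integral_finsetSum s fun j hj =>
    integrableOn_piece A vol Ω (hf j hj) i

variable [IsManifold (𝓡 n) ∞ M]

/-- Change of variables along the transition map: the absolute Jacobian determinant is the quotient
of the absolute densities. -/
theorem setIntegral_chartIntegrand (i k : Fin A.m) {S : Set M} (f : M → ℝ)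
    (hm : MeasurableSet (A.ball ∩ (A.chart i).symm ⁻¹' (A.dom k ∩ S))) :
    ∫ z in A.ball ∩ (A.chart k).symm ⁻¹' (A.dom i ∩ S), chartIntegrand A vol k f z =
      ∫ y in A.ball ∩ (A.chart i).symm ⁻¹' (A.dom k ∩ S), chartIntegrand A vol i f y := by
  have hsub : ∀ (i k : Fin A.m), ∀ y ∈ A.ball ∩ (A.chart i).symm ⁻¹' (A.dom k ∩ S),
      y ∈ overlap (A.chart i) (A.chart k) := fun i k y hy => ⟨A.ball_subset i hy.1, hy.2.1.1⟩
  have hmaps : ∀ (i k : Fin A.m), ∀ y ∈ A.ball ∩ (A.chart i).symm ⁻¹' (A.dom k ∩ S),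
      transition (A.chart i) (A.chart k) y ∈ A.ball ∩ (A.chart k).symm ⁻¹' (A.dom i ∩ S) := by
    intro i k y hy
    refine ⟨hy.2.1.2, ?_⟩
    rw [Set.mem_preimage, symm_transition (hsub i k y hy)]
    exact ⟨A.symm_mem_dom i hy.1, hy.2.2⟩
  have himg : A.ball ∩ (A.chart k).symm ⁻¹' (A.dom i ∩ S) =
      transition (A.chart i) (A.chart k) '' (A.ball ∩ (A.chart i).symm ⁻¹' (A.dom k ∩ S)) := by
    refine Set.Subset.antisymm (fun z hz => ?_) (Set.image_subset_iff.2 (hmaps i k))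
    exact ⟨_, hmaps k i z hz, transition_transition (hsub k i z hz)⟩
  have hinj : Set.InjOn (transition (A.chart i) (A.chart k))
      (A.ball ∩ (A.chart i).symm ⁻¹' (A.dom k ∩ S)) := by
    intro y hy z hz hyz
    rw [← transition_transition (hsub i k y hy), hyz, transition_transition (hsub i k z hz)]
  rw [himg, integral_image_eq_integral_abs_det_fderiv_smul volume hm (fun y hy =>
    (((contDiffOn_transition (A.mem_maximalAtlas i) (A.mem_maximalAtlas k)).contDiffAt
      (isOpen_overlap.mem_nhds (hsub i k y hy))).differentiableAt
        (by simp)).hasFDerivAt.hasFDerivWithinAt) hinj]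
  refine setIntegral_congr_fun hm fun y hy => ?_
  simp only [chartIntegrand, smul_eq_mul, symm_transition (hsub i k y hy)]
  rw [density_eq vol (A.mem_maximalAtlas i) (A.mem_maximalAtlas k) (hsub i k y hy), abs_mul]
  rw [ContinuousLinearMap.det]
  ring

/-- The integral of a function supported in one chart can be computed in that chart. -/
theorem integral_eq_chartIntegrand {Ω : Set M} (hΩ : IsOpen Ω) {f : M → ℝ} (hf : Continuous f)
    (i : Fin A.m) (hfi : ∀ x, x ∉ A.dom i → f x = 0) (hfΩ : ∀ x, x ∉ Ω → f x = 0) :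
    integral A vol Ω f = ∫ y in A.ball, chartIntegrand A vol i f y := by
  set S : Fin A.m → Set M := fun k => Ω \ ⋃ j < k, A.dom j with hS
  have hV : ∀ k, IsOpen (⋃ j < k, A.dom j) := fun k =>
    isOpen_iUnion fun j => isOpen_iUnion fun _ => A.isOpen_dom j
  have hmeas : ∀ i k : Fin A.m,
      MeasurableSet (A.ball ∩ (A.chart i).symm ⁻¹' (A.dom k ∩ S k)) := fun i k => by
    rw [hS, ← Set.inter_sdiff_assoc]
    exact A.measurableSet_ball_inter i ((A.isOpen_dom k).inter hΩ) (hV k)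
  -- Each piece is carried over to the chart `i`; the part of the `k`-th piece outside `A.dom i`
  -- does not count because `f` vanishes there.
  have hpiece : ∀ k, ∫ y in A.piece Ω k, chartIntegrand A vol k f y =
      ∫ y in A.ball ∩ (A.chart i).symm ⁻¹' (A.dom k ∩ S k), chartIntegrand A vol i f y := by
    intro k
    rw [← setIntegral_chartIntegrand i k f (hmeas i k)]
    refine setIntegral_eq_of_subset_of_forall_sdiff_eq_zero
      (A.measurableSet_ball_inter k hΩ (hV k)) (fun y hy => ⟨hy.1, hy.2.2⟩) fun y hy => ?_
    rw [chartIntegrand, hfi _ fun h => hy.2 ⟨hy.1.1, h, hy.1.2⟩, zero_mul]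
  have hsum : integral A vol Ω f = ∑ k, ∫ y in A.piece Ω k, chartIntegrand A vol k f y := rfl
  rw [hsum, Finset.sum_congr rfl fun k _ => hpiece k, ← integral_biUnion_finset]
  · refine (setIntegral_eq_of_subset_of_forall_sdiff_eq_zero
      A.isOpen_ball.measurableSet ?_ fun y hy => ?_).symm
    · exact Set.iUnion₂_subset fun k _ => Set.inter_subset_left
    · rw [chartIntegrand, hfΩ, zero_mul]
      intro hyΩ
      have hne : {k : Fin A.m | (A.chart i).symm y ∈ A.dom k}.Nonempty :=
        ⟨i, A.symm_mem_dom i hy.1⟩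
      -- The least index of a chart domain containing the point names the piece to which it belongs.
      obtain ⟨k, hk, hmin⟩ := WellFounded.has_min (wellFounded_lt (α := Fin A.m)) _ hne
      refine hy.2 (Set.mem_iUnion₂.2 ⟨k, Finset.mem_univ _, hy.1, hk, hyΩ, fun hmem => ?_⟩)
      obtain ⟨j, hj, hjd⟩ := Set.mem_iUnion₂.1 hmem
      exact hmin j hjd hj
  · exact fun k _ => hmeas i k
  · have hlt : ∀ k l : Fin A.m, k < l →
        Disjoint (A.ball ∩ (A.chart i).symm ⁻¹' (A.dom k ∩ S k))
          (A.ball ∩ (A.chart i).symm ⁻¹' (A.dom l ∩ S l)) := fun k l hkl =>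
      Set.disjoint_left.2 fun y hyk hyl => hyl.2.2.2 (Set.mem_iUnion₂.2 ⟨k, hkl, hyk.2.1⟩)
    intro k _ l _ hkl
    rcases hkl.lt_or_gt with h | h
    · exact hlt k l h
    · exact (hlt l k h).symm
  · exact fun k _ => (integrableOn_chartIntegrand hf i).mono_set Set.inter_subset_left

theorem integral_chartIntegrand_eq {f : M → ℝ} (hf : Continuous f) (i k : Fin A.m)
    (hfi : ∀ x, x ∉ A.dom i → f x = 0) (hfk : ∀ x, x ∉ A.dom k → f x = 0) :
    ∫ y in A.ball, chartIntegrand A vol i f y = ∫ y in A.ball, chartIntegrand A vol k f y := by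
  rw [← integral_eq_chartIntegrand isOpen_univ hf i hfi (by simp),
    ← integral_eq_chartIntegrand isOpen_univ hf k hfk (by simp)]

end Integral

/-! ### Passage between the norms of the statement and `HolderBound` -/

section Norms

set_option maxSynthPendingDepth 3
set_option linter.unusedSectionVars false

variable {n : ℕ} {F : Type} [NormedAddCommGroup F] [NormedSpace ℝ F]
  {D : Set (Eucl n)} {r : ℕ} {α : ℝ≥0}

theorem HolderBound.holderWith {K : ℝ} {f : Eucl n → F} (h : HolderBound r α D K f) :
    HolderWith K.toNNReal α (D.domRestrict (iteratedFDeriv ℝ r f)) := by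
  intro x y
  have := (h r le_rfl).2 x x.2 y y.2
  rw [edist_dist, edist_dist, ENNReal.ofReal_rpow_of_nonneg dist_nonneg α.coe_nonneg, dist_eq_norm,
    ← ENNReal.ofReal.eq_1, ← ENNReal.ofReal_mul' (Real.rpow_nonneg dist_nonneg _)]
  refine ENNReal.ofReal_le_ofReal ?_
  rw [Subtype.dist_eq, dist_eq_norm]
  exact this

theorem HolderBound.holderDeriv {K : ℝ} {f : Eucl n → F} (h : HolderBound r α D K f) :
    HolderDeriv D r α f := fun _ => h.holderWith.memHolder

theorem HolderBound.holderNormOn_le {K : ℝ} {f : Eucl n → F} (h : HolderBound r α D K f) :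
    holderNormOn D r α f ≤ ENNReal.ofReal K := by
  refine max_le (iSup₂_le fun k hk => iSup₂_le fun y hy => ?_) ?_
  · rw [← ofReal_norm]
    exact ENNReal.ofReal_le_ofReal ((h k hk).1 y hy)
  · split_ifs
    · exact zero_le
    · exact h.holderWith.eHolderNorm_le

theorem norm_iteratedFDeriv_le_of_holderNormOn_le {N : ℝ} (hN : 0 ≤ N) {f : Eucl n → F}
    (h : holderNormOn D r α f ≤ ENNReal.ofReal N) {k : ℕ} (hk : k ≤ r) {y : Eucl n} (hy : y ∈ D) :
    ‖iteratedFDeriv ℝ k f y‖ ≤ N := by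
  have h1 : ‖iteratedFDeriv ℝ k f y‖ₑ ≤ ENNReal.ofReal N :=
    (le_iSup₂_of_le (f := fun k (_ : k ≤ r) => ⨆ y ∈ D, ‖iteratedFDeriv ℝ k f y‖ₑ) k hk
      (le_iSup₂_of_le (f := fun y (_ : y ∈ D) => ‖iteratedFDeriv ℝ k f y‖ₑ) y hy le_rfl)).trans ((le_max_left _ _).trans h)
  rwa [← ofReal_norm, ENNReal.ofReal_le_ofReal_iff hN] at h1

/-- The factor `2` is there for `α = 0`, where the norm contains no seminorm and the difference is
bounded by two suprema. -/
theorem norm_sub_le_of_holderNormOn_le {N : ℝ} (hN : 0 ≤ N) {f : Eucl n → F}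
    (h : holderNormOn D r α f ≤ ENNReal.ofReal N) (hf : HolderDeriv D r α f)
    {x y : Eucl n} (hx : x ∈ D) (hy : y ∈ D) :
    ‖iteratedFDeriv ℝ r f x - iteratedFDeriv ℝ r f y‖ ≤ 2 * N * ‖x - y‖ ^ (α : ℝ) := by
  by_cases hα : α = 0
  · subst hα
    rw [NNReal.coe_zero, Real.rpow_zero, mul_one]
    linarith [norm_sub_le (iteratedFDeriv ℝ r f x) (iteratedFDeriv ℝ r f y),
      norm_iteratedFDeriv_le_of_holderNormOn_le hN h le_rfl hx,
      norm_iteratedFDeriv_le_of_holderNormOn_le hN h le_rfl hy]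
  · have h1 : eHolderNorm α (D.domRestrict (iteratedFDeriv ℝ r f)) ≤ ENNReal.ofReal N := by
      have := (le_max_right _ _).trans h
      rwa [if_neg hα] at this
    have hm := hf hα
    have h2 : (nnHolderNorm α (D.domRestrict (iteratedFDeriv ℝ r f)) : ℝ) ≤ N := by
      rw [← hm.coe_nnHolderNorm_eq_eHolderNorm, ENNReal.ofReal, ENNReal.coe_le_coe] at h1
      have h3 := NNReal.coe_le_coe.2 h1
      rwa [Real.coe_toNNReal N hN] at h3
    have h3 := hm.holderWith.dist_le ⟨x, hx⟩ ⟨y, hy⟩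
    rw [Subtype.dist_eq, dist_eq_norm, dist_eq_norm] at h3
    refine h3.trans (mul_le_mul_of_nonneg_right (by linarith) (Real.rpow_nonneg (norm_nonneg _) _))

theorem HolderBound.of_holderNormOn_le {R N : ℝ} (hN : 0 ≤ N) (hα : α ≤ 1) {f : Eucl n → F}
    (hfc : ContDiffOn ℝ r f (Metric.ball 0 R)) (hf : HolderDeriv (Metric.ball 0 R) r α f)
    (h : holderNormOn (Metric.ball 0 R) r α f ≤ ENNReal.ofReal N) :
    HolderBound r α (Metric.ball 0 R) (2 * N * max 1 (2 * R)) f := by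
  refine HolderBound.of_norm_le Metric.isOpen_ball (convex_ball _ _) (fun x hx y hy => ?_)
    α.coe_nonneg (by exact_mod_cast hα) (by positivity) hfc (fun k hk x hx => ?_)
    (fun x hx y hy => norm_sub_le_of_holderNormOn_le hN h hf hx hy)
  · rw [mem_ball_zero_iff] at hx hy
    linarith [norm_sub_le x y]
  · linarith [norm_iteratedFDeriv_le_of_holderNormOn_le hN h hk hx]

/-- Finiteness lets the extended norm be replaced by a real constant in the estimates and restored
at the end. -/
theorem holderNormOn_lt_top {U C : Set (Eucl n)} (hU : IsOpen U) (hC : IsCompact C) (hDC : D ⊆ C)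
    (hCU : C ⊆ U) {f : Eucl n → F} (hfc : ContDiffOn ℝ r f U) (hf : HolderDeriv D r α f) :
    holderNormOn D r α f < ⊤ := by
  have hk : ∀ k : ℕ, ∃ K, k ≤ r → ∀ x ∈ C, ‖iteratedFDeriv ℝ k f x‖ ≤ K := fun k => by
    by_cases hk : k ≤ r
    · obtain ⟨K, hK⟩ := hC.exists_bound_of_continuousOn (f := iteratedFDeriv ℝ k f) fun x hx =>
        ((hfc.contDiffAt (hU.mem_nhds (hCU hx))).continuousAt_iteratedFDeriv
          (by exact_mod_cast hk)).continuousWithinAt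
      exact ⟨K, fun _ => hK⟩
    · exact ⟨0, fun h => absurd h hk⟩
  choose K hK using hk
  refine max_lt ?_ ?_
  · refine lt_of_le_of_lt (iSup₂_le fun k hk => iSup₂_le fun y hy => ?_)
      (ENNReal.ofReal_lt_top (r := ∑ k ∈ Finset.range (r + 1), |K k|))
    rw [← ofReal_norm]
    refine ENNReal.ofReal_le_ofReal ((hK k hk y (hDC hy)).trans ((le_abs_self _).trans ?_))
    exact Finset.single_le_sum (f := fun k => |K k|) (fun _ _ => abs_nonneg _)
      (Finset.mem_range.2 (by omega))
  · split_ifs with hα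
    · exact ENNReal.zero_lt_top
    · exact eHolderNorm_lt_top.2 (hf hα)

end Norms

/-! ### Smooth cutoffs in Euclidean space -/

section Cutoff

set_option maxSynthPendingDepth 3

variable {n : ℕ} {F : Type} [NormedAddCommGroup F] [NormedSpace ℝ F]

theorem exists_cutoff {S O : Set (Eucl n)} (hS : IsCompact S) (hO : IsOpen O) (hSO : S ⊆ O) :
    ∃ η : Eucl n → ℝ, ContDiff ℝ ∞ η ∧ HasCompactSupport η ∧ tsupport η ⊆ O ∧
      ∀ x ∈ S, η x = 1 := by
  obtain ⟨T, hT, hST, hTO⟩ := exists_compact_between hS hO hSO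
  obtain ⟨η, hη, -, hsupp, h1⟩ := exists_contMDiff_support_eq_eq_one_iff (n := ⊤) (𝓡 n)
    isOpen_interior hS.isClosed hST
  have hts : tsupport η ⊆ T := by
    rw [tsupport, hsupp]
    exact closure_minimal interior_subset hT.isClosed
  exact ⟨η, hη.contDiff, hT.of_isClosed_subset (isClosed_tsupport η) hts, hts.trans hTO,
    fun x hx => (h1 x).1 hx⟩

theorem contDiff_of_eq_zero {k : WithTop ℕ∞} {f : Eucl n → F} {S O : Set (Eucl n)}
    (hS : IsClosed S) (hO : IsOpen O) (hSO : S ⊆ O) (hf : ContDiffOn ℝ k f O)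
    (h0 : ∀ x, x ∉ S → f x = 0) : ContDiff ℝ k f := by
  rw [contDiff_iff_contDiffAt]
  intro x
  by_cases hx : x ∈ S
  · exact hf.contDiffAt (hO.mem_nhds (hSO hx))
  · refine (contDiffAt_const (c := (0 : F))).congr_of_eventuallyEq ?_
    filter_upwards [hS.isOpen_compl.mem_nhds hx] with y hy using h0 y hy

theorem contDiff_cutoff_smul {η : Eucl n → ℝ} {f : Eucl n → F} {O : Set (Eucl n)}
    (hη : ContDiff ℝ ∞ η) (hO : IsOpen O) (hηO : tsupport η ⊆ O) (hf : ContDiffOn ℝ ∞ f O) :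
    ContDiff ℝ ∞ fun y => η y • f y :=
  contDiff_of_eq_zero (isClosed_tsupport η) hO hηO (hη.contDiffOn.smul hf) fun x hx => by
    rw [image_eq_zero_of_notMem_tsupport hx, zero_smul]

end Cutoff

/-! ### Estimates for a pushed-forward field in another chart -/

section PushForward

set_option maxSynthPendingDepth 3
set_option linter.unusedSectionVars false

variable {n : ℕ} {M : Type*} [TopologicalSpace M] [ChartedSpace (Eucl n) M]
  [IsManifold (𝓡 n) ∞ M] {e e' : OpenPartialHomeomorph M (Eucl n)}

theorem fieldInChart_pushField_of_mem (he : e ∈ IsManifold.maximalAtlas (𝓡 n) ∞ M)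
    (he' : e' ∈ IsManifold.maximalAtlas (𝓡 n) ∞ M) (u : Eucl n → Eucl n) {y : Eucl n}
    (hy : y ∈ overlap e' e) :
    fieldInChart (pushField e u) e' y =
      fderiv ℝ (transition e e') (transition e' e y) (u (transition e' e y)) := by
  have h := fieldInChart_transition (pushField e u) he he' (transition_mem_overlap hy)
  rw [transition_transition hy, fieldInChart_pushField he u (transition_mem_overlap hy).1] at h
  exact h.symm

theorem fieldInChart_pushField_of_notMem {u : Eucl n → Eucl n} {y : Eucl n}
    (hy : e'.symm y ∉ e.source) : fieldInChart (pushField e u) e' y = 0 := by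
  have h : toModel (pushField e u (e'.symm y)) = 0 := if_neg hy
  rw [fieldInChart_eq, h, map_zero]

/-- The expression of a push-forward in another chart is controlled by the original field. -/
theorem exists_holderBound_pushField [T2Space M] (he : e ∈ IsManifold.maximalAtlas (𝓡 n) ∞ M)
    (he' : e' ∈ IsManifold.maximalAtlas (𝓡 n) ∞ M) {S D C : Set (Eucl n)} (hS : IsCompact S)
    (hSe : S ⊆ e.target) (hD : IsOpen D) (hC : IsCompact C) (hDC : D ⊆ C) (hCe : C ⊆ e'.target)
    (r : ℕ) :
    ∃ c, 0 ≤ c ∧ ∀ (α K : ℝ) (u : Eucl n → Eucl n), 0 ≤ α → α ≤ 1 → 0 ≤ K → ContDiff ℝ r u →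
      (∀ y, y ∉ S → u y = 0) → HolderBound r α Set.univ K u →
      HolderBound r α D (c * K) (fieldInChart (pushField e u) e') := by
  set ψ := transition e' e with hψ
  have hψc : ContDiffOn ℝ ∞ ψ (overlap e' e) := contDiffOn_transition he' he
  have hclosed : IsClosed (e.symm '' S) :=
    (hS.image_of_continuousOn (e.continuousOn_symm.mono hSe)).isClosed
  have hT : IsCompact (C ∩ e'.symm ⁻¹' (e.symm '' S)) :=
    hC.of_isClosed_subset ((e'.continuousOn_symm.mono hCe).preimage_isClosed_of_isClosed
      hC.isClosed hclosed) Set.inter_subset_left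
  have hTO : C ∩ e'.symm ⁻¹' (e.symm '' S) ⊆ overlap e' e := by
    rintro y ⟨hyC, z, hz, hzy⟩
    refine ⟨hCe hyC, ?_⟩
    rw [Set.mem_preimage, ← hzy]
    exact e.map_target (hSe hz)
  -- The transition data exist only on the overlap. The cutoff `η₁` is one on the points of `C` that
  -- represent the image of `S` and globalizes the Jacobian; `η₂` is one on the support of `η₁` and
  -- globalizes the transition map. Wherever `η₁` is nonzero the modified map is thus the true one.
  obtain ⟨η₁, hη₁, hη₁c, hη₁O, hη₁T⟩ := exists_cutoff hT isOpen_overlap hTO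
  obtain ⟨η₂, hη₂, hη₂c, hη₂O, hη₂T⟩ := exists_cutoff hη₁c isOpen_overlap hη₁O
  have hJ : ContDiffOn ℝ ∞ (fun y => fderiv ℝ (transition e e') (ψ y)) (overlap e' e) :=
    ((contDiffOn_transition he he').fderiv_of_isOpen isOpen_overlap (by simp)).comp hψc
      fun y hy => transition_mem_overlap hy
  have hA := contDiff_cutoff_smul hη₁ isOpen_overlap hη₁O hJ
  have hψ' := contDiff_cutoff_smul hη₂ isOpen_overlap hη₂O hψc
  set A := fun y => η₁ y • fderiv ℝ (transition e e') (ψ y) with hAdef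
  set ψ' := fun y => η₂ y • ψ y with hψ'def
  have hAc : HasCompactSupport A := hη₁c.smul_right
  have hψ'c : HasCompactSupport ψ' := hη₂c.smul_right
  obtain ⟨a, ha0, ha⟩ := HolderBound.exists_of_hasCompactSupport hA hAc r
  obtain ⟨L₁, hL₁0, hL₁⟩ := HolderBound.exists_of_hasCompactSupport hψ' hψ'c 0
  obtain ⟨L₂, hL₂0, hL₂⟩ := HolderBound.exists_of_hasCompactSupport
    (hψ'.fderiv_right (m := ∞) (by simp)) (hψ'c.fderiv ℝ) r
  set L := max 1 (max L₁ L₂) with hLdef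
  have hL1 : 1 ≤ L := le_max_left _ _
  have hLip : ∀ x y, ‖ψ' x - ψ' y‖ ≤ L * ‖x - y‖ := fun x y => by
    have := (holderBound_zero.1 (hL₁ 1 zero_le_one le_rfl)).2 x trivial y trivial
    rw [Real.rpow_one] at this
    exact this.trans (mul_le_mul_of_nonneg_right ((le_max_left _ _).trans (le_max_right _ _))
      (norm_nonneg _))
  let B : (Eucl n →L[ℝ] Eucl n) →L[ℝ] Eucl n →L[ℝ] Eucl n :=
    ContinuousLinearMap.id ℝ (Eucl n →L[ℝ] Eucl n)
  refine ⟨2 ^ (r + 1) * ‖B‖ * a * ((2 ^ (r + 1)) ^ r * L ^ (r + 1)), by positivity,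
    fun α K u hα0 hα hK hu huS hub => ?_⟩
  have h1 := hub.comp hα0 hα hK hL1 hu hLip
    ((hL₂ α hα0 hα).mono ((le_max_right _ _).trans (le_max_right _ _))) hψ'
  have h2 := HolderBound.bilin isOpen_univ B ha0 (by positivity) (ha α hα0 hα) h1
    (hA.of_le (by exact_mod_cast le_top)).contDiffOn
    (hu.comp (hψ'.of_le (by exact_mod_cast le_top))).contDiffOn
  refine ((h2.mono (le_of_eq (by ring))).mono_set (Set.subset_univ D)).congr hD fun y hy => ?_
  change fieldInChart (pushField e u) e' y = η₁ y • fderiv ℝ (transition e e') (ψ y) (u (ψ' y))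
  -- The global formula is exact in all three cases: over the image of `S` both cutoffs are one,
  -- elsewhere in the overlap `u` vanishes at the corresponding point, and outside the overlap both
  -- sides are zero.
  by_cases hyT : y ∈ C ∩ e'.symm ⁻¹' (e.symm '' S)
  · have hy2 : η₂ y = 1 := hη₂T y (subset_tsupport _ (by simp [hη₁T y hyT]))
    rw [fieldInChart_pushField_of_mem he he' u (hTO hyT), hη₁T y hyT, one_smul, hψ'def]
    simp only [hy2, one_smul]
    rfl
  · by_cases hyO : y ∈ overlap e' e
    · have hu0 : u (ψ y) = 0 := by
        refine huS _ fun hmem => hyT ⟨hDC hy, ψ y, hmem, ?_⟩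
        exact symm_transition hyO
      rw [fieldInChart_pushField_of_mem he he' u hyO, ← hψ, hu0, map_zero]
      by_cases h0 : η₁ y = 0
      · rw [h0, zero_smul]
      · have hy2 : η₂ y = 1 := hη₂T y (subset_tsupport _ h0)
        simp only [hψ'def, hy2, one_smul, hu0, map_zero, smul_zero]
    · rw [fieldInChart_pushField_of_notMem fun h => hyO ⟨hCe (hDC hy), h⟩,
        image_eq_zero_of_notMem_tsupport fun h => hyO (hη₁O h), zero_smul]

end PushForward

/-! ### Linearity and locality of the divergence -/

section Divergence

set_option maxSynthPendingDepth 3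
set_option linter.unusedSectionVars false

variable {n : ℕ} {M : Type*} [TopologicalSpace M] [ChartedSpace (Eucl n) M]
  {e : OpenPartialHomeomorph M (Eucl n)} {v w : ∀ x : M, TangentSpace (𝓡 n) x}

theorem fieldInChart_add : fieldInChart (v + w) e = fieldInChart v e + fieldInChart w e :=
  funext fun y => map_add (dchart e (e.symm y)) (toModel (v (e.symm y))) (toModel (w (e.symm y)))

theorem fieldInChart_smul (t : ℝ) : fieldInChart (t • v) e = t • fieldInChart v e :=
  funext fun y => map_smul (dchart e (e.symm y)) t (toModel (v (e.symm y)))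

theorem fieldInChart_zero : fieldInChart (0 : ∀ x : M, TangentSpace (𝓡 n) x) e = 0 :=
  funext fun y => map_zero (dchart e (e.symm y))

theorem fieldInChart_sum {ι : Type*} (s : Finset ι) (v : ι → ∀ x : M, TangentSpace (𝓡 n) x) :
    fieldInChart (∑ j ∈ s, v j) e = ∑ j ∈ s, fieldInChart (v j) e := by
  classical
  induction s using Finset.induction_on with
  | empty => simpa using fieldInChart_zero
  | insert a s ha ih => rw [Finset.sum_insert ha, Finset.sum_insert ha, fieldInChart_add, ih]

variable [IsManifold (𝓡 n) ∞ M]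

theorem pushField_add (u u' : Eucl n → Eucl n) :
    pushField e (fun y => u y + u' y) = pushField e u + pushField e u' := by
  funext x
  by_cases hx : x ∈ e.source
  · have h1 := toModel_pushField (u := fun y => u y + u' y) hx
    rw [map_add, ← toModel_pushField hx, ← toModel_pushField hx] at h1
    exact h1
  · have h : ∀ w : Eucl n → Eucl n, toModel (pushField e w x) = 0 := fun w => if_neg hx
    have h1 : toModel (pushField e (fun y => u y + u' y) x) =
      toModel (pushField e u x) + toModel (pushField e u' x) := by simp only [h, add_zero]
    exact h1

theorem pushField_smul (t : ℝ) (u : Eucl n → Eucl n) :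
    pushField e (fun y => t • u y) = t • pushField e u := by
  funext x
  by_cases hx : x ∈ e.source
  · have h1 := toModel_pushField (u := fun y => t • u y) hx
    rw [map_smul, ← toModel_pushField hx] at h1
    exact h1
  · have h : ∀ w : Eucl n → Eucl n, toModel (pushField e w x) = 0 := fun w => if_neg hx
    have h1 : toModel (pushField e (fun y => t • u y) x) = t • toModel (pushField e u x) := by
      simp only [h, smul_zero]
    exact h1

/-- The field `v` is of class `C^k`. -/
abbrev IsCField (k : WithTop ℕ∞) (v : ∀ x : M, TangentSpace (𝓡 n) x) : Prop :=
  ContMDiff (𝓡 n) (𝓡 n).tangent k (fun x => (⟨x, v x⟩ : TangentBundle (𝓡 n) M))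

theorem IsCField.add {k : ℕ∞} (hv : IsCField k v) (hw : IsCField k w) : IsCField k (v + w) := by
  have : IsManifold (𝓡 n) ((k : WithTop ℕ∞) + 1) M :=
    IsManifold.of_le (n := ∞) (by exact_mod_cast le_top)
  have : IsManifold (𝓡 n) 1 M := IsManifold.of_le (n := ∞) (by exact_mod_cast le_top)
  exact ContMDiff.add_section hv hw

theorem IsCField.smul {k : ℕ∞} (t : ℝ) (hv : IsCField k v) : IsCField k (t • v) := by
  have : IsManifold (𝓡 n) ((k : WithTop ℕ∞) + 1) M :=
    IsManifold.of_le (n := ∞) (by exact_mod_cast le_top)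
  have : IsManifold (𝓡 n) 1 M := IsManifold.of_le (n := ∞) (by exact_mod_cast le_top)
  exact ContMDiff.const_smul_section hv

theorem IsCField.zero {k : ℕ∞} : IsCField k (0 : ∀ x : M, TangentSpace (𝓡 n) x) := by
  have : IsManifold (𝓡 n) 1 M := IsManifold.of_le (n := ∞) (by exact_mod_cast le_top)
  have : IsManifold (𝓡 n) ((k : WithTop ℕ∞) + 1) M :=
    IsManifold.of_le (n := ∞) (by exact_mod_cast le_top)
  exact Bundle.contMDiff_zeroSection ℝ (TangentSpace (𝓡 n) : M → Type _)

theorem IsCField.sum {k : ℕ∞} {ι : Type*} (s : Finset ι)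
    {v : ι → ∀ x : M, TangentSpace (𝓡 n) x} (hv : ∀ j ∈ s, IsCField k (v j)) :
    IsCField k (∑ j ∈ s, v j) := by
  classical
  induction s using Finset.induction_on with
  | empty => simpa using IsCField.zero
  | insert a s ha ih =>
    rw [Finset.sum_insert ha]
    exact (hv a (Finset.mem_insert_self _ _)).add
      (ih fun j hj => hv j (Finset.mem_insert_of_mem hj))

theorem differentiableAt_density_smul (vol : VolumeForm n M)
    (hv : IsCField 1 v) (he : e ∈ IsManifold.maximalAtlas (𝓡 n) ∞ M) {y : Eucl n}
    (hy : y ∈ e.target) :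
    DifferentiableAt ℝ (fun y => density vol.toFun e y • fieldInChart v e y) y := by
  have h1 := (vol.smooth e he).contDiffAt (e.open_target.mem_nhds hy)
  have h2 : ContDiffOn ℝ (1 : ℕ∞) (fieldInChart v e) _ :=
    contDiffOn_fieldInChart he isOpen_univ (by exact_mod_cast hv.contMDiffOn)
  rw [Set.preimage_univ, Set.inter_univ] at h2
  exact (h1.differentiableAt (by simp)).smul
    ((h2.contDiffAt (e.open_target.mem_nhds hy)).differentiableAt (by simp))

theorem divergence_add (vol : VolumeForm n M) (hv : IsCField 1 v) (hw : IsCField 1 w) :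
    divergence vol (v + w) = divergence vol v + divergence vol w := by
  funext x
  have hx := (chartAt (Eucl n) x).map_source (mem_chart_source (Eucl n) x)
  have he := IsManifold.chart_mem_maximalAtlas (I := 𝓡 n) (n := ∞) x
  have := fderiv_fun_add (differentiableAt_density_smul vol hv he hx)
    (differentiableAt_density_smul vol hw he hx)
  simp only [divergence, fieldInChart_add, Pi.add_apply, smul_add]
  rw [this, ContinuousLinearMap.toLinearMap_add, map_add, mul_add]

theorem divergence_smul (vol : VolumeForm n M) (t : ℝ) (hv : IsCField 1 v) :
    divergence vol (t • v) = t • divergence vol v := by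
  funext x
  have hx := (chartAt (Eucl n) x).map_source (mem_chart_source (Eucl n) x)
  have he := IsManifold.chart_mem_maximalAtlas (I := 𝓡 n) (n := ∞) x
  have := fderiv_fun_const_smul (differentiableAt_density_smul vol hv he hx) t
  simp only [divergence, fieldInChart_smul, Pi.smul_apply, smul_comm _ t]
  rw [this, ContinuousLinearMap.toLinearMap_smul, map_smul, smul_eq_mul, smul_eq_mul,
    mul_left_comm]

theorem divergence_zero (vol : VolumeForm n M) :
    divergence vol (0 : ∀ x : M, TangentSpace (𝓡 n) x) = 0 := by
  have := divergence_smul vol (0 : ℝ) (IsCField.zero (M := M) (n := n) (k := 1))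
  simpa using this

theorem divergence_sum (vol : VolumeForm n M) {ι : Type*} (s : Finset ι)
    {v : ι → ∀ x : M, TangentSpace (𝓡 n) x} (hv : ∀ j ∈ s, IsCField 1 (v j)) :
    divergence vol (∑ j ∈ s, v j) = ∑ j ∈ s, divergence vol (v j) := by
  classical
  induction s using Finset.induction_on with
  | empty => simpa using divergence_zero vol
  | insert a s ha ih =>
    have h1 : ∀ j ∈ s, IsCField 1 (v j) := fun j hj => hv j (Finset.mem_insert_of_mem hj)
    rw [Finset.sum_insert ha, Finset.sum_insert ha,
      divergence_add vol (hv a (Finset.mem_insert_self _ _)) (IsCField.sum (k := 1) s h1), ih h1]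

theorem divergence_eq_zero (vol : VolumeForm n M) {x : M} (h : ∀ᶠ z in 𝓝 x, v z = 0) :
    divergence vol v x = 0 := by
  set e := chartAt (Eucl n) x with he
  have hx : x ∈ e.source := mem_chart_source _ x
  have hev : (fun y => density vol.toFun e y • fieldInChart v e y) =ᶠ[𝓝 (e x)] fun _ => 0 := by
    have h1 : Filter.Tendsto e.symm (𝓝 (e x)) (𝓝 x) := e.tendsto_symm hx
    filter_upwards [h1.eventually h] with y hy
    have : toModel (v (e.symm y)) = 0 := hy
    rw [fieldInChart_eq, this, map_zero, smul_zero]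
  rw [divergence, ← he, hev.fderiv_eq]
  simp

theorem contDiffOn_abs_density (vol : VolumeForm n M)
    (he : e ∈ IsManifold.maximalAtlas (𝓡 n) ∞ M) :
    ContDiffOn ℝ ∞ (fun y => |density vol.toFun e y|) e.target :=
  (vol.smooth e he).norm ℝ fun _ hy => density_ne_zero vol he hy

/-- A continuous nonvanishing density has locally constant sign. Dividing by its absolute value
instead of the density itself costs only this sign, which cancels in the divergence. -/
theorem eventually_sign_density (vol : VolumeForm n M)
    (he : e ∈ IsManifold.maximalAtlas (𝓡 n) ∞ M) {y : Eucl n} (hy : y ∈ e.target) :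
    ∃ s : ℝ, ∀ᶠ z in 𝓝 y, density vol.toFun e z ≠ 0 ∧
      density vol.toFun e z * |density vol.toFun e z|⁻¹ = s := by
  have hc : ContinuousAt (density vol.toFun e) y :=
    (vol.smooth e he).continuousOn.continuousAt (e.open_target.mem_nhds hy)
  rcases (density_ne_zero vol he hy).lt_or_gt with h | h
  · refine ⟨-1, ?_⟩
    filter_upwards [hc.eventually (gt_mem_nhds h)] with z hz
    rw [abs_of_neg hz, inv_neg, mul_neg, mul_inv_cancel₀ hz.ne]
    exact ⟨hz.ne, rfl⟩
  · refine ⟨1, ?_⟩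
    filter_upwards [hc.eventually (lt_mem_nhds h)] with z hz
    rw [abs_of_pos hz, mul_inv_cancel₀ hz.ne']
    exact ⟨hz.ne', rfl⟩

/-- The divergence of the field that is `|ρ|⁻¹ L` in the chart `e`. -/
theorem divergence_pushField [T2Space M] (vol : VolumeForm n M)
    (he : e ∈ IsManifold.maximalAtlas (𝓡 n) ∞ M) {L : Eucl n → Eucl n}
    (hL : Differentiable ℝ L)
    (hv : IsCField 1 (pushField e fun y => |density vol.toFun e y|⁻¹ • L y))
    {x : M} (hx : x ∈ e.source) :
    divergence vol (pushField e fun y => |density vol.toFun e y|⁻¹ • L y) x =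
      |density vol.toFun e (e x)|⁻¹ *
        LinearMap.trace ℝ (Eucl n) (fderiv ℝ L (e x) : Eucl n →ₗ[ℝ] Eucl n) := by
  have hy := e.map_source hx
  obtain ⟨s, hs⟩ := eventually_sign_density vol he hy
  have hev : (fun y => density vol.toFun e y • fieldInChart
      (pushField e fun y => |density vol.toFun e y|⁻¹ • L y) e y) =ᶠ[𝓝 (e x)]
      fun y => s • L y := by
    filter_upwards [hs, e.open_target.mem_nhds hy] with z hz hzt
    rw [fieldInChart_pushField he _ hzt, smul_smul, hz.2]
  rw [divergence_eq vol hv he hx, hev.fderiv_eq, fderiv_fun_const_smul (hL _),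
    ContinuousLinearMap.toLinearMap_smul, map_smul, smul_eq_mul, ← mul_assoc,
    ← hs.self_of_nhds.2, inv_mul_cancel_left₀ hs.self_of_nhds.1]

/-- The function on the manifold that is `g` in the chart `e`. -/
def pullFun (e : OpenPartialHomeomorph M (Eucl n)) (g : Eucl n → ℝ) (x : M) : ℝ :=
  e.source.indicator (fun x => g (e x)) x

theorem pullFun_eq_zero {g : Eucl n → ℝ} {S : Set (Eucl n)} (h0 : ∀ y, y ∉ S → g y = 0) {x : M}
    (hx : x ∉ e.symm '' S) : pullFun e g x = 0 := by
  by_cases h : x ∈ e.source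
  · rw [pullFun, Set.indicator_of_mem h, h0]
    exact fun hS => hx ⟨e x, hS, e.left_inv h⟩
  · rw [pullFun, Set.indicator_of_notMem h]

theorem contMDiff_pullFun [T2Space M] (he : e ∈ IsManifold.maximalAtlas (𝓡 n) ∞ M)
    {g : Eucl n → ℝ} {S : Set (Eucl n)} (hS : IsCompact S) (hSe : S ⊆ e.target)
    (hg : ContDiffOn ℝ ∞ g e.target) (h0 : ∀ y, y ∉ S → g y = 0) :
    ContMDiff (𝓡 n) 𝓘(ℝ, ℝ) ∞ (pullFun e g) := by
  have hC : IsClosed (e.symm '' S) :=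
    (hS.image_of_continuousOn (e.continuousOn_symm.mono hSe)).isClosed
  intro x
  by_cases hx : x ∈ e.source
  · have h1 : ContMDiffAt (𝓡 n) 𝓘(ℝ, ℝ) ∞ (fun z => g (e z)) x :=
      (hg.contDiffAt (e.open_target.mem_nhds (e.map_source hx))).contMDiffAt.comp x
        ((contMDiffOn_of_mem_maximalAtlas he).contMDiffAt (e.open_source.mem_nhds hx))
    refine h1.congr_of_eventuallyEq ?_
    filter_upwards [e.open_source.mem_nhds hx] with z hz
    rw [pullFun, Set.indicator_of_mem hz]
  · refine (contMDiffAt_const (c := (0 : ℝ))).congr_of_eventuallyEq ?_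
    filter_upwards [hC.isOpen_compl.mem_nhds (x := x) (by
      rintro ⟨y, hy, rfl⟩; exact hx (e.map_target (hSe hy)))] with z hz
    exact pullFun_eq_zero h0 hz

end Divergence

/-! ### Solving the equation in one coordinate ball -/

section LocalBalls

set_option maxSynthPendingDepth 3
set_option linter.unusedSectionVars false

open MeasureTheory

variable {n : ℕ} {M : Type*} [TopologicalSpace M] [ChartedSpace (Eucl n) M]

/-- A ball in one of the charts of the atlas whose double is contained in `Ω`. -/
structure LocalBall (A : RegularAtlas n M) (Ω : Set M) where
  i : Fin A.m
  c : Eucl n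
  ρ : ℝ
  ρ_pos : 0 < ρ
  subset_ball : Metric.closedBall c (2 * ρ) ⊆ A.ball
  mem : ∀ y ∈ Metric.closedBall c (2 * ρ), (A.chart i).symm y ∈ Ω

namespace LocalBall

variable {A : RegularAtlas n M} {Ω : Set M} (β : LocalBall A Ω) (vol : VolumeForm n M)

/-- The chart in which the ball is given. -/
abbrev chart : OpenPartialHomeomorph M (Eucl n) := A.chart β.i

/-- The part of the manifold represented by the open ball. -/
def region : Set M := β.chart.source ∩ β.chart ⁻¹' Metric.ball β.c β.ρ

theorem isOpen_region : IsOpen β.region := β.chart.isOpen_inter_preimage Metric.isOpen_ball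

theorem closedBall_subset : Metric.closedBall β.c β.ρ ⊆ Metric.closedBall β.c (2 * β.ρ) :=
  Metric.closedBall_subset_closedBall (by linarith [β.ρ_pos])

theorem closedBall_subset_target : Metric.closedBall β.c (2 * β.ρ) ⊆ β.chart.target :=
  β.subset_ball.trans (A.ball_subset β.i)

theorem ball_subset_target : Metric.ball β.c β.ρ ⊆ β.chart.target :=
  Metric.ball_subset_closedBall.trans (β.closedBall_subset.trans β.closedBall_subset_target)

theorem region_subset_dom : β.region ⊆ A.dom β.i := fun _ hx =>
  ⟨hx.1, β.subset_ball (β.closedBall_subset (Metric.ball_subset_closedBall hx.2))⟩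

theorem region_subset : β.region ⊆ Ω := fun x hx => by
  have := β.mem _ (β.closedBall_subset (Metric.ball_subset_closedBall hx.2))
  rwa [β.chart.left_inv hx.1] at this

theorem symm_center_mem_region : β.chart.symm β.c ∈ β.region := by
  have h := Metric.mem_ball_self (x := β.c) β.ρ_pos
  refine ⟨β.chart.map_target (β.ball_subset_target h), ?_⟩
  rw [Set.mem_preimage, β.chart.right_inv (β.ball_subset_target h)]
  exact h

/-- A smooth bump function of integral one supported in a ball about the origin. -/
def bump : ContDiffBump (0 : Eucl n) := ⟨β.ρ / 2, β.ρ, half_pos β.ρ_pos, half_lt_self β.ρ_pos⟩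

/-- The normalized bump function. -/
def θ : Eucl n → ℝ := β.bump.normed volume

theorem contDiff_θ : ContDiff ℝ ∞ β.θ := β.bump.contDiff_normed

theorem hasCompactSupport_θ : HasCompactSupport β.θ := β.bump.hasCompactSupport_normed

theorem integral_θ : ∫ y, β.θ y = 1 := β.bump.integral_normed

theorem θ_eq_zero {y : Eucl n} (hy : y ∉ Metric.closedBall 0 β.ρ) : β.θ y = 0 := by
  have h : Function.support β.θ = Metric.ball 0 β.ρ := β.bump.support_normed_eq
  by_contra hne
  exact hy (Metric.ball_subset_closedBall (h ▸ hne))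

theorem θ_sub_eq_zero {y : Eucl n} (hy : y ∉ Metric.closedBall β.c β.ρ) : β.θ (y - β.c) = 0 :=
  β.θ_eq_zero fun h => hy (by simpa [dist_eq_norm] using h)

/-- The field on the manifold obtained from the local operator, applied to a function `g` in the
chart. -/
def solve (g : Eucl n → ℝ) : ∀ x : M, TangentSpace (𝓡 n) x :=
  pushField β.chart fun y => |density vol.toFun β.chart y|⁻¹ • localOperator β.c β.θ g y

/-- The expression of the function `f` in the chart, multiplied by the density, and cut off. -/
def lift (f : M → ℝ) : Eucl n → ℝ :=
  (Metric.closedBall β.c β.ρ).indicator (chartIntegrand A vol β.i f)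

/-- A function on the manifold with integral one, supported in the ball. -/
def bumpFun : M → ℝ :=
  pullFun β.chart fun y => |density vol.toFun β.chart y|⁻¹ * β.θ (y - β.c)

theorem lift_eq_zero {f : M → ℝ} {y : Eucl n} (hy : y ∉ Metric.closedBall β.c β.ρ) :
    β.lift vol f y = 0 := Set.indicator_of_notMem hy _

/-- Density and cutoff stay with one factor. With `f` a cutoff function, the lift becomes a fixed
smooth function times the chart expression of `g`, which is the form that `HolderBound.bilin`
estimates. -/
theorem lift_mul (f g : M → ℝ) (y : Eucl n) :
    β.lift vol (f * g) y = β.lift vol f y * g (β.chart.symm y) := by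
  by_cases hy : y ∈ Metric.closedBall β.c β.ρ
  · rw [lift, lift, Set.indicator_of_mem hy, Set.indicator_of_mem hy, chartIntegrand,
      chartIntegrand, Pi.mul_apply]
    ring
  · rw [lift_eq_zero β vol hy, lift_eq_zero β vol hy, zero_mul]

theorem lift_add (f g : M → ℝ) : β.lift vol (f + g) = β.lift vol f + β.lift vol g := by
  rw [lift, lift, lift, ← Set.indicator_add']
  congr 1
  funext y
  simp [chartIntegrand, add_mul]

theorem lift_smul (t : ℝ) (f : M → ℝ) : β.lift vol (t • f) = t • β.lift vol f := by
  funext y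
  by_cases hy : y ∈ Metric.closedBall β.c β.ρ
  · simp [lift, Set.indicator_of_mem hy, chartIntegrand, mul_assoc]
  · simp [lift, Set.indicator_of_notMem hy]

theorem integral_lift {f : M → ℝ} (hf : ∀ x, x ∉ β.region → f x = 0) :
    ∫ y, β.lift vol f y = ∫ y in A.ball, chartIntegrand A vol β.i f y := by
  rw [lift, integral_indicator Metric.isClosed_closedBall.measurableSet]
  refine (setIntegral_eq_of_subset_of_forall_sdiff_eq_zero A.isOpen_ball.measurableSet
    (β.closedBall_subset.trans β.subset_ball) fun y hy => ?_).symm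
  rw [chartIntegrand, hf, zero_mul]
  intro h
  have h2 : β.chart (β.chart.symm y) ∈ Metric.ball β.c β.ρ := h.2
  rw [β.chart.right_inv (A.ball_subset β.i hy.1)] at h2
  exact hy.2 (Metric.ball_subset_closedBall h2)

variable [IsManifold (𝓡 n) ∞ M]

theorem mem_maximalAtlas : β.chart ∈ IsManifold.maximalAtlas (𝓡 n) ∞ M := A.mem_maximalAtlas β.i

theorem contDiffOn_inv_density :
    ContDiffOn ℝ ∞ (fun y => |density vol.toFun β.chart y|⁻¹) β.chart.target :=
  (contDiffOn_abs_density vol β.mem_maximalAtlas).inv fun _ hy =>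
    abs_ne_zero.2 (density_ne_zero vol β.mem_maximalAtlas hy)

theorem contDiffOn_comp_symm {k : ℕ∞} {f : M → ℝ} (hf : ContMDiff (𝓡 n) 𝓘(ℝ, ℝ) k f)
    {e : OpenPartialHomeomorph M (Eucl n)} (he : e ∈ IsManifold.maximalAtlas (𝓡 n) ∞ M) :
    ContDiffOn ℝ k (fun y => f (e.symm y)) e.target :=
  contMDiffOn_iff_contDiffOn.1 (hf.comp_contMDiffOn
    ((contMDiffOn_symm_of_mem_maximalAtlas he).of_le (by exact_mod_cast le_top)))

/-- The indicator creates no jump, since the closed support of `f` lies in the region of the open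
ball. -/
theorem contDiff_lift {k : ℕ∞} {f : M → ℝ} (hf : ContMDiff (𝓡 n) 𝓘(ℝ, ℝ) k f)
    (hfs : tsupport f ⊆ β.region) : ContDiff ℝ k (β.lift vol f) := by
  have hsub : Metric.closedBall β.c β.ρ ⊆ β.chart.target :=
    β.closedBall_subset.trans β.closedBall_subset_target
  refine contDiff_of_eq_zero (O := Metric.ball β.c β.ρ)
    ((β.chart.continuousOn_symm.mono hsub).preimage_isClosed_of_isClosed
      Metric.isClosed_closedBall (isClosed_tsupport f)) Metric.isOpen_ball ?_ ?_ ?_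
  · intro y hy
    have := (hfs hy.2).2
    rwa [Set.mem_preimage, β.chart.right_inv (hsub hy.1)] at this
  · have h1 : ContDiffOn ℝ k (chartIntegrand A vol β.i f) β.chart.target :=
      (contDiffOn_comp_symm hf β.mem_maximalAtlas).mul
        ((contDiffOn_abs_density vol β.mem_maximalAtlas).of_le (by exact_mod_cast le_top))
    exact (h1.mono β.ball_subset_target).congr fun y hy =>
      Set.indicator_of_mem (Metric.ball_subset_closedBall hy) _
  · intro y hy
    by_cases hyb : y ∈ Metric.closedBall β.c β.ρ
    · have h0 : f (β.chart.symm y) = 0 := image_eq_zero_of_notMem_tsupport fun h => hy ⟨hyb, h⟩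
      rw [lift, Set.indicator_of_mem hyb, chartIntegrand, h0, zero_mul]
    · exact β.lift_eq_zero vol hyb

theorem hasCompactSupport_of_eq_zero {g : Eucl n → ℝ}
    (hg0 : ∀ y, y ∉ Metric.closedBall β.c β.ρ → g y = 0) : HasCompactSupport g :=
  HasCompactSupport.intro (isCompact_closedBall β.c β.ρ) fun y hy => hg0 y hy

theorem localOperator_eq_zero {g : Eucl n → ℝ}
    (hg0 : ∀ y, y ∉ Metric.closedBall β.c β.ρ → g y = 0) {y : Eucl n}
    (hy : y ∉ Metric.closedBall β.c (2 * β.ρ)) : localOperator β.c β.θ g y = 0 :=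
  DivEq.localOperator_eq_zero (fun _ h => β.θ_eq_zero h) hg0 hy

theorem contDiff_inv_density_smul {r : ℕ} {g : Eucl n → ℝ} (hg : ContDiff ℝ r g)
    (hg0 : ∀ y, y ∉ Metric.closedBall β.c β.ρ → g y = 0) :
    ContDiff ℝ r fun y => |density vol.toFun β.chart y|⁻¹ • localOperator β.c β.θ g y :=
  contDiff_of_eq_zero Metric.isClosed_closedBall β.chart.open_target β.closedBall_subset_target
    (((β.contDiffOn_inv_density vol).of_le (by exact_mod_cast le_top)).smul
      (localOperator_contDiff β.contDiff_θ β.hasCompactSupport_θ hg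
        (β.hasCompactSupport_of_eq_zero hg0)).contDiffOn)
    fun y hy => by rw [β.localOperator_eq_zero hg0 hy, smul_zero]

theorem isCField_solve [T2Space M] {r : ℕ} {g : Eucl n → ℝ} (hg : ContDiff ℝ r g)
    (hg0 : ∀ y, y ∉ Metric.closedBall β.c β.ρ → g y = 0) : IsCField r (β.solve vol g) :=
  contMDiff_pushField (k := r) β.mem_maximalAtlas (β.contDiff_inv_density_smul vol hg hg0)
    (isCompact_closedBall _ _) β.closedBall_subset_target
    fun y hy => by rw [β.localOperator_eq_zero hg0 hy, smul_zero]

theorem closure_solve_subset [T2Space M] {g : Eucl n → ℝ}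
    (hg0 : ∀ y, y ∉ Metric.closedBall β.c β.ρ → g y = 0) :
    closure {x | β.solve vol g x ≠ 0} ⊆ Ω := by
  refine (closure_pushField_subset (isCompact_closedBall β.c (2 * β.ρ))
    β.closedBall_subset_target fun y hy => by
      rw [β.localOperator_eq_zero hg0 hy, smul_zero]).trans ?_
  rintro x ⟨y, hy, rfl⟩
  exact β.mem y hy

/-- Inside the chart this is `trace_fderiv_localOperator` divided by the density. Outside, the field
vanishes nearby and so do both functions on the right. -/
theorem divergence_solve [T2Space M] {g : Eucl n → ℝ} (hg : ContDiff ℝ 1 g)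
    (hg0 : ∀ y, y ∉ Metric.closedBall β.c β.ρ → g y = 0) (x : M) :
    divergence vol (β.solve vol g) x =
      pullFun β.chart (fun y => |density vol.toFun β.chart y|⁻¹ * g y) x -
        (∫ y, g y) * β.bumpFun vol x := by
  have hgc := β.hasCompactSupport_of_eq_zero hg0
  have hg1 : ContDiff ℝ (1 : ℕ) g := by exact_mod_cast hg
  by_cases hx : x ∈ β.chart.source
  · have hL := localOperator_contDiff (c := β.c) β.contDiff_θ β.hasCompactSupport_θ hg1 hgc
    have hcf : IsCField 1 (β.solve vol g) := by exact_mod_cast β.isCField_solve vol hg1 hg0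
    have h := divergence_pushField vol β.mem_maximalAtlas (hL.differentiable (by simp)) hcf hx
    rw [trace_fderiv_localOperator β.contDiff_θ β.hasCompactSupport_θ β.integral_θ hg hgc] at h
    rw [solve, h, bumpFun, pullFun, pullFun, Set.indicator_of_mem hx, Set.indicator_of_mem hx]
    ring
  · rw [divergence_eq_zero, bumpFun, pullFun, pullFun, Set.indicator_of_notMem hx,
      Set.indicator_of_notMem hx]
    · ring
    · have hcl := closure_pushField_subset (isCompact_closedBall β.c (2 * β.ρ))
        β.closedBall_subset_target (u := fun y => |density vol.toFun β.chart y|⁻¹ •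
          localOperator β.c β.θ g y) fun y hy => by
        rw [β.localOperator_eq_zero hg0 hy, smul_zero]
      have hxc : x ∉ closure {x | β.solve vol g x ≠ 0} := by
        intro h
        obtain ⟨y, hy, rfl⟩ := hcl h
        exact hx (β.chart.map_target (β.closedBall_subset_target hy))
      filter_upwards [isClosed_closure.isOpen_compl.mem_nhds hxc] with z hz
      by_contra hne
      exact hz (subset_closure hne)

theorem pullFun_lift {f : M → ℝ} (hf : ∀ x, x ∉ β.region → f x = 0) (x : M) :
    pullFun β.chart (fun y => |density vol.toFun β.chart y|⁻¹ * β.lift vol f y) x = f x := by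
  by_cases hx : x ∈ β.region
  · have hne := density_ne_zero vol β.mem_maximalAtlas (β.chart.map_source hx.1)
    rw [pullFun, Set.indicator_of_mem hx.1, lift,
      Set.indicator_of_mem (Metric.ball_subset_closedBall hx.2), chartIntegrand,
      β.chart.left_inv hx.1]
    field_simp
  · rw [hf x hx]
    by_cases hxs : x ∈ β.chart.source
    · rw [pullFun, Set.indicator_of_mem hxs, lift]
      by_cases hb : β.chart x ∈ Metric.closedBall β.c β.ρ
      · rw [Set.indicator_of_mem hb, chartIntegrand, β.chart.left_inv hxs, hf x hx]
        ring
      · rw [Set.indicator_of_notMem hb, mul_zero]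
    · rw [pullFun, Set.indicator_of_notMem hxs]

theorem solve_add {g g' : Eucl n → ℝ} (hg : Continuous g)
    (hg0 : ∀ y, y ∉ Metric.closedBall β.c β.ρ → g y = 0) (hg' : Continuous g')
    (hg0' : ∀ y, y ∉ Metric.closedBall β.c β.ρ → g' y = 0) :
    β.solve vol (g + g') = β.solve vol g + β.solve vol g' := by
  have h := localOperator_add (c := β.c) β.contDiff_θ.continuous β.hasCompactSupport_θ hg
    (β.hasCompactSupport_of_eq_zero hg0) hg' (β.hasCompactSupport_of_eq_zero hg0')
  simp only [solve, h, Pi.add_apply, smul_add]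
  exact pushField_add _ _

theorem solve_smul (t : ℝ) (g : Eucl n → ℝ) : β.solve vol (t • g) = t • β.solve vol g := by
  have h := localOperator_smul (c := β.c) (θ := β.θ) (f := g) t
  simp only [solve, h, Pi.smul_apply, smul_comm _ t]
  exact pushField_smul _ _

/-- The constants belong, in this order, to the local operator, the inverse density on `A.ball`, the
extension by zero from `A.ball` and the push-forward read in chart `k`. -/
theorem exists_holderBound_solve [T2Space M] (k : Fin A.m) (r : ℕ) :
    ∃ C, 0 ≤ C ∧ ∀ (α K : ℝ) (g : Eucl n → ℝ), 0 ≤ α → α ≤ 1 → 0 ≤ K → ContDiff ℝ r g →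
      (∀ y, y ∉ Metric.closedBall β.c β.ρ → g y = 0) → HolderBound r α Set.univ K g →
      HolderBound r α A.ball (C * K) (fieldInChart (β.solve vol g) (A.chart k)) := by
  obtain ⟨C₁, hC₁0, hC₁⟩ := exists_holderBound_localOperator β.contDiff_θ β.hasCompactSupport_θ
    β.c β.ρ r
  obtain ⟨C₂, hC₂0, hC₂⟩ := HolderBound.exists_of_contDiffOn β.chart.open_target
    (isCompact_closedBall 0 A.radius) A.isOpen_ball (convex_ball 0 A.radius)
    Metric.ball_subset_closedBall (A.closedBall_subset β.i) (β.contDiffOn_inv_density vol) r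
  obtain ⟨C₃, hC₃1, hC₃⟩ := HolderBound.exists_extend (F := Eucl n) A.isOpen_ball
    (isCompact_closedBall β.c (2 * β.ρ)) β.subset_ball
  obtain ⟨C₄, hC₄0, hC₄⟩ := exists_holderBound_pushField β.mem_maximalAtlas
    (A.mem_maximalAtlas k) (isCompact_closedBall β.c (2 * β.ρ)) β.closedBall_subset_target
    A.isOpen_ball (isCompact_closedBall 0 A.radius) Metric.ball_subset_closedBall
    (A.closedBall_subset k) r
  let B : ℝ →L[ℝ] Eucl n →L[ℝ] Eucl n := ContinuousLinearMap.lsmul ℝ ℝ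
  have hC₃0 : 0 ≤ C₃ := zero_le_one.trans hC₃1
  refine ⟨C₄ * (C₃ * (2 ^ (r + 1) * ‖B‖ * C₂ * C₁)), by positivity,
    fun α K g hα0 hα hK hg hg0 hgb => ?_⟩
  have h1 := hC₁ α K g hα0 hα hK hg hg0 hgb
  have hL := localOperator_contDiff (c := β.c) β.contDiff_θ β.hasCompactSupport_θ hg
    (β.hasCompactSupport_of_eq_zero hg0)
  have h2 := HolderBound.bilin A.isOpen_ball B hC₂0 (by positivity) (hC₂ α hα0 hα)
    (h1.mono_set (Set.subset_univ _))
    (((β.contDiffOn_inv_density vol).mono (A.ball_subset β.i)).of_le (by exact_mod_cast le_top))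
    hL.contDiffOn
  have hz : ∀ y, y ∉ Metric.closedBall β.c (2 * β.ρ) →
      |density vol.toFun β.chart y|⁻¹ • localOperator β.c β.θ g y = 0 := fun y hy => by
    rw [β.localOperator_eq_zero hg0 hy, smul_zero]
  have h3 := hC₃ r α _ _ hα0 hα (by positivity) (closure_minimal (fun y hy => by
    by_contra hne
    exact hy (hz y hne)) Metric.isClosed_closedBall) h2
  exact (hC₄ α _ _ hα0 hα (by positivity) (β.contDiff_inv_density_smul vol hg hg0) hz h3).mono
    (le_of_eq (by ring))

theorem contMDiff_bumpFun [T2Space M] : ContMDiff (𝓡 n) 𝓘(ℝ, ℝ) ∞ (β.bumpFun vol) :=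
  contMDiff_pullFun β.mem_maximalAtlas (isCompact_closedBall β.c β.ρ)
    (β.closedBall_subset.trans β.closedBall_subset_target)
    ((β.contDiffOn_inv_density vol).mul
      (β.contDiff_θ.comp (contDiff_id.sub contDiff_const)).contDiffOn)
    fun y hy => by rw [β.θ_sub_eq_zero hy, mul_zero]

theorem bumpFun_eq_zero {x : M} (hx : x ∉ β.chart.symm '' Metric.closedBall β.c β.ρ) :
    β.bumpFun vol x = 0 :=
  pullFun_eq_zero (fun y hy => by rw [β.θ_sub_eq_zero hy, mul_zero]) hx

theorem integral_bumpFun : ∫ y in A.ball, chartIntegrand A vol β.i (β.bumpFun vol) y = 1 := by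
  have h1 : ∀ y ∈ A.ball, chartIntegrand A vol β.i (β.bumpFun vol) y = β.θ (y - β.c) := by
    intro y hy
    have hyt := A.ball_subset β.i hy
    have hne := density_ne_zero vol β.mem_maximalAtlas hyt
    rw [chartIntegrand, bumpFun, pullFun, Set.indicator_of_mem (β.chart.map_target hyt),
      β.chart.right_inv hyt]
    field_simp
  rw [setIntegral_congr_fun A.isOpen_ball.measurableSet h1,
    setIntegral_eq_integral_of_forall_compl_eq_zero,
    integral_sub_right_eq_self (fun y => β.θ y) β.c, β.integral_θ]
  exact fun y hy => β.θ_sub_eq_zero fun h => hy (β.subset_ball (β.closedBall_subset h))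

end LocalBall

end LocalBalls

/-! ### Linking balls and correcting the local solutions -/

section Assembly

set_option maxSynthPendingDepth 3
set_option linter.unusedSectionVars false

open MeasureTheory

variable {n : ℕ} {M : Type*} [TopologicalSpace M] [ChartedSpace (Eucl n) M]
  {A : RegularAtlas n M} {Ω : Set M}

theorem exists_localBall (hΩ : IsOpen Ω) {x : M} (hx : x ∈ Ω) {U : Set M} (hU : IsOpen U)
    (hxU : x ∈ U) : ∃ β : LocalBall A Ω, x ∈ β.region ∧
      ∀ y ∈ Metric.closedBall β.c (2 * β.ρ), β.chart.symm y ∈ U := by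
  obtain ⟨i, hxs, hxb⟩ := A.cover x
  have hmem : A.chart i x ∈ A.ball ∩ (A.chart i).symm ⁻¹' (Ω ∩ U) := by
    refine ⟨hxb, ?_⟩
    rw [Set.mem_preimage, (A.chart i).left_inv hxs]
    exact ⟨hx, hxU⟩
  obtain ⟨ε, hε, hsub⟩ := Metric.nhds_basis_closedBall.mem_iff.1
    ((A.isOpen_ball_inter i (hΩ.inter hU)).mem_nhds hmem)
  have h2 : 2 * (ε / 2) = ε := by ring
  refine ⟨⟨i, A.chart i x, ε / 2, half_pos hε, ?_, ?_⟩, ⟨hxs, ?_⟩, ?_⟩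
  · rw [h2]; exact fun y hy => (hsub hy).1
  · rw [h2]; exact fun y hy => (hsub hy).2.1
  · exact Metric.mem_ball_self (half_pos hε)
  · intro y hy
    have hy' : y ∈ Metric.closedBall (A.chart i x) (2 * (ε / 2)) := hy
    rw [h2] at hy'
    exact (hsub hy').2.2

variable [IsManifold (𝓡 n) ∞ M]

/-- The difference of the bump functions of the two balls is the divergence of a smooth field
supported in `Ω`. -/
def Linked (vol : VolumeForm n M) (β γ : LocalBall A Ω) : Prop :=
  ∃ w : ∀ x : M, TangentSpace (𝓡 n) x, IsCField ∞ w ∧ closure {x | w x ≠ 0} ⊆ Ω ∧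
    divergence vol w = β.bumpFun vol - γ.bumpFun vol

variable {vol : VolumeForm n M} {β γ δ : LocalBall A Ω}

theorem closure_add_subset {v w : ∀ x : M, TangentSpace (𝓡 n) x}
    (hv : closure {x | v x ≠ 0} ⊆ Ω) (hw : closure {x | w x ≠ 0} ⊆ Ω) :
    closure {x | (v + w) x ≠ 0} ⊆ Ω := by
  refine (closure_mono (t := {x | v x ≠ 0} ∪ {x | w x ≠ 0}) fun x hx => ?_).trans
    (closure_union.trans_subset (Set.union_subset hv hw))
  by_contra hcon
  simp only [Set.mem_union, Set.mem_ofPred_eq, not_or, not_not] at hcon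
  exact hx (by simp [hcon.1, hcon.2])

theorem closure_smul_subset {v : ∀ x : M, TangentSpace (𝓡 n) x} (t : ℝ)
    (hv : closure {x | v x ≠ 0} ⊆ Ω) : closure {x | (t • v) x ≠ 0} ⊆ Ω :=
  (closure_mono (s := {x | (t • v) x ≠ 0}) (t := {x | v x ≠ 0}) fun x hx h0 =>
    hx (by simp [show v x = 0 from h0])).trans hv

theorem IsCField.one {v : ∀ x : M, TangentSpace (𝓡 n) x} (hv : IsCField ∞ v) : IsCField 1 v :=
  hv.of_le (by exact_mod_cast le_top)

theorem Linked.symm (h : Linked vol β γ) : Linked vol γ β := by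
  obtain ⟨w, hw, hws, hwd⟩ := h
  refine ⟨(-1 : ℝ) • w, hw.smul (-1), closure_smul_subset _ hws, ?_⟩
  rw [divergence_smul vol _ hw.one, hwd, neg_smul, one_smul, neg_sub]

theorem Linked.trans (h : Linked vol β γ) (h' : Linked vol γ δ) : Linked vol β δ := by
  obtain ⟨w, hw, hws, hwd⟩ := h
  obtain ⟨v, hv, hvs, hvd⟩ := h'
  refine ⟨w + v, IsCField.add hw hv, closure_add_subset hws hvs, ?_⟩
  rw [divergence_add vol hw.one hv.one, hwd, hvd, sub_add_sub_cancel]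

variable [T2Space M]

/-- Solving in the larger ball `β` with the bump function of `γ` as right-hand side does it: that
function has mass one, also when computed in the chart of `β`, so the remainder is exactly the bump
function of `β`. -/
theorem linked_of_subset (h : ∀ y ∈ Metric.closedBall γ.c (2 * γ.ρ), γ.chart.symm y ∈ β.region) :
    Linked vol γ β := by
  have hsub : γ.chart.symm '' Metric.closedBall γ.c γ.ρ ⊆ β.region := by
    rintro _ ⟨y, hy, rfl⟩
    exact h y (γ.closedBall_subset hy)
  have hdom : ∀ x, x ∉ A.dom γ.i → γ.bumpFun vol x = 0 := fun x hx => by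
    refine γ.bumpFun_eq_zero vol ?_
    rintro ⟨y, hy, rfl⟩
    exact hx (A.symm_mem_dom γ.i (γ.subset_ball (γ.closedBall_subset hy)))
  have hreg : ∀ x, x ∉ β.region → γ.bumpFun vol x = 0 := fun x hx =>
    γ.bumpFun_eq_zero vol fun hmem => hx (hsub hmem)
  have hts : tsupport (γ.bumpFun vol) ⊆ β.region := by
    refine (closure_minimal (fun x hx => ?_) (((isCompact_closedBall γ.c γ.ρ).image_of_continuousOn
      (γ.chart.continuousOn_symm.mono
        (γ.closedBall_subset.trans γ.closedBall_subset_target))).isClosed)).trans hsub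
    by_contra hne
    exact hx (γ.bumpFun_eq_zero vol hne)
  have hlift : ContDiff ℝ ∞ (β.lift vol (γ.bumpFun vol)) :=
    β.contDiff_lift vol (k := ⊤) (γ.contMDiff_bumpFun vol) hts
  have h0 : ∀ y, y ∉ Metric.closedBall β.c β.ρ → β.lift vol (γ.bumpFun vol) y = 0 :=
    fun y hy => β.lift_eq_zero vol hy
  refine ⟨β.solve vol (β.lift vol (γ.bumpFun vol)), contMDiff_infty.2 fun r =>
    β.isCField_solve vol (hlift.of_le (by exact_mod_cast le_top)) h0,
    β.closure_solve_subset vol h0, funext fun x => ?_⟩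
  rw [β.divergence_solve vol (hlift.of_le (by exact_mod_cast le_top)) h0, β.pullFun_lift vol hreg,
    β.integral_lift vol hreg, integral_chartIntegrand_eq (γ.contMDiff_bumpFun vol).continuous
      β.i γ.i (fun x hx => hreg x fun h => hx (β.region_subset_dom h)) hdom,
    γ.integral_bumpFun vol, one_mul, Pi.sub_apply]

/-- Both balls are linked to a small ball inside the intersection of their regions. -/
theorem linked_of_mem (hΩ : IsOpen Ω) {x : M} (hβ : x ∈ β.region) (hγ : x ∈ γ.region) :
    Linked vol β γ := by
  obtain ⟨δ, -, hδ⟩ := exists_localBall (A := A) hΩ (β.region_subset hβ)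
    (β.isOpen_region.inter γ.isOpen_region) ⟨hβ, hγ⟩
  exact (linked_of_subset fun y hy => (hδ y hy).1).symm.trans
    (linked_of_subset fun y hy => (hδ y hy).2)

/-- The relation on points, that any two balls around them are linked, holds locally and is
transitive and symmetric, so it holds throughout a preconnected set. -/
theorem linked_of_isPreconnected (vol : VolumeForm n M) (hΩ : IsOpen Ω) (hΩc : IsPreconnected Ω)
    (β γ : LocalBall A Ω) : Linked vol β γ := by
  have key := hΩc.induction₂ (fun x y => ∀ β γ : LocalBall A Ω, x ∈ β.region → y ∈ γ.region →
      Linked vol β γ) ?_ ?_ ?_ (β.region_subset β.symm_center_mem_region)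
      (γ.region_subset γ.symm_center_mem_region)
  · exact key β γ β.symm_center_mem_region γ.symm_center_mem_region
  · intro x hx
    obtain ⟨δ, hδ, -⟩ := exists_localBall (A := A) hΩ hx isOpen_univ trivial
    filter_upwards [nhdsWithin_le_nhds (δ.isOpen_region.mem_nhds hδ)] with y hy β γ hβ hγ
    exact (linked_of_mem hΩ hβ hδ).trans (linked_of_mem hΩ hy hγ)
  · intro x y z _ hy _ hxy hyz β γ hβ hγ
    obtain ⟨δ, hδ, -⟩ := exists_localBall (A := A) hΩ hy isOpen_univ trivial
    exact (hxy β δ hβ hδ).trans (hyz δ γ hδ hγ)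
  · intro x y _ _ hxy β γ hβ hγ
    exact (hxy γ β hγ hβ).symm

/-- The contribution of one ball to the solution operator. -/
def localSolution (vol : VolumeForm n M) (β : LocalBall A Ω) (χ : M → ℝ)
    (w : ∀ x : M, TangentSpace (𝓡 n) x) (h : M → ℝ) : ∀ x : M, TangentSpace (𝓡 n) x :=
  β.solve vol (β.lift vol (χ * h)) + (∫ y, β.lift vol (χ * h) y) • w

variable {χ h : M → ℝ} {w : ∀ x : M, TangentSpace (𝓡 n) x}

theorem contDiff_lift_mul (vol : VolumeForm n M) {r : ℕ} (hχ : ContMDiff (𝓡 n) 𝓘(ℝ, ℝ) ∞ χ)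
    (hχs : tsupport χ ⊆ β.region) (hh : ContMDiff (𝓡 n) 𝓘(ℝ, ℝ) r h) :
    ContDiff ℝ r (β.lift vol (χ * h)) :=
  β.contDiff_lift vol (k := r) ((hχ.of_le (by exact_mod_cast le_top)).mul hh)
    ((tsupport_mul_subset_left).trans hχs)

theorem isCField_localSolution {r : ℕ} (hχ : ContMDiff (𝓡 n) 𝓘(ℝ, ℝ) ∞ χ)
    (hχs : tsupport χ ⊆ β.region) (hw : IsCField ∞ w) (hh : ContMDiff (𝓡 n) 𝓘(ℝ, ℝ) r h) :
    IsCField r (localSolution vol β χ w h) :=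
  IsCField.add (k := r) (β.isCField_solve vol (contDiff_lift_mul vol hχ hχs hh)
    fun _ hy => β.lift_eq_zero vol hy)
    (IsCField.smul (k := r) _ (hw.of_le (by exact_mod_cast le_top)))

/-- The multiple of `w` exchanges the bump function of `β`, left over by `solve`, for that of the
common ball `γ`. -/
theorem divergence_localSolution (hχ : ContMDiff (𝓡 n) 𝓘(ℝ, ℝ) ∞ χ)
    (hχs : tsupport χ ⊆ β.region) (hw : IsCField ∞ w)
    (hwd : divergence vol w = β.bumpFun vol - γ.bumpFun vol)
    (hh : ContMDiff (𝓡 n) 𝓘(ℝ, ℝ) 1 h) (x : M) :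
    divergence vol (localSolution vol β χ w h) x =
      χ x * h x - (∫ y, β.lift vol (χ * h) y) * γ.bumpFun vol x := by
  have hh1 : ContMDiff (𝓡 n) 𝓘(ℝ, ℝ) (1 : ℕ) h := by exact_mod_cast hh
  have hl := contDiff_lift_mul vol hχ hχs hh1
  have h0 : ∀ y, y ∉ Metric.closedBall β.c β.ρ → β.lift vol (χ * h) y = 0 :=
    fun y hy => β.lift_eq_zero vol hy
  have hreg : ∀ x, x ∉ β.region → (χ * h) x = 0 := fun x hx => by
    rw [Pi.mul_apply, image_eq_zero_of_notMem_tsupport fun hmem => hx (hχs hmem), zero_mul]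
  have hs : IsCField 1 (β.solve vol (β.lift vol (χ * h))) := by
    exact_mod_cast β.isCField_solve vol hl h0
  rw [localSolution, divergence_add vol hs (IsCField.smul (k := 1) _ hw.one),
    divergence_smul vol _ hw.one, hwd, Pi.add_apply,
    β.divergence_solve vol (by exact_mod_cast hl) h0, β.pullFun_lift vol hreg]
  simp only [Pi.smul_apply, Pi.sub_apply, Pi.mul_apply, smul_eq_mul]
  ring

theorem integral_lift_mul (hΩ : IsOpen Ω) (hχ : ContMDiff (𝓡 n) 𝓘(ℝ, ℝ) ∞ χ)
    (hχs : tsupport χ ⊆ β.region) (hh : Continuous h) :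
    ∫ y, β.lift vol (χ * h) y = integral A vol Ω (χ * h) := by
  have hreg : ∀ x, x ∉ β.region → (χ * h) x = 0 := fun x hx => by
    rw [Pi.mul_apply, image_eq_zero_of_notMem_tsupport fun hmem => hx (hχs hmem), zero_mul]
  rw [β.integral_lift vol hreg, integral_eq_chartIntegrand hΩ (hχ.continuous.mul hh) β.i
    (fun x hx => hreg x fun h => hx (β.region_subset_dom h))
    fun x hx => hreg x fun h => hx (β.region_subset h)]

/-- The contribution of one ball to the solution operator, as a linear map. -/
def localSolutionLinear (vol : VolumeForm n M) (β : LocalBall A Ω) (Ω₁ : Set M) (χ : M → ℝ)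
    (w : ∀ x : M, TangentSpace (𝓡 n) x) (hχ : ContMDiff (𝓡 n) 𝓘(ℝ, ℝ) ∞ χ)
    (hχs : tsupport χ ⊆ β.region) (hw : IsCField ∞ w) (hws : closure {x | w x ≠ 0} ⊆ Ω) :
    sourceSpace A vol Ω₁ Ω →ₗ[ℝ] targetSpace (n := n) (M := M) Ω where
  toFun h := ⟨localSolution vol β χ w h, by
    have h1 : ContMDiff (𝓡 n) 𝓘(ℝ, ℝ) (1 : ℕ) (h : M → ℝ) := by exact_mod_cast h.2.1
    refine ⟨by exact_mod_cast isCField_localSolution hχ hχs hw h1, ?_⟩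
    exact closure_add_subset (β.closure_solve_subset vol fun _ hy => β.lift_eq_zero vol hy)
      (closure_smul_subset _ hws)⟩
  map_add' h h' := by
    have h1 : ∀ h : sourceSpace A vol Ω₁ Ω, ContDiff ℝ (1 : ℕ) (β.lift vol (χ * h)) := fun h =>
      contDiff_lift_mul vol hχ hχs (by exact_mod_cast h.2.1)
    have h2 : ∀ f : M → ℝ, ∀ y, y ∉ Metric.closedBall β.c β.ρ → β.lift vol f y = 0 :=
      fun f y hy => β.lift_eq_zero vol hy
    have hi : ∀ h : sourceSpace A vol Ω₁ Ω, Integrable (β.lift vol (χ * h)) := fun h =>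
      (h1 h).continuous.integrable_of_hasCompactSupport (β.hasCompactSupport_of_eq_zero (h2 _))
    refine Subtype.ext ?_
    change localSolution vol β χ w (h + h') = localSolution vol β χ w h + localSolution vol β χ w h'
    rw [localSolution, mul_add, β.lift_add, β.solve_add vol (h1 h).continuous (h2 _)
      (h1 h').continuous (h2 _), localSolution, localSolution]
    simp only [Pi.add_apply]
    rw [integral_add (hi h) (hi h'), add_smul]
    abel
  map_smul' t h := by
    refine Subtype.ext ?_
    change localSolution vol β χ w (t • (h : M → ℝ)) = t • localSolution vol β χ w h
    rw [localSolution, mul_smul_comm, β.lift_smul, β.solve_smul, localSolution, smul_add]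
    simp only [Pi.smul_apply]
    rw [integral_smul, smul_assoc]

/-- The term from `solve` is estimated through `lift_mul`. In the other term the field `w` is fixed
and smooth, and its scalar coefficient is at most a supremum times the volume `V` of the ball. -/
theorem exists_holderBound_localSolution (vol : VolumeForm n M)
    (hχ : ContMDiff (𝓡 n) 𝓘(ℝ, ℝ) ∞ χ) (hχs : tsupport χ ⊆ β.region) (hw : IsCField ∞ w)
    (k : Fin A.m) (r : ℕ) :
    ∃ C, 0 ≤ C ∧ ∀ (α N : ℝ) (h : M → ℝ), 0 ≤ α → α ≤ 1 → 0 ≤ N →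
      ContMDiff (𝓡 n) 𝓘(ℝ, ℝ) r h →
      HolderBound r α A.ball N (fun y => h (β.chart.symm y)) →
      HolderBound r α A.ball (C * N) (fieldInChart (localSolution vol β χ w h) (A.chart k)) := by
  obtain ⟨C₁, hC₁0, hC₁⟩ := HolderBound.exists_of_hasCompactSupport
    (β.contDiff_lift vol (k := ⊤) hχ hχs)
    (β.hasCompactSupport_of_eq_zero fun _ hy => β.lift_eq_zero vol hy) r
  obtain ⟨C₂, hC₂1, hC₂⟩ := HolderBound.exists_extend (F := ℝ) A.isOpen_ball
    (isCompact_closedBall β.c β.ρ) (β.closedBall_subset.trans β.subset_ball)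
  obtain ⟨C₃, hC₃0, hC₃⟩ := β.exists_holderBound_solve vol k r
  have hwk := contDiffOn_fieldInChart (A.mem_maximalAtlas k) (k := ⊤) isOpen_univ hw.contMDiffOn
  rw [Set.preimage_univ, Set.inter_univ] at hwk
  obtain ⟨C₄, hC₄0, hC₄⟩ := HolderBound.exists_of_contDiffOn (A.chart k).open_target
    (isCompact_closedBall 0 A.radius) A.isOpen_ball (convex_ball 0 A.radius)
    Metric.ball_subset_closedBall (A.closedBall_subset k) hwk r
  set B : ℝ →L[ℝ] ℝ →L[ℝ] ℝ := ContinuousLinearMap.mul ℝ ℝ with hB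
  set V := volume.real (Metric.closedBall β.c β.ρ) with hV
  have hC₂0 : 0 ≤ C₂ := zero_le_one.trans hC₂1
  set C₅ := C₂ * (2 ^ (r + 1) * ‖B‖ * C₁) with hC₅
  have hC₅0 : 0 ≤ C₅ := by positivity
  refine ⟨C₃ * C₅ + C₅ * V * C₄, by positivity, fun α N h hα0 hα hN hh hhb => ?_⟩
  have hl := contDiff_lift_mul vol hχ hχs hh
  have h0 : ∀ y, y ∉ Metric.closedBall β.c β.ρ → β.lift vol (χ * h) y = 0 :=
    fun y hy => β.lift_eq_zero vol hy
  have hhc : ContDiffOn ℝ r (fun y => h (β.chart.symm y)) A.ball :=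
    (LocalBall.contDiffOn_comp_symm (k := r) hh β.mem_maximalAtlas).mono (A.ball_subset β.i)
  have hchi : ContDiff ℝ r (β.lift vol χ) :=
    (β.contDiff_lift vol (k := ⊤) hχ hχs).of_le (by exact_mod_cast le_top)
  have b1 := HolderBound.bilin A.isOpen_ball B hC₁0 hN
    ((hC₁ α hα0 hα).mono_set (Set.subset_univ _)) hhb hchi.contDiffOn hhc
  have b2 : HolderBound r α Set.univ (C₅ * N) (β.lift vol (χ * h)) := by
    refine (hC₂ r α _ _ hα0 hα (by positivity) (closure_minimal (fun y hy => ?_)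
      Metric.isClosed_closedBall) (b1.congr A.isOpen_ball fun y _ => β.lift_mul vol χ h y)).mono
      (le_of_eq (by rw [hC₅]; ring))
    by_contra hne
    exact hy (h0 y hne)
  have b3 := hC₃ α _ _ hα0 hα (by positivity) hl h0 b2
  have hint : |∫ y, β.lift vol (χ * h) y| ≤ C₅ * N * V := by
    have hsupp : ∫ y, β.lift vol (χ * h) y =
        ∫ y in Metric.closedBall β.c β.ρ, β.lift vol (χ * h) y :=
      (setIntegral_eq_integral_of_forall_compl_eq_zero fun y hy => h0 y hy).symm
    rw [hsupp, ← Real.norm_eq_abs]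
    exact norm_setIntegral_le_of_norm_le_const (isCompact_closedBall _ _).measure_lt_top
      fun y _ => b2.norm_le trivial
  have hwk' : ContDiffOn ℝ r (fieldInChart w (A.chart k)) A.ball :=
    (hwk.mono (A.ball_subset k)).of_le (by exact_mod_cast le_top)
  have b4 := HolderBound.const_smul A.isOpen_ball (∫ y, β.lift vol (χ * h) y)
    (hC₄ α hα0 hα) hwk'
  have hsol := contDiffOn_fieldInChart (A.mem_maximalAtlas k) (k := r) isOpen_univ
    (β.isCField_solve vol hl h0).contMDiffOn
  rw [Set.preimage_univ, Set.inter_univ] at hsol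
  have b5 := HolderBound.add A.isOpen_ball b3 b4 (hsol.mono (A.ball_subset k))
    (hwk'.const_smul (∫ y, β.lift vol (χ * h) y))
  refine (b5.mono ?_).congr A.isOpen_ball fun y _ => ?_
  · have := mul_le_mul_of_nonneg_right hint hC₄0
    linarith
  · rw [localSolution, fieldInChart_add, fieldInChart_smul]
    rfl

end Assembly

/-! ### Partition of unity and the global operator -/

section Operator

set_option maxSynthPendingDepth 3
set_option linter.unusedSectionVars false

variable {n : ℕ} {M : Type*} [TopologicalSpace M] [ChartedSpace (Eucl n) M]
  [IsManifold (𝓡 n) ∞ M] [T2Space M] {A : RegularAtlas n M} {Ω : Set M}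

/-- A partition of unity on a closed subset of `Ω` that is subordinate to finitely many balls. -/
theorem exists_partition [CompactSpace M] (A : RegularAtlas n M) (hΩ : IsOpen Ω) {S : Set M}
    (hS : IsClosed S) (hSΩ : S ⊆ Ω) :
    ∃ (s : Finset M) (β : s → LocalBall A Ω) (χ : s → M → ℝ),
      (∀ j, ContMDiff (𝓡 n) 𝓘(ℝ, ℝ) ∞ (χ j)) ∧ (∀ j, tsupport (χ j) ⊆ (β j).region) ∧
      ∀ x ∈ S, ∑ j, χ j x = 1 := by
  have hβ : ∀ x : S, ∃ β : LocalBall A Ω, (x : M) ∈ β.region := fun x =>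
    (exists_localBall hΩ (hSΩ x.2) isOpen_univ trivial).imp fun _ h => h.1
  choose β hβ using hβ
  obtain ⟨t, ht⟩ := hS.isCompact.elim_finite_subcover (fun x : S => (β x).region)
    (fun x => (β x).isOpen_region) fun x hx => Set.mem_iUnion.2 ⟨⟨x, hx⟩, hβ _⟩
  classical
  set s : Finset M := t.map (Function.Embedding.subtype _) with hs
  have hst : ∀ j : s, ∃ x : S, x ∈ t ∧ (x : M) = j := fun j => by
    obtain ⟨x, hx, hxj⟩ := Finset.mem_map.1 j.2
    exact ⟨x, hx, hxj⟩
  -- `g` returns the point of `S` behind an index, and with it the chosen ball.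
  choose g hgt hg using hst
  obtain ⟨f, hf⟩ := SmoothPartitionOfUnity.exists_isSubordinate (𝓡 n) hS
    (fun j : s => (β (g j)).region) (fun j => (β (g j)).isOpen_region) fun x hx => by
      obtain ⟨y, hy, hxy⟩ := Set.mem_iUnion₂.1 (ht hx)
      have hys : (y : M) ∈ s := Finset.mem_map.2 ⟨y, hy, rfl⟩
      have hgy : g ⟨y, hys⟩ = y := Subtype.ext (hg ⟨y, hys⟩)
      exact Set.mem_iUnion.2 ⟨⟨y, hys⟩, by rw [hgy]; exact hxy⟩
  refine ⟨s, fun j => β (g j), fun j => f j, fun j => (f j).contMDiff, hf, fun x hx => ?_⟩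
  rw [← finsum_eq_sum_of_fintype]
  exact f.sum_eq_one hx

theorem funNorm_lt_top {r : ℕ} {α : ℝ≥0} {h : M → ℝ} (hh : FunIsHolder A r α h) :
    funNorm A r α h < ⊤ := by
  rw [funNorm]
  refine (iSup_le fun i => Finset.le_sup (f := fun i => holderNormOn A.ball r α
    fun y => h ((A.chart i).symm y)) (Finset.mem_univ i)).trans_lt
    ((Finset.sup_lt_iff ENNReal.zero_lt_top).2 fun i _ => ?_)
  exact holderNormOn_lt_top (A.chart i).open_target (isCompact_closedBall 0 A.radius)
    Metric.ball_subset_closedBall (A.closedBall_subset i)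
    (LocalBall.contDiffOn_comp_symm (k := r) hh.1 (A.mem_maximalAtlas i)) (hh.2 i)

theorem FunIsHolder.holderBound {r : ℕ} {α : ℝ≥0} (hα : α ≤ 1) {h : M → ℝ}
    (hh : FunIsHolder A r α h) (i : Fin A.m) :
    HolderBound r α A.ball (2 * (funNorm A r α h).toReal * max 1 (2 * A.radius))
      fun y => h ((A.chart i).symm y) := by
  refine HolderBound.of_holderNormOn_le ENNReal.toReal_nonneg hα
    ((LocalBall.contDiffOn_comp_symm (k := r) hh.1 (A.mem_maximalAtlas i)).mono (A.ball_subset i))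
    (hh.2 i) ?_
  rw [ENNReal.ofReal_toReal (funNorm_lt_top hh).ne]
  exact le_iSup (fun i => holderNormOn A.ball r α fun y => h ((A.chart i).symm y)) i

theorem fieldIsHolder_of_holderBound {r : ℕ} {α : ℝ≥0} {v : ∀ x : M, TangentSpace (𝓡 n) x}
    {K : ℝ} (hv : IsCField r v)
    (hK : ∀ i, HolderBound r α A.ball K (fieldInChart v (A.chart i))) :
    FieldIsHolder A r α v ∧ fieldNorm A r α v ≤ ENNReal.ofReal K :=
  ⟨⟨hv, fun i => (hK i).holderDeriv⟩, iSup_le fun i => (hK i).holderNormOn_le⟩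

/-- The functions `χ j * h` add up to `h` everywhere, since `h` vanishes off `closure Ω₁`. The
coefficients of the common bump function therefore add up to the integral of `h` over `Ω`, which is
zero. -/
theorem divergence_sum_localSolution (vol : VolumeForm n M) (hΩ : IsOpen Ω) {Ω₁ : Set M}
    {ι : Type*} [Fintype ι] {β : ι → LocalBall A Ω} {γ : LocalBall A Ω} {χ : ι → M → ℝ}
    {w : ι → ∀ x : M, TangentSpace (𝓡 n) x} (hχ : ∀ j, ContMDiff (𝓡 n) 𝓘(ℝ, ℝ) ∞ (χ j))
    (hχs : ∀ j, tsupport (χ j) ⊆ (β j).region) (hχ1 : ∀ x ∈ closure Ω₁, ∑ j, χ j x = 1)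
    (hw : ∀ j, IsCField ∞ (w j))
    (hwd : ∀ j, divergence vol (w j) = (β j).bumpFun vol - γ.bumpFun vol) {h : M → ℝ}
    (hh : h ∈ sourceSpace A vol Ω₁ Ω) :
    divergence vol (∑ j, localSolution vol (β j) (χ j) (w j) h) = h := by
  obtain ⟨hh1, hint, hsupp⟩ := hh
  have hsum : ∀ x, ∑ j, χ j x * h x = h x := fun x => by
    by_cases hx : x ∈ closure Ω₁
    · rw [← Finset.sum_mul, hχ1 x hx, one_mul]
    · have h0 : h x = 0 :=
        image_eq_zero_of_notMem_tsupport fun hmem => hx (subset_closure (hsupp hmem))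
      simp [h0]
  have hzero : ∑ j, ∫ y, (β j).lift vol (χ j * h) y = 0 := by
    simp_rw [fun j => integral_lift_mul (vol := vol) hΩ (hχ j) (hχs j) hh1.continuous]
    rw [← integral_sum Ω Finset.univ fun j _ => (hχ j).continuous.mul hh1.continuous]
    simp only [Pi.mul_apply, hsum]
    exact hint
  funext x
  rw [divergence_sum vol _ fun j _ => by
    exact_mod_cast isCField_localSolution (r := 1) (hχ j) (hχs j) (hw j) (by exact_mod_cast hh1),
    Finset.sum_apply]
  simp_rw [fun j => divergence_localSolution (hχ j) (hχs j) (hw j) (hwd j) hh1 x]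
  rw [Finset.sum_sub_distrib, hsum, ← Finset.sum_mul, hzero, zero_mul, sub_zero]

theorem exists_holderBound_sum_localSolution (vol : VolumeForm n M)
    {ι : Type*} [Fintype ι] {β : ι → LocalBall A Ω} {χ : ι → M → ℝ}
    {w : ι → ∀ x : M, TangentSpace (𝓡 n) x} (hχ : ∀ j, ContMDiff (𝓡 n) 𝓘(ℝ, ℝ) ∞ (χ j))
    (hχs : ∀ j, tsupport (χ j) ⊆ (β j).region) (hw : ∀ j, IsCField ∞ (w j)) (r : ℕ) :
    ∃ C, 0 ≤ C ∧ ∀ (α : ℝ≥0) (h : M → ℝ), α ≤ 1 → FunIsHolder A r α h → ∀ k,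
      HolderBound r α A.ball (C * (funNorm A r α h).toReal)
        (fieldInChart (∑ j, localSolution vol (β j) (χ j) (w j) h) (A.chart k)) := by
  choose C hC0 hC using fun j k =>
    exists_holderBound_localSolution vol (hχ j) (hχs j) (hw j) k r
  have hR : 0 ≤ max 1 (2 * A.radius) := zero_le_one.trans (le_max_left _ _)
  -- Summing also over `k` gives one constant for all charts; the last factor is the price of
  -- passing from `funNorm` to `HolderBound`, with `2 * A.radius` bounding the diameter of `A.ball`.
  refine ⟨(∑ j, ∑ k, C j k) * (2 * max 1 (2 * A.radius)),
    mul_nonneg (Finset.sum_nonneg fun j _ => Finset.sum_nonneg fun k _ => hC0 j k) (by positivity),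
    fun α h hα hh k => ?_⟩
  set N := 2 * (funNorm A r α h).toReal * max 1 (2 * A.radius) with hN
  have hN0 : 0 ≤ N := mul_nonneg (mul_nonneg zero_le_two ENNReal.toReal_nonneg) hR
  have hf : ∀ j, ContDiffOn ℝ r (fieldInChart (localSolution vol (β j) (χ j) (w j) h) (A.chart k))
      A.ball := fun j => by
    have := contDiffOn_fieldInChart (A.mem_maximalAtlas k) (k := r) isOpen_univ
      (isCField_localSolution (vol := vol) (hχ j) (hχs j) (hw j) hh.1).contMDiffOn
    rw [Set.preimage_univ, Set.inter_univ] at this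
    exact this.mono (A.ball_subset k)
  have hb := HolderBound.sum A.isOpen_ball Finset.univ (fun j _ => hC j k α N h α.coe_nonneg
    (by exact_mod_cast hα) hN0 hh.1 (hh.holderBound hα (β j).i)) fun j _ => hf j
  have hle : ∑ j, C j k * N ≤
      (∑ j, ∑ k, C j k) * (2 * max 1 (2 * A.radius)) * (funNorm A r α h).toReal := by
    calc ∑ j, C j k * N = (∑ j, C j k) * N := (Finset.sum_mul _ _ _).symm
      _ ≤ (∑ j, ∑ k, C j k) * N := mul_le_mul_of_nonneg_right (Finset.sum_le_sum fun j _ =>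
          Finset.single_le_sum (f := fun k => C j k) (fun k _ => hC0 j k) (Finset.mem_univ k)) hN0
      _ = _ := by rw [hN]; ring
  refine (hb.mono hle).congr A.isOpen_ball fun y _ => ?_
  rw [fieldInChart_sum, Finset.sum_apply]

end Operator

end DivEq

end

/-! ### The main theorem -/

theorem lemma1 {n : ℕ} (hn : 2 ≤ n) {M : Type*} [TopologicalSpace M]
    [ChartedSpace (DivEq.Eucl n) M] [IsManifold (𝓡 n) ∞ M]
    [T2Space M] [CompactSpace M] [ConnectedSpace M]
    (vol : DivEq.VolumeForm n M) (A : DivEq.RegularAtlas n M)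
    (Ω₁ Ω : Set M) (hΩ₁ : IsOpen Ω₁) (hΩ₁c : IsConnected Ω₁)
    (hΩ : IsOpen Ω) (hΩc : IsConnected Ω) (hsub : closure Ω₁ ⊆ Ω) :
    ∃ Φ : DivEq.sourceSpace A vol Ω₁ Ω →ₗ[ℝ] DivEq.targetSpace (n := n) Ω,
      (∀ h, DivEq.divergence vol (Φ h : ∀ x : M, TangentSpace (𝓡 n) x) = (h : M → ℝ)) ∧
      ∀ r : ℕ, 1 ≤ r → ∃ C : ℝ, 1 ≤ C ∧ ∀ α : ℝ≥0, α ≤ 1 →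
        ∀ h : DivEq.sourceSpace A vol Ω₁ Ω, DivEq.FunIsHolder A r α (h : M → ℝ) →
          DivEq.FieldIsHolder A r α (Φ h : ∀ x : M, TangentSpace (𝓡 n) x) ∧
          DivEq.fieldNorm A r α (Φ h : ∀ x : M, TangentSpace (𝓡 n) x) ≤
            ENNReal.ofReal C * DivEq.funNorm A r α (h : M → ℝ) := by
  obtain ⟨s, β, χ, hχ, hχs, hχ1⟩ := DivEq.exists_partition A hΩ isClosed_closure hsub
  obtain ⟨x₀, hx₀⟩ := hΩc.nonempty
  obtain ⟨γ, -⟩ := DivEq.exists_localBall (A := A) hΩ hx₀ isOpen_univ trivial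
  choose w hw hws hwd using fun j =>
    DivEq.linked_of_isPreconnected vol hΩ hΩc.isPreconnected (β j) γ
  -- The balls, the partition and the linking fields are all fixed before `r` and `α`, so a single
  -- operator serves every class.
  set Φ : DivEq.sourceSpace A vol Ω₁ Ω →ₗ[ℝ] DivEq.targetSpace (n := n) (M := M) Ω :=
    ∑ j, DivEq.localSolutionLinear vol (β j) Ω₁ (χ j) (w j) (hχ j) (hχs j) (hw j) (hws j) with hΦ
  have hcoe : ∀ h, (Φ h : ∀ x : M, TangentSpace (𝓡 n) x) =
      ∑ j, DivEq.localSolution vol (β j) (χ j) (w j) h := fun h => by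
    rw [hΦ, LinearMap.sum_apply, Submodule.coe_sum]
    rfl
  refine ⟨Φ, fun h => ?_, fun r _ => ?_⟩
  · rw [hcoe]
    exact DivEq.divergence_sum_localSolution vol hΩ hχ hχs hχ1 hw hwd h.2
  · obtain ⟨C, hC0, hC⟩ := DivEq.exists_holderBound_sum_localSolution vol hχ hχs hw r
    -- The summand `1` only serves to make the constant at least one.
    refine ⟨1 + C, by linarith, fun α hα h hh => ?_⟩
    rw [hcoe]
    have hv : DivEq.IsCField r (∑ j, DivEq.localSolution vol (β j) (χ j) (w j) h) :=
      DivEq.IsCField.sum (k := r) _ fun j _ =>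
        DivEq.isCField_localSolution (hχ j) (hχs j) (hw j) hh.1
    refine (DivEq.fieldIsHolder_of_holderBound hv (hC α h hα hh)).imp_right fun hle => hle.trans ?_
    rw [ENNReal.ofReal_mul hC0, ENNReal.ofReal_toReal (DivEq.funNorm_lt_top hh).ne]
    gcongr
    linarith
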